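/- **Setting.** Let $\Lambda$ be a nonempty finite $k$-graph (a small category with a functor $d:\Lambda\to\mathbb N^k$ having the factorisation property: whenever $d(\lambda)=m+n$ there are unique $\mu,\nu$ with $\lambda=\mu\nu$, $d(\mu)=m$, $d(\nu)=n$; finite means that $\Lambda^n:=d^{-1}(n)$ is finite for every $n$), with range and source maps $r,s$ and vertex set $\Lambda^0$. Suppose $\Lambda$ has no sources (for all $v\in\Lambda^0$ and $n\in\mathbb N^k$ there is a path of degree $n$ with range $v$) and is coordinatewise irreducible: each vertex matrix $A_i$, with entries $A_i(v,w)=|\{\lambda: d(\lambda)=e_i,\ r(\lambda)=v,\ s(\lambda)=w\}|$, is irreducible. Let $\rho(A_i)$ be its spectral radius. Let $\{1,\dots,k\}=J\sqcup K$ with $J,K$ nonempty and let $r\in(0,\infty)^k$ satisfy $r_j>\ln\rho(A_j)$ for $j\in J$ and $r_i=\ln\rho(A_i)$ for $i\in K$. Set $C_J=\prod_{j\in J}(1-e^{-r_j}\rho(A_j))$. **Paths.** For $n\in(\mathbb N\cup\{\infty\})^k$ a path $x$ of degree $d(x)=n$ is a degree-preserving functor $x:\Omega_{k,n}\to\Lambda$,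 where $\Omega_{k,n}$ is the $k$-graph of pairs $(p,q)\in\mathbb N^k\times\mathbb N^k$ with $p\le q\le n$, $d(p,q)=q-p$, range $p$ and source $q$. Write $Z(\lambda)=\{x: x(0,d(\lambda))=\lambda\}$; the set $W_\Lambda$ of all paths has the topology generated by the sets $Z(\lambda)\setminus\bigcup_{\alpha\in G}Z(\lambda\alpha)$ with $G$ a finite set of paths with range $s(\lambda)$. For $m\in\mathbb N^J$ let $\Lambda^{m,\infty_K}$ be the set of $x$ with $d(x)_J=m$ and $d(x)_i=\infty$ for $i\in K$, and let $\partial^K\Lambda=\bigcup_{m\in\mathbb N^J}\Lambda^{m,\infty_K}$, with the relative topology of $W_\Lambda$ and its Borel sets. **Algebra.** A Toeplitz–Cuntz–Krieger $\Lambda$-family consists of partial isometries $T_\lambda$ such that the $T_v$ ($v\in\Lambda^0$) are mutually orthogonal projections, $T_\lambda T_\mu=T_{\lambda\mu}$ if $s(\lambda)=r(\mu)$, $T_\lambda^*T_\lambda=T_{s(\lambda)}$, $T_v\ge\sum_{r(\lambda)=v,\,d(\lambda)=n}T_\lambda T_\lambda^*$ for $v\in\Lambda^0$, $n\in\mathbb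 N^k$, and $T_\mu^*T_\nu=\sum T_\eta T_\zeta^*$, the sum over all $(\eta,\zeta)$ with $\mu\eta=\nu\zeta$ and $d(\mu\eta)=d(\mu)\vee d(\nu)$. Let $\mathcal TC^*(\Lambda)$ be the $C^*$-algebra generated by a universal such family $\{t_\lambda\}$, let $\gamma$ be its gauge action of $\mathbb T^k$, $\gamma_z(t_\lambda)=z^{d(\lambda)}t_\lambda$, let $\Phi^\gamma(a)=\int_{\mathbb T^k}\gamma_z(a)\,dz$ (normalised Haar measure), and let $\alpha^r_t=\gamma_{e^{itr}}$. A KMS$_1$ state of $(\mathcal TC^*(\Lambda),\alpha^r)$ is a state $\phi$ with $\phi(ab)=\phi(b\,\alpha^r_{i}(a))$ for all analytic $a,b$. Let $\{\xi_x\}$ be the orthonormal basis of point masses of $\ell^2(\partial^K\Lambda)$, and let $\pi^K:\mathcal TC^*(\Lambda)\to B(\ell^2(\partial^K\Lambda))$ be the representation such that $\pi^K(t_\lambda)\xi_x=\xi_{\lambda x}$ if $s(\lambda)=r(x)$ and $\pi^K(t_\lambda)\xi_x=0$ otherwise. **Statement.** There is a common unimodular Perron–Frobenius eigenvector $\kappa$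 of the $A_i$ (that is, $\kappa_v>0$ for all $v$, $\sum_v\kappa_v=1$, and $A_i\kappa=\rho(A_i)\kappa$ for all $i$). There are Borel measures $\nu^m$, $m\in\mathbb N^J$, on $\partial^K\Lambda$, with $\nu^m$ concentrated on $\Lambda^{m,\infty_K}$, such that $\nu^m(Z(\lambda)\cap\partial^K\Lambda)=e^{-r\cdot d(\lambda)}C_J\,\kappa_{s(\lambda)}$ for all $\lambda\in\Lambda$ with $d(\lambda)_J=m$. There is a KMS$_1$ state $\phi$ of $(\mathcal TC^*(\Lambda),\alpha^r)$ with $$\phi(a)=\sum_{m\in\mathbb N^J}\int\big(\pi^K(\Phi^\gamma(a))\xi_x\mid\xi_x\big)\,d\nu^m(x)\quad(a\in\mathcal TC^*(\Lambda)),\qquad \phi(t_\sigma t_\tau^*)=\delta_{\sigma,\tau}\,e^{-r\cdot d(\sigma)}\kappa_{s(\sigma)}\quad(\sigma,\tau\in\Lambda).$$ For this state $\phi$ there is a Borel probability measure $\mu$ on $\partial^K\Lambda$ such that, for every $a\in\mathcal TC^*(\Lambda)$, the function $x\mapsto\big(\pi^K(\Phi^\gamma(a))\xi_x\mid\xi_x\big)$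 is $\mu$-integrable and $$\phi(a)=\int_{\partial^K\Lambda}\big(\pi^K(\Phi^\gamma(a))\xi_x\mid\xi_x\big)\,d\mu(x).$$ In particular, $\phi(t_\sigma t_\sigma^*)=\mu(Z(\sigma)\cap\partial^K\Lambda)$ for every $\sigma\in\Lambda$. -/

import Mathlib

open scoped ENNReal

universe u v

/-- A `k`-graph: a small category with object set `V` (the vertices) and morphism set `Path`,
range and source maps `r`, `s`, composition `comp a b` defined when `s a = r b`, and a degree
functor `d` to `ℕ ^ k` with the factorisation property. -/
structure KGraph (k : ℕ) where
  V : Type u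
  Path : Type u
  r : Path → V
  s : Path → V
  id : V → Path
  comp : (a b : Path) → s a = r b → Path
  d : Path → Fin k → ℕ
  r_id : ∀ v, r (id v) = v
  s_id : ∀ v, s (id v) = v
  r_comp : ∀ a b h, r (comp a b h) = r a
  s_comp : ∀ a b h, s (comp a b h) = s b
  id_comp : ∀ a, comp (id (r a)) a (s_id (r a)) = a
  comp_id : ∀ a, comp a (id (s a)) (r_id (s a)).symm = a
  assoc : ∀ a b c (h₁ : s a = r b) (h₂ : s b = r c),
    comp (comp a b h₁) c ((s_comp a b h₁).trans h₂) =
      comp a (comp b c h₂) (h₁.trans (r_comp b c h₂).symm)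
  d_id : ∀ v, d (id v) = 0
  d_comp : ∀ a b h, d (comp a b h) = d a + d b
  factorisation : ∀ (c : Path) (m n : Fin k → ℕ), d c = m + n →
    ∃! p : Path × Path, d p.1 = m ∧ d p.2 = n ∧ ∃ h : s p.1 = r p.2, comp p.1 p.2 h = c

namespace KGraph

variable {k : ℕ}

/-- A `k`-graph is finite if `Λ^n = d⁻¹(n)` is finite for every `n ∈ ℕ ^ k`. -/
class IsFinite (Λ : KGraph.{u} k) : Prop where
  finite_degree : ∀ n : Fin k → ℕ, {a : Λ.Path | Λ.d a = n}.Finite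

/-- `v Λ^n`, the paths of degree `n` with range `v`. -/
def pathsFrom (Λ : KGraph.{u} k) (v : Λ.V) (n : Fin k → ℕ) : Set Λ.Path :=
  {a | Λ.r a = v ∧ Λ.d a = n}

/-- `Λ` has no sources if `v Λ^n` is nonempty for all `v` and `n`. -/
def NoSources (Λ : KGraph.{u} k) : Prop :=
  ∀ (v : Λ.V) (n : Fin k → ℕ), (Λ.pathsFrom v n).Nonempty

/-- `Λ^min(μ, ν)`: the pairs `(η, ζ)` with `μ η = ν ζ` and `d (μ η) = d μ ⊔ d ν`. -/
def minExt (Λ : KGraph.{u} k) (a b : Λ.Path) : Set (Λ.Path × Λ.Path) :=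
  {p | ∃ (h₁ : Λ.s a = Λ.r p.1) (h₂ : Λ.s b = Λ.r p.2),
    Λ.comp a p.1 h₁ = Λ.comp b p.2 h₂ ∧ Λ.d (Λ.comp a p.1 h₁) = Λ.d a ⊔ Λ.d b}

/-! ### Consequences of the factorisation property -/

section Factor

variable (Λ : KGraph.{u} k)

theorem cancel {a b a' b' : Λ.Path} (h : Λ.s a = Λ.r b) (h' : Λ.s a' = Λ.r b')
    (e : Λ.comp a b h = Λ.comp a' b' h') (hd : Λ.d a = Λ.d a') : a = a' ∧ b = b' := by
  have hb : Λ.d b = Λ.d b' := by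
    have := Λ.d_comp a b h
    rw [e, Λ.d_comp, hd] at this
    exact (add_left_cancel this).symm
  obtain ⟨p, -, hu⟩ := Λ.factorisation (Λ.comp a b h) (Λ.d a) (Λ.d b) (Λ.d_comp a b h)
  have e₁ := hu (a, b) ⟨rfl, rfl, h, rfl⟩
  have e₂ := hu (a', b') ⟨hd.symm, hb.symm, h', e.symm⟩
  have := e₁.trans e₂.symm
  exact ⟨congrArg Prod.fst this, congrArg Prod.snd this⟩

theorem eq_id_of_d_eq_zero {a : Λ.Path} (h : Λ.d a = 0) : a = Λ.id (Λ.r a) :=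
  (Λ.cancel (Λ.r_id (Λ.s a)).symm (Λ.s_id (Λ.r a)) ((Λ.comp_id a).trans (Λ.id_comp a).symm)
    (by rw [h, Λ.d_id])).1

theorem exists_factor (a : Λ.Path) (n : Fin k → ℕ) :
    ∃ p : Λ.Path × Λ.Path, n ≤ Λ.d a →
      Λ.d p.1 = n ∧ ∃ h : Λ.s p.1 = Λ.r p.2, Λ.comp p.1 p.2 h = a := by
  by_cases hn : n ≤ Λ.d a
  · obtain ⟨p, ⟨h₁, -, h₂⟩, -⟩ := Λ.factorisation a n (Λ.d a - n) (by
      funext i; have := hn i; simp only [Pi.add_apply, Pi.sub_apply]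
      exact (Nat.add_sub_of_le this).symm)
    exact ⟨p, fun _ => ⟨h₁, h₂⟩⟩
  · exact ⟨(a, a), fun h => absurd h hn⟩

/-- The initial segment `a(0, n)` of `a`, for `n ≤ d a`. -/
noncomputable def take (a : Λ.Path) (n : Fin k → ℕ) : Λ.Path :=
  (Λ.exists_factor a n).choose.1

/-- The final segment `a(n, d a)` of `a`, for `n ≤ d a`. -/
noncomputable def drop (a : Λ.Path) (n : Fin k → ℕ) : Λ.Path :=
  (Λ.exists_factor a n).choose.2

/-- The segment `a(p, q)` of `a`, for `p ≤ q ≤ d a`. -/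
noncomputable def seg (a : Λ.Path) (p q : Fin k → ℕ) : Λ.Path := Λ.drop (Λ.take a q) p

theorem d_take {a : Λ.Path} {n : Fin k → ℕ} (hn : n ≤ Λ.d a) : Λ.d (Λ.take a n) = n :=
  ((Λ.exists_factor a n).choose_spec hn).1

theorem take_drop {a : Λ.Path} {n : Fin k → ℕ} (hn : n ≤ Λ.d a) :
    ∃ h : Λ.s (Λ.take a n) = Λ.r (Λ.drop a n), Λ.comp (Λ.take a n) (Λ.drop a n) h = a :=
  ((Λ.exists_factor a n).choose_spec hn).2

theorem d_drop {a : Λ.Path} {n : Fin k → ℕ} (hn : n ≤ Λ.d a) :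
    Λ.d (Λ.drop a n) = Λ.d a - n := by
  obtain ⟨h, e⟩ := Λ.take_drop hn
  have := congrArg Λ.d e
  rw [Λ.d_comp, Λ.d_take hn] at this
  rw [← this, add_tsub_cancel_left]

theorem r_take {a : Λ.Path} {n : Fin k → ℕ} (hn : n ≤ Λ.d a) : Λ.r (Λ.take a n) = Λ.r a := by
  obtain ⟨h, e⟩ := Λ.take_drop hn
  conv_rhs => rw [← e]
  rw [Λ.r_comp]

theorem take_drop_comp (a b : Λ.Path) (h : Λ.s a = Λ.r b) :
    Λ.take (Λ.comp a b h) (Λ.d a) = a ∧ Λ.drop (Λ.comp a b h) (Λ.d a) = b := by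
  have hle : Λ.d a ≤ Λ.d (Λ.comp a b h) := by rw [Λ.d_comp]; exact le_self_add
  obtain ⟨h', e⟩ := Λ.take_drop hle
  exact Λ.cancel h' h e (Λ.d_take hle)

theorem take_comp {a b : Λ.Path} (h : Λ.s a = Λ.r b) {n : Fin k → ℕ} (hn : n ≤ Λ.d a) :
    Λ.take (Λ.comp a b h) n = Λ.take a n := by
  have hle : n ≤ Λ.d (Λ.comp a b h) := by rw [Λ.d_comp]; exact hn.trans le_self_add
  obtain ⟨h₁, e₁⟩ := Λ.take_drop hn
  obtain ⟨h₂, e₂⟩ := Λ.take_drop hle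
  have h₃ : Λ.s (Λ.drop a n) = Λ.r b := by rw [← h, ← Λ.s_comp _ _ h₁, e₁]
  have key : Λ.comp (Λ.take a n) (Λ.comp (Λ.drop a n) b h₃)
      (h₁.trans (Λ.r_comp _ _ h₃).symm) = Λ.comp a b h := by
    rw [← Λ.assoc _ _ _ h₁ h₃]; congr 1
  exact (Λ.cancel h₂ _ (e₂.trans key.symm) (by rw [Λ.d_take hle, Λ.d_take hn])).1

theorem take_take {a : Λ.Path} {m n : Fin k → ℕ} (hmn : m ≤ n) (hn : n ≤ Λ.d a) :
    Λ.take (Λ.take a n) m = Λ.take a m := by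
  obtain ⟨h, e⟩ := Λ.take_drop hn
  conv_rhs => rw [← e]
  rw [Λ.take_comp h (by rwa [Λ.d_take hn])]

theorem take_d (a : Λ.Path) : Λ.take a (Λ.d a) = a := by
  have := (Λ.take_drop_comp a (Λ.id (Λ.s a)) (Λ.r_id _).symm).1
  rwa [Λ.comp_id] at this

theorem take_zero (a : Λ.Path) : Λ.take a 0 = Λ.id (Λ.r a) := by
  have := (Λ.take_drop_comp (Λ.id (Λ.r a)) a (Λ.s_id _)).1
  rwa [Λ.id_comp, Λ.d_id] at this

theorem drop_zero (a : Λ.Path) : Λ.drop a 0 = a := by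
  have := (Λ.take_drop_comp (Λ.id (Λ.r a)) a (Λ.s_id _)).2
  rwa [Λ.id_comp, Λ.d_id] at this

theorem d_seg {a : Λ.Path} {p q : Fin k → ℕ} (hpq : p ≤ q) (hq : q ≤ Λ.d a) :
    Λ.d (Λ.seg a p q) = q - p := by
  rw [seg, Λ.d_drop (by rwa [Λ.d_take hq]), Λ.d_take hq]

theorem seg_comp {a : Λ.Path} {p q t : Fin k → ℕ} (hpq : p ≤ q) (hqt : q ≤ t)
    (ht : t ≤ Λ.d a) :
    ∃ h : Λ.s (Λ.seg a p q) = Λ.r (Λ.seg a q t),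
      Λ.comp (Λ.seg a p q) (Λ.seg a q t) h = Λ.seg a p t := by
  have hq := hqt.trans ht
  obtain ⟨h₁, e₁⟩ := Λ.take_drop (a := Λ.take a t) (n := q) (by rwa [Λ.d_take ht])
  obtain ⟨h₂, e₂⟩ := Λ.take_drop (a := Λ.take a q) (n := p) (by rwa [Λ.d_take hq])
  obtain ⟨h₃, e₃⟩ := Λ.take_drop (a := Λ.take a t) (n := p) (by rw [Λ.d_take ht]; exact hpq.trans hqt)
  have tq := Λ.take_take hqt ht
  have tp := Λ.take_take (hpq.trans hqt) ht
  have tp' := Λ.take_take hpq hq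
  have hs : Λ.s (Λ.seg a p q) = Λ.r (Λ.seg a q t) := by
    rw [seg, seg, ← h₁, tq, ← Λ.s_comp _ _ h₂, e₂]
  refine ⟨hs, ?_⟩
  have h₂' : Λ.s (Λ.take (Λ.take a q) p) = Λ.r (Λ.seg a p q) := h₂
  have key : Λ.comp (Λ.take (Λ.take a q) p) (Λ.comp (Λ.seg a p q) (Λ.seg a q t) hs)
      (h₂'.trans (Λ.r_comp _ _ hs).symm) = Λ.take a t := by
    rw [← Λ.assoc _ _ _ h₂' hs]
    conv_rhs => rw [← e₁]
    congr 1
    exact e₂.trans tq.symm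
  exact (Λ.cancel _ h₃ (key.trans e₃.symm) (by rw [tp, tp'])).2

theorem seg_congr_take {a b : Λ.Path} {p q : Fin k → ℕ} (h : Λ.take a q = Λ.take b q) :
    Λ.seg a p q = Λ.seg b p q := by rw [seg, seg, h]

end Factor

/-! ### Morphisms and the path space -/

/-- Coordinatewise inclusion of `ℕ ^ k` in `(ℕ ∪ {∞}) ^ k`. -/
def castDeg (n : Fin k → ℕ) : Fin k → ℕ∞ := fun i => (n i : ℕ∞)

theorem castDeg_le {m n : Fin k → ℕ} : castDeg m ≤ castDeg n ↔ m ≤ n := by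
  simp [castDeg, Pi.le_def]

theorem castDeg_mono {m n : Fin k → ℕ} (h : m ≤ n) : castDeg m ≤ castDeg n := castDeg_le.2 h

/-- The `k`-graph `Ω_{k,n}`, for `n ∈ (ℕ ∪ {∞}) ^ k`: its paths are the pairs `(p, q)` with
`p ≤ q ≤ n`, with range `p`, source `q` and degree `q - p`. -/
def Omega (n : Fin k → ℕ∞) : KGraph.{0} k where
  V := {p : Fin k → ℕ // castDeg p ≤ n}
  Path := {e : {p : Fin k → ℕ // castDeg p ≤ n} × {p : Fin k → ℕ // castDeg p ≤ n} //
    e.1.1 ≤ e.2.1}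
  r e := e.1.1
  s e := e.1.2
  id v := ⟨(v, v), le_rfl⟩
  comp a b h := ⟨(a.1.1, b.1.2), a.2.trans (by rw [h]; exact b.2)⟩
  d e := e.1.2.1 - e.1.1.1
  r_id _ := rfl
  s_id _ := rfl
  r_comp _ _ _ := rfl
  s_comp _ _ _ := rfl
  id_comp _ := rfl
  comp_id _ := rfl
  assoc _ _ _ _ _ := rfl
  d_id v := by simp
  d_comp a b h := by
    funext i
    have h₁ := a.2 i
    have h₂ := b.2 i
    have h₃ := congrFun (congrArg Subtype.val h) i
    simp only [Pi.sub_apply, Pi.add_apply] at *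
    omega
  factorisation := by
    rintro ⟨⟨⟨p, hp⟩, ⟨q, hq⟩⟩, hpq⟩ m l hd
    simp only at hpq hd
    have hqe : q = p + m + l := by
      funext i
      have h₁ := hpq i
      have h₂ := congrFun hd i
      simp only [Pi.sub_apply, Pi.add_apply] at *
      omega
    have hpm : p + m ≤ q := by rw [hqe]; exact le_self_add
    refine ⟨(⟨(⟨p, hp⟩, ⟨p + m, (castDeg_mono hpm).trans hq⟩), le_self_add⟩,
      ⟨(⟨p + m, (castDeg_mono hpm).trans hq⟩, ⟨q, hq⟩), hpm⟩),
      ⟨by simp, by simp [hqe], rfl, rfl⟩, ?_⟩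
    rintro ⟨⟨⟨⟨p₁, h₁⟩, ⟨q₁, h₂⟩⟩, h₃⟩, ⟨⟨⟨p₂, h₄⟩, ⟨q₂, h₅⟩⟩, h₆⟩⟩ ⟨e₁, e₂, e₃, e₄⟩
    simp only [Subtype.mk.injEq, Prod.mk.injEq] at e₁ e₂ e₃ e₄ h₃ h₆ ⊢
    obtain ⟨rfl, rfl⟩ := e₄
    subst e₃
    have : q₁ = p₁ + m := by
      rw [← e₁]; exact (add_tsub_cancel_of_le h₃).symm
    simp [this]

/-- A morphism of `k`-graphs: a degree-preserving functor. -/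
structure Hom (Γ : KGraph.{v} k) (Λ : KGraph.{u} k) where
  onV : Γ.V → Λ.V
  onPath : Γ.Path → Λ.Path
  map_r : ∀ a, Λ.r (onPath a) = onV (Γ.r a)
  map_s : ∀ a, Λ.s (onPath a) = onV (Γ.s a)
  map_id : ∀ v, onPath (Γ.id v) = Λ.id (onV v)
  map_comp : ∀ a b h, onPath (Γ.comp a b h) = Λ.comp (onPath a) (onPath b)
    ((map_s a).trans ((congrArg onV h).trans (map_r b).symm))
  map_d : ∀ a, Λ.d (onPath a) = Γ.d a

/-- The path space `W_Λ`: a path `x` of degree `n ∈ (ℕ ∪ {∞}) ^ k` is a morphism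
`Ω_{k,n} → Λ`. -/
structure PathSpace (Λ : KGraph.{u} k) where
  deg : Fin k → ℕ∞
  hom : Hom (Omega deg) Λ

namespace PathSpace

variable {Λ : KGraph.{u} k}

/-- The segment `x(p, q)`, for `p ≤ q ≤ d x`. -/
def seg (x : Λ.PathSpace) (p q : Fin k → ℕ) (hpq : p ≤ q) (hq : castDeg q ≤ x.deg) : Λ.Path :=
  x.hom.onPath ⟨(⟨p, (castDeg_mono hpq).trans hq⟩, ⟨q, hq⟩), hpq⟩

/-- The range `r(x) = x(0)`. -/
def range (x : Λ.PathSpace) : Λ.V := x.hom.onV ⟨0, fun i => by simp [castDeg]⟩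

/-- The cylinder set `Z(a) = {x : x(0, d a) = a}`. -/
def cyl (a : Λ.Path) : Set Λ.PathSpace :=
  {x | ∃ h : castDeg (Λ.d a) ≤ x.deg, x.seg 0 (Λ.d a) (zero_le) h = a}

/-- `Z(a \ G) = Z(a) \ ⋃_{b ∈ G} Z(a b)`, for `G ⊆ s(a) Λ`. -/
def cylDiff (a : Λ.Path) (G : Set Λ.Path) : Set Λ.PathSpace :=
  cyl a \ ⋃ b ∈ G, ⋃ h : Λ.s a = Λ.r b, cyl (Λ.comp a b h)

/-- The topology on `W_Λ` generated by the sets `Z(a \ G)` with `G` a finite subset of `s(a) Λ`. -/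
instance : TopologicalSpace Λ.PathSpace :=
  TopologicalSpace.generateFrom
    {U | ∃ (a : Λ.Path) (G : Set Λ.Path), G.Finite ∧ (∀ b ∈ G, Λ.r b = Λ.s a) ∧ U = cylDiff a G}

theorem ext' {x y : Λ.PathSpace} (hd : x.deg = y.deg)
    (h : ∀ p q hpq hq hq', x.seg p q hpq hq = y.seg p q hpq hq') : x = y := by
  obtain ⟨n, f⟩ := x
  obtain ⟨n', g⟩ := y
  obtain rfl : n = n' := hd
  have e : f.onPath = g.onPath := by
    funext ⟨⟨⟨p, hp⟩, ⟨q, hq⟩⟩, hpq⟩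
    exact h p q hpq hq hq
  have e' : f.onV = g.onV := by
    funext w
    have h₁ := f.map_r ((Omega n).id w)
    have h₂ := g.map_r ((Omega n).id w)
    rw [(Omega n).r_id] at h₁ h₂
    rw [← h₁, ← h₂, e]
  congr 1
  obtain ⟨_, _⟩ := f
  obtain ⟨_, _⟩ := g
  simp only at e e'
  subst e e'
  rfl

theorem seg_congr (x : Λ.PathSpace) {p q p' q' : Fin k → ℕ} (hp : p = p') (hq : q = q')
    (h₁ h₂ h₃ h₄) : x.seg p q h₁ h₂ = x.seg p' q' h₃ h₄ := by
  subst hp hq; rfl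

theorem d_seg (x : Λ.PathSpace) (p q hpq hq) : Λ.d (x.seg p q hpq hq) = q - p :=
  x.hom.map_d _

theorem r_seg_zero (x : Λ.PathSpace) (q hpq hq) : Λ.r (x.seg 0 q hpq hq) = x.range :=
  x.hom.map_r _

theorem seg_comp (x : Λ.PathSpace) (p q t : Fin k → ℕ) (hpq hqt hpt hq ht) :
    ∃ h, Λ.comp (x.seg p q hpq hq) (x.seg q t hqt ht) h = x.seg p t hpt ht :=
  ⟨_, (x.hom.map_comp ⟨(⟨p, (castDeg_mono hpq).trans hq⟩, ⟨q, hq⟩), hpq⟩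
    ⟨(⟨q, hq⟩, ⟨t, ht⟩), hqt⟩ rfl).symm⟩

/-- `x(p, q)` is the segment from `p` to `q` of the finite path `x(0, t)`. -/
theorem seg_seg (x : Λ.PathSpace) (p q t : Fin k → ℕ) (hpq) (hqt : q ≤ t) (hq ht) :
    Λ.seg (x.seg 0 t (zero_le) ht) p q = x.seg p q hpq hq := by
  obtain ⟨h₁, e₁⟩ := x.seg_comp 0 q t (zero_le) hqt (zero_le) hq ht
  obtain ⟨h₂, e₂⟩ := x.seg_comp 0 p q (zero_le) hpq (zero_le) ((castDeg_mono hpq).trans hq) hq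
  have t₁ := (Λ.take_drop_comp _ _ h₁).1
  have t₂ := (Λ.take_drop_comp _ _ h₂).2
  rw [d_seg, tsub_zero, e₁] at t₁
  rw [d_seg, tsub_zero, e₂] at t₂
  rw [KGraph.seg, t₁, t₂]

/-- Build a path from its segments. -/
def ofSeg (n : Fin k → ℕ∞) (f : (p q : Fin k → ℕ) → p ≤ q → castDeg q ≤ n → Λ.Path)
    (hd : ∀ p q hpq hq, Λ.d (f p q hpq hq) = q - p)
    (hc : ∀ p q t (hpq : p ≤ q) (hqt : q ≤ t) (ht : castDeg t ≤ n),
      ∃ h, Λ.comp (f p q hpq ((castDeg_mono hqt).trans ht)) (f q t hqt ht) h =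
        f p t (hpq.trans hqt) ht) : Λ.PathSpace where
  deg := n
  hom :=
    { onV := fun w => Λ.r (f w.1 w.1 le_rfl w.2)
      onPath := fun e => f e.1.1.1 e.1.2.1 e.2 e.1.2.2
      map_r := by
        rintro ⟨⟨⟨p, hp⟩, ⟨q, hq⟩⟩, hpq⟩
        obtain ⟨h, e⟩ := hc p p q le_rfl hpq hq
        exact (congrArg Λ.r e).symm.trans (Λ.r_comp _ _ h)
      map_s := by
        rintro ⟨⟨⟨p, hp⟩, ⟨q, hq⟩⟩, hpq⟩
        exact (hc p q q hpq le_rfl hq).1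
      map_id := by
        rintro ⟨p, hp⟩
        exact Λ.eq_id_of_d_eq_zero ((hd p p le_rfl hp).trans (by simp))
      map_comp := by
        rintro ⟨⟨⟨p, hp⟩, ⟨q, hq⟩⟩, hpq⟩ ⟨⟨⟨p', hp'⟩, ⟨t, ht⟩⟩, hpt⟩ h
        obtain rfl : q = p' := congrArg Subtype.val h
        exact (hc p q t hpq hpt ht).2.symm
      map_d := by
        rintro ⟨⟨⟨p, hp⟩, ⟨q, hq⟩⟩, hpq⟩
        exact hd p q hpq hq }

theorem castDeg_add_le {q n : Fin k → ℕ} {N : Fin k → ℕ∞} (hn : castDeg n ≤ N)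
    (hq : castDeg q ≤ N - castDeg n) : castDeg (q + n) ≤ N := by
  intro i
  have h₁ := hn i
  have h₂ := hq i
  simp only [castDeg, Pi.sub_apply, Pi.add_apply] at *
  generalize N i = e at *
  induction e using ENat.recTopCoe with
  | top => exact le_top
  | coe e => norm_cast at *; omega

theorem castDeg_sub_le {q n : Fin k → ℕ} {N : Fin k → ℕ∞}
    (hq : castDeg q ≤ castDeg n + N) : castDeg (q - n) ≤ N := by
  intro i
  have h₂ := hq i
  simp only [castDeg, Pi.sub_apply, Pi.add_apply] at *
  generalize N i = e at *
  induction e using ENat.recTopCoe with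
  | top => exact le_top
  | coe e => norm_cast at *; omega

/-- The shift `x(n, ∞)`, for `n ≤ d x`: the path `y` of degree `d x - n` with
`y(p, q) = x(p + n, q + n)`. -/
def shift (x : Λ.PathSpace) (n : Fin k → ℕ) (hn : castDeg n ≤ x.deg) : Λ.PathSpace :=
  ofSeg (x.deg - castDeg n)
    (fun p q hpq hq => x.seg (p + n) (q + n) (add_le_add_left hpq n) (castDeg_add_le hn hq))
    (fun _ _ _ _ => (x.d_seg _ _ _ _).trans (add_tsub_add_eq_tsub_right _ _ _))
    (fun _ _ _ _ _ _ => x.seg_comp _ _ _ _ _ _ _ _)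

/-- The finite path `a x(0, q - d a)`, whose degree is at least `q`. -/
def extend (a : Λ.Path) (x : Λ.PathSpace) (h : Λ.s a = x.range) (q : Fin k → ℕ)
    (hq : castDeg q ≤ castDeg (Λ.d a) + x.deg) : Λ.Path :=
  Λ.comp a (x.seg 0 (q - Λ.d a) zero_le (castDeg_sub_le hq)) (h.trans (x.r_seg_zero _ _ _).symm)

theorem le_d_extend (a : Λ.Path) (x : Λ.PathSpace) (h : Λ.s a = x.range) (q : Fin k → ℕ) (hq) :
    q ≤ Λ.d (extend a x h q hq) := by
  rw [extend, Λ.d_comp, d_seg, tsub_zero]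
  exact le_add_tsub

theorem take_extend (a : Λ.Path) (x : Λ.PathSpace) (h : Λ.s a = x.range) (q t : Fin k → ℕ)
    (hqt : q ≤ t) (hq ht) :
    Λ.take (extend a x h t ht) q = Λ.take (extend a x h q hq) q := by
  have h₁ : q - Λ.d a ≤ t - Λ.d a := tsub_le_tsub_right hqt _
  obtain ⟨hs, e⟩ := x.seg_comp 0 (q - Λ.d a) (t - Λ.d a) zero_le h₁ zero_le
    (castDeg_sub_le hq) (castDeg_sub_le ht)
  have hs' : Λ.s (extend a x h q hq) =
      Λ.r (x.seg (q - Λ.d a) (t - Λ.d a) h₁ (castDeg_sub_le ht)) := (Λ.s_comp _ _ _).trans hs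
  have key : extend a x h t ht = Λ.comp (extend a x h q hq) _ hs' := by
    unfold extend
    rw [Λ.assoc _ _ _ _ hs]
    congr 1
    exact e.symm
  rw [key, Λ.take_comp _ (le_d_extend a x h q hq)]

/-- The path `a x`, for `s(a) = r(x)`. -/
noncomputable def prepend (a : Λ.Path) (x : Λ.PathSpace) (h : Λ.s a = x.range) : Λ.PathSpace :=
  ofSeg (castDeg (Λ.d a) + x.deg)
    (fun p q _ hq => Λ.seg (extend a x h q hq) p q)
    (fun p q hpq hq => Λ.d_seg hpq (le_d_extend a x h q hq))
    (fun p q t hpq hqt ht => by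
      have hq := (castDeg_mono hqt).trans ht
      have e := Λ.seg_congr_take (p := p) (take_extend a x h q t hqt hq ht)
      obtain ⟨h₁, e₁⟩ := Λ.seg_comp hpq hqt (le_d_extend a x h t ht)
      exact ⟨by rw [← e]; exact h₁, by simp only [← e]; exact e₁⟩)

theorem prepend_mem_cyl (a : Λ.Path) (x : Λ.PathSpace) (h : Λ.s a = x.range) :
    prepend a x h ∈ cyl a := by
  refine ⟨le_self_add, ?_⟩
  change Λ.seg (extend a x h (Λ.d a) _) 0 (Λ.d a) = a
  rw [KGraph.seg, extend, (Λ.take_drop_comp _ _ _).1, Λ.drop_zero]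

theorem shift_prepend (a : Λ.Path) (x : Λ.PathSpace) (h : Λ.s a = x.range) (h') :
    (prepend a x h).shift (Λ.d a) h' = x := by
  refine ext' ?_ ?_
  · funext i
    change (castDeg (Λ.d a) + x.deg - castDeg (Λ.d a)) i = x.deg i
    simp only [castDeg, Pi.sub_apply, Pi.add_apply]
    generalize x.deg i = e
    induction e using ENat.recTopCoe with
    | top => simp
    | coe e => norm_cast; omega
  · intro p q hpq hq hq'
    change Λ.seg (extend a x h (q + Λ.d a) _) (p + Λ.d a) (q + Λ.d a) = _
    have hd : Λ.d (extend a x h (q + Λ.d a) (castDeg_add_le h' hq)) = q + Λ.d a := by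
      rw [extend, Λ.d_comp, d_seg, tsub_zero, add_tsub_cancel_right, add_comm]
    have h0 : castDeg p ≤ x.deg := (castDeg_mono hpq).trans hq'
    obtain ⟨hs, e⟩ := x.seg_comp 0 p q zero_le hpq zero_le h0 hq'
    have h1 : Λ.s a = Λ.r (x.seg 0 p zero_le h0) := h.trans (x.r_seg_zero _ _ _).symm
    have key : extend a x h (q + Λ.d a) (castDeg_add_le h' hq) =
        Λ.comp (Λ.comp a (x.seg 0 p zero_le h0) h1) (x.seg p q hpq hq')
          ((Λ.s_comp _ _ _).trans hs) := by
      rw [Λ.assoc _ _ _ _ hs]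
      unfold extend
      congr 1
      exact (x.seg_congr rfl (add_tsub_cancel_right _ _) _ _ _ _).trans e.symm
    have hd' : Λ.d (Λ.comp a (x.seg 0 p zero_le h0) h1) = p + Λ.d a := by
      rw [Λ.d_comp, d_seg, tsub_zero, add_comm]
    rw [KGraph.seg]
    conv_lhs => enter [2, 3]; rw [← hd]
    rw [Λ.take_d, key, ← hd', (Λ.take_drop_comp _ _ _).2]

theorem s_eq_range_shift {a : Λ.Path} {x : Λ.PathSpace} (hx : x ∈ cyl a) :
    Λ.s a = (x.shift (Λ.d a) hx.1).range := by
  obtain ⟨h, e⟩ := hx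
  have h0 : castDeg 0 ≤ (x.shift (Λ.d a) h).deg := fun i => by simp [castDeg]
  rw [← r_seg_zero (x.shift (Λ.d a) h) 0 le_rfl h0]
  have h1 : castDeg (0 + Λ.d a) ≤ x.deg := by rwa [zero_add]
  obtain ⟨hs, -⟩ := x.seg_comp 0 (0 + Λ.d a) (0 + Λ.d a) zero_le le_rfl zero_le h1 h1
  refine Eq.trans ?_ hs
  conv_lhs => rw [← e]
  exact congrArg Λ.s (x.seg_congr rfl (zero_add _).symm _ _ _ _)

theorem prepend_shift {a : Λ.Path} {x : Λ.PathSpace} (hx : x ∈ cyl a) (h) :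
    prepend a (x.shift (Λ.d a) hx.1) h = x := by
  have hx' := hx
  obtain ⟨hd, e⟩ := hx'
  have hdeg : castDeg (Λ.d a) + (x.deg - castDeg (Λ.d a)) = x.deg := by
    funext i
    have := hd i
    simp only [castDeg, Pi.sub_apply, Pi.add_apply] at *
    generalize x.deg i = e at *
    induction e using ENat.recTopCoe with
    | top => simp
    | coe e => norm_cast at *; omega
  refine ext' hdeg ?_
  intro p q hpq hq hq'
  have hA : castDeg (q - Λ.d a) ≤ x.deg - castDeg (Λ.d a) := castDeg_sub_le hq
  have hB : castDeg (q - Λ.d a + Λ.d a) ≤ x.deg := castDeg_add_le hd hA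
  have key : extend a (x.shift (Λ.d a) hd) h q hq =
      x.seg 0 (q - Λ.d a + Λ.d a) zero_le hB := by
    obtain ⟨hs, e'⟩ := x.seg_comp 0 (Λ.d a) (q - Λ.d a + Λ.d a) zero_le le_add_self zero_le hd hB
    rw [← e']
    unfold extend
    congr 1
    · exact e.symm
    · exact x.seg_congr (zero_add _) rfl _ _ _ _
  change Λ.seg (extend a (x.shift (Λ.d a) hd) h q hq) p q = _
  rw [key, seg_seg x p q _ hpq le_tsub_add hq' hB]

theorem shift_congr (x : Λ.PathSpace) {m n : Fin k → ℕ} (h : m = n) (hm hn) :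
    x.shift m hm = x.shift n hn := by
  subst h; rfl

theorem shift_shift (x : Λ.PathSpace) (m n : Fin k → ℕ) (hm hn hmn) :
    (x.shift m hm).shift n hn = x.shift (m + n) hmn := by
  refine ext' ?_ ?_
  · funext i
    change x.deg i - (m i : ℕ∞) - (n i : ℕ∞) = x.deg i - ((m i + n i : ℕ) : ℕ∞)
    generalize x.deg i = e
    induction e using ENat.recTopCoe with
    | top => simp only [ENat.top_sub_natCast]
    | coe e => norm_cast; omega
  · intro p q hpq hq hq'
    have h (p : Fin k → ℕ) : p + n + m = p + (m + n) := by rw [add_comm m n, add_assoc]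
    exact x.seg_congr (h p) (h q) _ _ _ _

theorem mem_cyl_comp {a b : Λ.Path} (h : Λ.s a = Λ.r b) {y : Λ.PathSpace} :
    y ∈ cyl (Λ.comp a b h) ↔ ∃ hy : y ∈ cyl a, y.shift (Λ.d a) hy.1 ∈ cyl b := by
  constructor
  · rintro ⟨hd, e⟩
    have hd' : castDeg (Λ.d a + Λ.d b) ≤ y.deg := by rwa [Λ.d_comp] at hd
    have ha : castDeg (Λ.d a) ≤ y.deg := (castDeg_mono le_self_add).trans hd'
    obtain ⟨hs, e'⟩ := y.seg_comp 0 (Λ.d a) (Λ.d a + Λ.d b) zero_le le_self_add zero_le ha hd'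
    have e'' := e'.trans ((y.seg_congr rfl (Λ.d_comp _ _ _).symm _ _ _ _).trans e)
    obtain ⟨e₁, e₂⟩ := Λ.cancel hs h e'' (by rw [d_seg, tsub_zero])
    refine ⟨⟨ha, e₁⟩, ?_, ?_⟩
    · intro i
      have := hd' i
      change (castDeg (Λ.d b)) i ≤ y.deg i - castDeg (Λ.d a) i
      simp only [castDeg, Pi.add_apply] at *
      generalize y.deg i = e at *
      induction e using ENat.recTopCoe with
      | top => simp
      | coe e => norm_cast at *; omega
    · exact (y.seg_congr (zero_add _) (add_comm _ _) _ _ _ _).trans e₂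
  · rintro ⟨⟨ha, e₁⟩, hb, e₂⟩
    have hd' : castDeg (Λ.d b + Λ.d a) ≤ y.deg := castDeg_add_le ha hb
    have hd : castDeg (Λ.d (Λ.comp a b h)) ≤ y.deg := by rwa [Λ.d_comp, add_comm]
    refine ⟨hd, ?_⟩
    obtain ⟨hs, e'⟩ := y.seg_comp 0 (Λ.d a) (Λ.d b + Λ.d a) zero_le le_add_self zero_le ha hd'
    refine (y.seg_congr rfl (by rw [Λ.d_comp, add_comm]) _ _ _ _).trans (e'.symm.trans ?_)
    congr 1
    exact (y.seg_congr (zero_add _).symm rfl _ _ _ _).trans e₂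

theorem range_prepend (a : Λ.Path) (x : Λ.PathSpace) (h : Λ.s a = x.range) :
    (prepend a x h).range = Λ.r a := by
  obtain ⟨hd, e⟩ := prepend_mem_cyl a x h
  rw [← r_seg_zero _ _ zero_le hd, e]

theorem range_eq_of_mem_cyl {a : Λ.Path} {x : Λ.PathSpace} (h : x ∈ cyl a) :
    x.range = Λ.r a := by
  obtain ⟨hd, e⟩ := h
  rw [← r_seg_zero _ _ zero_le hd, e]

theorem mem_cyl_id {v : Λ.V} {x : Λ.PathSpace} : x ∈ cyl (Λ.id v) ↔ x.range = v := by
  constructor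
  · intro h
    rw [range_eq_of_mem_cyl h, Λ.r_id]
  · rintro rfl
    have hd : castDeg (Λ.d (Λ.id x.range)) ≤ x.deg := by
      rw [Λ.d_id]; intro i; simp [castDeg]
    refine ⟨hd, ?_⟩
    have h0 : Λ.d (x.seg 0 (Λ.d (Λ.id x.range)) zero_le hd) = 0 := by
      rw [d_seg, Λ.d_id, tsub_zero]
    rw [Λ.eq_id_of_d_eq_zero h0, r_seg_zero]

theorem eq_of_mem_cyl {a b : Λ.Path} {x : Λ.PathSpace} (ha : x ∈ cyl a) (hb : x ∈ cyl b)
    (h : Λ.d a = Λ.d b) : a = b := by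
  obtain ⟨hd, e⟩ := ha
  obtain ⟨hd', e'⟩ := hb
  exact e.symm.trans ((x.seg_congr rfl h _ _ _ _).trans e')

/-- `z = a x` if and only if `z ∈ Z(a)` and `z(d a, ∞) = x`. -/
theorem prepend_eq_iff {a : Λ.Path} {x z : Λ.PathSpace} (h : Λ.s a = x.range) :
    prepend a x h = z ↔ ∃ hz : z ∈ cyl a, z.shift (Λ.d a) hz.1 = x := by
  constructor
  · rintro rfl
    exact ⟨prepend_mem_cyl a x h, shift_prepend a x h _⟩
  · rintro ⟨hz, rfl⟩
    exact prepend_shift hz h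

theorem prepend_comp {a b : Λ.Path} (h : Λ.s a = Λ.r b) (x : Λ.PathSpace)
    (hx : Λ.s b = x.range) (h₁ h₂) :
    prepend (Λ.comp a b h) x h₁ = prepend a (prepend b x hx) h₂ := by
  rw [prepend_eq_iff]
  have hs := shift_prepend a (prepend b x hx) h₂ (prepend_mem_cyl a _ h₂).1
  have hm : prepend a (prepend b x hx) h₂ ∈ cyl (Λ.comp a b h) :=
    (mem_cyl_comp h).2 ⟨prepend_mem_cyl a _ h₂, by rw [hs]; exact prepend_mem_cyl b x hx⟩
  refine ⟨hm, ?_⟩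
  have hd := (prepend_mem_cyl b x hx).1
  have hmn : castDeg (Λ.d a + Λ.d b) ≤ (prepend a (prepend b x hx) h₂).deg := by
    rw [← Λ.d_comp a b h]; exact hm.1
  rw [shift_congr _ (Λ.d_comp a b h) _ hmn,
    ← shift_shift _ _ _ (prepend_mem_cyl a _ h₂).1 (by rw [hs]; exact hd)]
  simp only [hs]
  exact shift_prepend b x hx hd

end PathSpace

/-! ### Semi-infinite paths -/

/-- The semi-infinite path space `∂^K Λ`: the paths whose degree is `∞` in the coordinates in `K`
and finite in the coordinates outside `K`. -/
def Boundary (Λ : KGraph.{u} k) (K : Finset (Fin k)) : Type u :=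
  {x : Λ.PathSpace // (∀ i ∈ K, x.deg i = ⊤) ∧ ∀ i ∉ K, x.deg i ≠ ⊤}

namespace Boundary

variable {Λ : KGraph.{u} k} {K : Finset (Fin k)}

/-- The relative topology of `∂^K Λ ⊆ W_Λ`. -/
instance : TopologicalSpace (Λ.Boundary K) := instTopologicalSpaceSubtype

/-- The Borel `σ`-algebra. -/
instance : MeasurableSpace (Λ.Boundary K) := borel _

instance : BorelSpace (Λ.Boundary K) := ⟨rfl⟩

/-- `Z(a) ∩ ∂^K Λ`. -/
def cyl (K : Finset (Fin k)) (a : Λ.Path) : Set (Λ.Boundary K) := {x | x.1 ∈ PathSpace.cyl a}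

/-- `Λ^{m,∞_K}`, for `m ∈ ℕ^J` where `J` is the complement of `K`. -/
def level (Λ : KGraph.{u} k) (K : Finset (Fin k)) (m : {j // j ∉ K} → ℕ) : Set (Λ.Boundary K) :=
  {x | ∀ j : {j // j ∉ K}, x.1.deg j = m j}

/-- The semi-infinite path `a x`. -/
noncomputable def prepend (a : Λ.Path) (x : Λ.Boundary K) (h : Λ.s a = x.1.range) :
    Λ.Boundary K :=
  ⟨PathSpace.prepend a x.1 h,
    fun i hi => by
      change (Λ.d a i : ℕ∞) + x.1.deg i = ⊤
      rw [x.2.1 i hi, add_top],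
    fun i hi => WithTop.add_ne_top.2 ⟨ENat.natCast_ne_top _, x.2.2 i hi⟩⟩

/-- The semi-infinite path `x(n, ∞)`. -/
def shift (x : Λ.Boundary K) (n : Fin k → ℕ) (h : castDeg n ≤ x.1.deg) : Λ.Boundary K :=
  ⟨x.1.shift n h,
    fun i hi => by
      change x.1.deg i - (n i : ℕ∞) = ⊤
      rw [x.2.1 i hi, ENat.top_sub_natCast],
    fun i hi => by
      change x.1.deg i - (n i : ℕ∞) ≠ ⊤
      have := x.2.2 i hi
      generalize x.1.deg i = e at *
      induction e using ENat.recTopCoe with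
      | top => exact absurd rfl this
      | coe e => norm_cast; exact ENat.natCast_ne_top _⟩

open Classical in
/-- The partial bijection `x ↦ a x` of `∂^K Λ`, defined for `r(x) = s(a)`, with inverse
`y ↦ y(d a, ∞)`, defined for `y ∈ Z(a)`. -/
noncomputable def prependEquiv (K : Finset (Fin k)) (a : Λ.Path) :
    Λ.Boundary K ≃. Λ.Boundary K where
  toFun x := if h : Λ.s a = x.1.range then some (prepend a x h) else none
  invFun y := if h : y ∈ cyl K a then some (y.shift (Λ.d a) h.1) else none
  inv x y := by
    constructor
    · intro h
      simp only [Option.dite_none_right_eq_some, Option.some.injEq] at h ⊢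
      obtain ⟨hy, rfl⟩ := h
      exact ⟨PathSpace.s_eq_range_shift hy,
        Subtype.ext (PathSpace.prepend_shift hy (PathSpace.s_eq_range_shift hy))⟩
    · intro h
      simp only [Option.dite_none_right_eq_some, Option.some.injEq] at h ⊢
      obtain ⟨hx, rfl⟩ := h
      exact ⟨PathSpace.prepend_mem_cyl a x.1 hx,
        Subtype.ext (PathSpace.shift_prepend a x.1 hx (PathSpace.prepend_mem_cyl a x.1 hx).1)⟩

open Classical in
theorem prependEquiv_eq_some {a : Λ.Path} {x y : Λ.Boundary K} :
    prependEquiv K a x = some y ↔ ∃ h : Λ.s a = x.1.range, PathSpace.prepend a x.1 h = y.1 := by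
  change (if h : Λ.s a = x.1.range then some (prepend a x h) else none) = some y ↔ _
  simp only [Option.dite_none_right_eq_some, Option.some.injEq]
  exact exists_congr fun h => Subtype.ext_iff

open Classical in
theorem prependEquiv_symm_eq_some {a : Λ.Path} {x y : Λ.Boundary K} :
    (prependEquiv K a).symm y = some x ↔
      ∃ h : y.1 ∈ PathSpace.cyl a, y.1.shift (Λ.d a) h.1 = x.1 := by
  change (if h : y ∈ cyl K a then some (y.shift (Λ.d a) h.1) else none) = some x ↔ _
  simp only [Option.dite_none_right_eq_some, Option.some.injEq]
  exact exists_congr fun h => Subtype.ext_iff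

theorem prependEquiv_comp {a b : Λ.Path} (h : Λ.s a = Λ.r b) :
    (prependEquiv K b).trans (prependEquiv K a) = prependEquiv K (Λ.comp a b h) := by
  ext x y
  change ((prependEquiv K b x).bind (prependEquiv K a)) = some y ↔ _
  rw [Option.bind_eq_some_iff]
  constructor
  · rintro ⟨z, hz, hy⟩
    obtain ⟨hx, e⟩ := prependEquiv_eq_some.1 hz
    obtain ⟨hz', e'⟩ := prependEquiv_eq_some.1 hy
    refine prependEquiv_eq_some.2 ⟨(Λ.s_comp _ _ _).trans hx, ?_⟩
    rw [PathSpace.prepend_comp h x.1 hx _ (by rw [e]; exact hz'), ← e']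
    simp only [e]
  · intro hy
    obtain ⟨hx, e⟩ := prependEquiv_eq_some.1 hy
    have hx' : Λ.s b = x.1.range := (Λ.s_comp _ _ _).symm.trans hx
    have hz : Λ.s a = (prepend b x hx').1.range := h.trans (PathSpace.range_prepend b x.1 hx').symm
    refine ⟨prepend b x hx', prependEquiv_eq_some.2 ⟨hx', rfl⟩,
      prependEquiv_eq_some.2 ⟨hz, ?_⟩⟩
    rw [← e, PathSpace.prepend_comp h x.1 hx' hx hz]
    rfl

/-- The partial bijection of a vertex `v` is the identity on `{x : r(x) = v}`. -/
theorem prependEquiv_id {v : Λ.V} {x y : Λ.Boundary K} :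
    prependEquiv K (Λ.id v) x = some y ↔ x.1.range = v ∧ x = y := by
  rw [← PEquiv.eq_some_iff, prependEquiv_symm_eq_some]
  constructor
  · rintro ⟨h, e⟩
    have h0 : castDeg 0 ≤ y.1.deg := fun i => by simp [castDeg]
    have : y.1.shift (Λ.d (Λ.id v)) h.1 = y.1 := by
      rw [PathSpace.shift_congr _ (Λ.d_id v) _ h0]
      refine PathSpace.ext' ?_ fun _ _ _ _ _ => rfl
      funext i
      change y.1.deg i - ((0 : ℕ) : ℕ∞) = _
      simp
    rw [this] at e
    exact ⟨by rw [← e]; exact PathSpace.mem_cyl_id.1 h, Subtype.ext e.symm⟩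
  · rintro ⟨h, rfl⟩
    refine ⟨PathSpace.mem_cyl_id.2 h, ?_⟩
    have h0 : castDeg 0 ≤ x.1.deg := fun i => by simp [castDeg]
    rw [PathSpace.shift_congr _ (Λ.d_id v) _ h0]
    refine PathSpace.ext' ?_ fun _ _ _ _ _ => rfl
    funext i
    change x.1.deg i - ((0 : ℕ) : ℕ∞) = _
    simp

theorem minExt_iff {a b : Λ.Path} {x y : Λ.Boundary K} :
    (prependEquiv K a x).bind (prependEquiv K b).symm = some y ↔
      ∃ p ∈ Λ.minExt a b, ((prependEquiv K p.1).symm x).bind (prependEquiv K p.2) = some y := by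
  constructor
  · intro h
    obtain ⟨z, hz, hy⟩ := Option.bind_eq_some_iff.1 h
    rw [← PEquiv.eq_some_iff] at hz
    obtain ⟨ha, ea⟩ := prependEquiv_symm_eq_some.1 hz
    obtain ⟨hb, eb⟩ := prependEquiv_symm_eq_some.1 hy
    have hN : castDeg (Λ.d a ⊔ Λ.d b) ≤ z.1.deg := by
      intro i
      have h₁ := ha.1 i
      have h₂ := hb.1 i
      simp only [castDeg, Pi.sup_apply] at *
      rcases le_total (Λ.d a i) (Λ.d b i) with hl | hl
      · rwa [sup_of_le_right hl]
      · rwa [sup_of_le_left hl]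
    obtain ⟨sa, ca⟩ := z.1.seg_comp 0 (Λ.d a) (Λ.d a ⊔ Λ.d b) zero_le le_sup_left zero_le ha.1 hN
    obtain ⟨sb, cb⟩ := z.1.seg_comp 0 (Λ.d b) (Λ.d a ⊔ Λ.d b) zero_le le_sup_right zero_le hb.1 hN
    have eca := ha.2
    have ecb := hb.2
    set η := z.1.seg (Λ.d a) (Λ.d a ⊔ Λ.d b) le_sup_left hN with hη
    set ζ := z.1.seg (Λ.d b) (Λ.d a ⊔ Λ.d b) le_sup_right hN with hζ
    simp only [eca] at sa ca
    simp only [ecb] at sb cb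
    have hda : Λ.d (Λ.comp a η sa) = Λ.d a ⊔ Λ.d b := by
      rw [ca, PathSpace.d_seg, tsub_zero]
    have hdb : Λ.d (Λ.comp b ζ sb) = Λ.d a ⊔ Λ.d b := by
      rw [cb, PathSpace.d_seg, tsub_zero]
    have hza : z.1 ∈ PathSpace.cyl (Λ.comp a η sa) :=
      ⟨by rw [hda]; exact hN, (z.1.seg_congr rfl hda _ _ _ _).trans ca.symm⟩
    have hzb : z.1 ∈ PathSpace.cyl (Λ.comp b ζ sb) :=
      ⟨by rw [hdb]; exact hN, (z.1.seg_congr rfl hdb _ _ _ _).trans cb.symm⟩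
    obtain ⟨_, ha'⟩ := (PathSpace.mem_cyl_comp sa).1 hza
    obtain ⟨_, hb'⟩ := (PathSpace.mem_cyl_comp sb).1 hzb
    have hx' : x.1 ∈ PathSpace.cyl η := by rw [← ea]; exact ha'
    have hy' : y.1 ∈ PathSpace.cyl ζ := by rw [← eb]; exact hb'
    refine ⟨(η, ζ), ⟨sa, sb, ca.trans cb.symm, hda⟩, Option.bind_eq_some_iff.2
      ⟨x.shift (Λ.d η) hx'.1, prependEquiv_symm_eq_some.2 ⟨hx', rfl⟩, ?_⟩⟩
    rw [← PEquiv.eq_some_iff]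
    refine prependEquiv_symm_eq_some.2 ⟨hy', ?_⟩
    change y.1.shift _ hy'.1 = x.1.shift _ hx'.1
    have hya := Λ.d_comp a η sa
    have hyb := Λ.d_comp b ζ sb
    simp only [← ea, ← eb]
    rw [PathSpace.shift_shift _ _ _ _ _ (by rw [← hyb, hdb]; exact hN),
      PathSpace.shift_shift _ _ _ _ _ (by rw [← hya, hda]; exact hN)]
    exact PathSpace.shift_congr _ (by rw [← hya, ← hyb, hda, hdb]) _ _
  · rintro ⟨⟨η, ζ⟩, ⟨sa, sb, e, -⟩, h⟩
    obtain ⟨w, hw, hy⟩ := Option.bind_eq_some_iff.1 h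
    rw [PEquiv.eq_some_iff] at hw
    have h₁ : ((prependEquiv K η).trans (prependEquiv K a)) w = prependEquiv K a x := by
      change (prependEquiv K η w).bind _ = _
      rw [hw]; rfl
    have h₂ : ((prependEquiv K ζ).trans (prependEquiv K b)) w = prependEquiv K b y := by
      change (prependEquiv K ζ w).bind _ = _
      simp only at hy
      rw [hy]; rfl
    rw [prependEquiv_comp sa] at h₁
    rw [prependEquiv_comp sb, ← e] at h₂
    have hη := (prependEquiv_eq_some.1 hw).1
    have hz : prependEquiv K (Λ.comp a η sa) w =
        some (prepend (Λ.comp a η sa) w ((Λ.s_comp _ _ _).trans hη)) :=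
      prependEquiv_eq_some.2 ⟨_, rfl⟩
    rw [← h₁, hz]
    refine (PEquiv.eq_some_iff _).2 ?_
    rw [← h₂, hz]

theorem minExt_unique {a b : Λ.Path} {p q : Λ.Path × Λ.Path} (hp : p ∈ Λ.minExt a b)
    (hq : q ∈ Λ.minExt a b) {x : Λ.Boundary K} (h₁ : x ∈ cyl K p.1) (h₂ : x ∈ cyl K q.1) :
    p = q := by
  obtain ⟨sa, sb, e, hd⟩ := hp
  obtain ⟨sa', sb', e', hd'⟩ := hq
  have : Λ.d p.1 = Λ.d q.1 := by
    rw [← hd', Λ.d_comp, Λ.d_comp] at hd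
    exact add_left_cancel hd
  have h : p.1 = q.1 := PathSpace.eq_of_mem_cyl h₁ h₂ this
  have h' : Λ.comp a p.1 sa = Λ.comp a q.1 sa' := by congr 1
  exact Prod.ext h (Λ.cancel sb sb' (e.symm.trans (h'.trans e')) rfl).2

end Boundary

end KGraph

/-! ### Partial bijections as operators on `ℓ²` -/

section PartialShift

variable {X : Type u}

theorem PEquiv.summable_norm_sq (g : X ≃. X) (f : lp (fun _ : X => ℂ) 2) :
    Summable (fun y => ‖(g y).elim 0 f‖ ^ 2) ∧
      ∑' y, ‖(g y).elim 0 f‖ ^ 2 ≤ ‖f‖ ^ 2 := by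
  have hf : Summable fun x => ‖f x‖ ^ 2 := by
    have := (lp.memℓp f).summable (by norm_num)
    simpa using this
  have hnorm : ‖f‖ ^ 2 = ∑' x, ‖f x‖ ^ 2 := by
    have := lp.norm_rpow_eq_tsum (p := 2) (by norm_num) f
    simpa using this
  let S := {y : X // (g y).isSome}
  let j : S → X := fun y => (g y.1).get y.2
  have hj : Function.Injective j := by
    intro y z h
    have hy : g y.1 = some (j y) := (Option.some_get y.2).symm
    have hz : g z.1 = some (j y) := h ▸ (Option.some_get z.2).symm
    rw [← PEquiv.eq_some_iff] at hy hz
    exact Subtype.ext (Option.some.inj (hy.symm.trans hz))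
  have hF : ∀ y : S, ‖(g y.1).elim 0 f‖ ^ 2 = ‖f (j y)‖ ^ 2 := by
    intro y
    have hy : g y.1 = some (j y) := (Option.some_get y.2).symm
    rw [hy]; rfl
  have hsupp : Function.support (fun y => ‖(g y).elim 0 f‖ ^ 2) ⊆ Set.range (Subtype.val : S → X) := by
    intro y hy
    by_contra h
    apply hy
    have : g y = none := by
      rw [← Option.not_isSome_iff_eq_none]
      exact fun h' => h ⟨⟨y, h'⟩, rfl⟩
    simp [this]
  have hs : Summable fun y : S => ‖(g y.1).elim 0 f‖ ^ 2 := by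
    simp only [hF]; exact hf.comp_injective hj
  refine ⟨(Subtype.val_injective.summable_iff fun y hy => ?_).1 hs, ?_⟩
  · by_contra h
    exact hy (hsupp h)
  · rw [← Subtype.val_injective.tsum_eq hsupp, hnorm]
    simp only [hF]
    exact Summable.tsum_le_tsum_of_inj j hj (fun _ _ => by positivity) (fun _ => le_rfl)
      (hf.comp_injective hj) hf

/-- The operator on `ℓ²(X)` of a partial bijection `g` of `X`:
`(g.toOp ξ)(y) = ξ (g y)` if `g y` is defined, and `0` otherwise. -/
noncomputable def PEquiv.toOp (g : X ≃. X) :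
    lp (fun _ : X => ℂ) 2 →L[ℂ] lp (fun _ : X => ℂ) 2 :=
  LinearMap.mkContinuous
    { toFun := fun f => ⟨fun y => (g y).elim 0 f, memℓp_gen (by
        have := (g.summable_norm_sq f).1
        simpa using this)⟩
      map_add' := fun f₁ f₂ => by
        ext y
        change (g y).elim 0 (f₁ + f₂ : lp (fun _ : X => ℂ) 2) =
          (g y).elim 0 f₁ + (g y).elim 0 f₂
        cases g y with
        | none => exact (add_zero _).symm
        | some x => rfl
      map_smul' := fun c f => by
        ext y
        change (g y).elim 0 (c • f : lp (fun _ : X => ℂ) 2) = c • (g y).elim 0 f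
        cases g y with
        | none => exact (smul_zero _).symm
        | some x => rfl }
    1 (fun f => by
      rw [one_mul]
      refine abs_le_of_sq_le_sq' ?_ (norm_nonneg f) |>.2
      have := lp.norm_rpow_eq_tsum (p := 2) (by norm_num)
        (⟨fun y => (g y).elim 0 f, memℓp_gen (by
          have := (g.summable_norm_sq f).1
          simpa using this)⟩ : lp (fun _ : X => ℂ) 2)
      simp only [ENNReal.toReal_ofNat, Real.rpow_ofNat] at this
      exact this.trans_le (g.summable_norm_sq f).2)

theorem PEquiv.toOp_apply (g : X ≃. X) (f : lp (fun _ : X => ℂ) 2) (y : X) :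
    g.toOp f y = (g y).elim 0 f := rfl

theorem PEquiv.toOp_mul (g h : X ≃. X) : g.toOp * h.toOp = (g.trans h).toOp := by
  ext f y
  change (g y).elim 0 (h.toOp f) = ((g y).bind h).elim 0 f
  cases g y <;> rfl

theorem PEquiv.toOp_single [DecidableEq X] (g : X ≃. X) (x y : X) (h : g y = some x) :
    g.toOp (lp.single 2 x (1 : ℂ)) = lp.single 2 y (1 : ℂ) := by
  ext z
  rw [PEquiv.toOp_apply]
  by_cases hz : z = y
  · subst hz
    rw [h]
    exact (lp.single_apply_self (E := fun _ : X => ℂ) 2 x 1).trans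
      (lp.single_apply_self (E := fun _ : X => ℂ) 2 z 1).symm
  · refine Eq.trans ?_ (lp.single_apply_ne (E := fun _ : X => ℂ) 2 y 1 hz).symm
    cases hw : g z with
    | none => rfl
    | some w =>
      have : w ≠ x := by
        rintro rfl
        rw [← PEquiv.eq_some_iff] at h hw
        exact hz (Option.some.inj (hw.symm.trans h))
      exact lp.single_apply_ne (E := fun _ : X => ℂ) 2 x 1 this

theorem PEquiv.toOp_single_eq_zero [DecidableEq X] (g : X ≃. X) (x : X) (h : g.symm x = none) :
    g.toOp (lp.single 2 x (1 : ℂ)) = 0 := by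
  ext z
  rw [PEquiv.toOp_apply]
  cases hw : g z with
  | none => rfl
  | some w =>
    have : w ≠ x := by
      rintro rfl
      rw [← PEquiv.eq_some_iff, h] at hw
      exact absurd hw (by simp)
    exact lp.single_apply_ne (E := fun _ : X => ℂ) 2 x 1 this

theorem PEquiv.star_toOp (g : X ≃. X) : star g.toOp = g.symm.toOp := by
  classical
  rw [ContinuousLinearMap.star_eq_adjoint]
  ext f y
  have h := ContinuousLinearMap.adjoint_inner_right g.toOp (lp.single 2 y (1 : ℂ)) f
  rw [lp.inner_single_left] at h
  rw [PEquiv.toOp_apply]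
  cases hy : g.symm y with
  | none =>
    rw [PEquiv.toOp_single_eq_zero g y hy] at h
    simpa using h
  | some x =>
    rw [PEquiv.toOp_single g y x ((PEquiv.eq_some_iff g).1 hy), lp.inner_single_left] at h
    simpa using h

theorem PEquiv.toOp_eq_finsum {ι : Type*} {S : Set ι} (hS : S.Finite) (g : X ≃. X)
    (h : ι → X ≃. X) (hg : ∀ x y, g x = some y ↔ ∃ i ∈ S, h i x = some y)
    (hu : ∀ x, ∀ i ∈ S, ∀ j ∈ S, (h i x).isSome → (h j x).isSome → i = j) :
    g.toOp = ∑ᶠ i ∈ S, (h i).toOp := by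
  rw [finsum_mem_eq_finite_toFinset_sum _ hS]
  ext f x
  have hev : (∑ i ∈ hS.toFinset, (h i).toOp) f x = ∑ i ∈ hS.toFinset, (h i x).elim 0 f := by
    rw [sum_apply, lp.coeFn_sum, Finset.sum_apply]
    rfl
  rw [hev, PEquiv.toOp_apply]
  cases hx : g x with
  | none =>
    refine (Finset.sum_eq_zero fun i hi => ?_).symm
    cases hi' : h i x with
    | none => rfl
    | some y =>
      have := (hg x y).2 ⟨i, hS.mem_toFinset.1 hi, hi'⟩
      rw [hx] at this
      exact absurd this (by simp)
  | some y =>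
    obtain ⟨i, hi, hy⟩ := (hg x y).1 hx
    rw [Finset.sum_eq_single_of_mem i (hS.mem_toFinset.2 hi), hy]
    intro j hj hji
    cases hj' : h j x with
    | none => rfl
    | some w =>
      exact absurd (hu x j (hS.mem_toFinset.1 hj) i hi (by simp [hj']) (by simp [hy])) hji

end PartialShift

namespace KGraph

variable {k : ℕ}

/-! ### Toeplitz-Cuntz-Krieger families -/

/-- Toeplitz-Cuntz-Krieger `Λ`-families of operators on a Hilbert space. (For a finite `k`-graph the
index sets of the sums are finite.) -/
structure IsTCK (Λ : KGraph.{u} k) {H : Type v} [NormedAddCommGroup H] [InnerProductSpace ℂ H]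
    [CompleteSpace H] (T : Λ.Path → H →L[ℂ] H) : Prop where
  partialIsometry : ∀ a, T a * star (T a) * T a = T a
  proj : ∀ v, IsStarProjection (T (Λ.id v))
  orthogonal : ∀ v w, v ≠ w → T (Λ.id v) * T (Λ.id w) = 0
  mul : ∀ a b h, T a * T b = T (Λ.comp a b h)
  star_mul_self : ∀ a, star (T a) * T a = T (Λ.id (Λ.s a))
  sum_le : ∀ v n, (∑ᶠ a ∈ Λ.pathsFrom v n, T a * star (T a)) ≤ T (Λ.id v)
  star_mul : ∀ a b, star (T a) * T b = ∑ᶠ p ∈ Λ.minExt a b, T p.1 * star (T p.2)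

theorem IsTCK.norm_le_one {Λ : KGraph.{u} k} {H : Type v} [NormedAddCommGroup H]
    [InnerProductSpace ℂ H] [CompleteSpace H] {T : Λ.Path → H →L[ℂ] H} (hT : Λ.IsTCK T)
    (a : Λ.Path) : ‖T a‖ ≤ 1 := by
  have h := (hT.proj (Λ.s a)).norm_le
  rw [← hT.star_mul_self, CStarRing.norm_star_mul_self] at h
  nlinarith [norm_nonneg (T a)]

theorem finite_pathsFrom (Λ : KGraph.{u} k) [Λ.IsFinite] (v : Λ.V) (n : Fin k → ℕ) :
    (Λ.pathsFrom v n).Finite :=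
  (IsFinite.finite_degree n).subset fun _ h => h.2

theorem finite_minExt (Λ : KGraph.{u} k) [Λ.IsFinite] (a b : Λ.Path) :
    (Λ.minExt a b).Finite := by
  refine ((IsFinite.finite_degree (Λ := Λ) (Λ.d a ⊔ Λ.d b - Λ.d a)).prod
    (IsFinite.finite_degree (Λ := Λ) (Λ.d a ⊔ Λ.d b - Λ.d b))).subset ?_
  rintro ⟨p, q⟩ ⟨h₁, h₂, e, hd⟩
  have hd' := hd
  rw [e, Λ.d_comp] at hd'
  rw [Λ.d_comp] at hd
  exact ⟨by simp [← hd], by simp [← hd']⟩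

/-- The operators `T_a` on `ℓ²(∂^K Λ)`: `T_a ξ_x = ξ_{a x}` if `s(a) = r(x)`, and `T_a ξ_x = 0`
otherwise. Equivalently `(T_a ξ)(y) = ξ(y(d a, ∞))` if `y ∈ Z(a)`, and `(T_a ξ)(y) = 0`
otherwise. -/
noncomputable def boundaryOp (Λ : KGraph.{u} k) (K : Finset (Fin k)) (a : Λ.Path) :
    lp (fun _ : Λ.Boundary K => ℂ) 2 →L[ℂ] lp (fun _ : Λ.Boundary K => ℂ) 2 :=
  (Boundary.prependEquiv K a).symm.toOp

theorem boundaryOp_single (Λ : KGraph.{u} k) (K : Finset (Fin k)) [DecidableEq (Λ.Boundary K)]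
    (a : Λ.Path) (x : Λ.Boundary K) (h : Λ.s a = x.1.range) :
    Λ.boundaryOp K a (lp.single 2 x (1 : ℂ)) = lp.single 2 (Boundary.prepend a x h) (1 : ℂ) :=
  PEquiv.toOp_single _ _ _
    ((PEquiv.eq_some_iff _).2 (Boundary.prependEquiv_eq_some.2 ⟨h, rfl⟩))

theorem boundaryOp_single_of_ne (Λ : KGraph.{u} k) (K : Finset (Fin k))
    [DecidableEq (Λ.Boundary K)] (a : Λ.Path) (x : Λ.Boundary K) (h : Λ.s a ≠ x.1.range) :
    Λ.boundaryOp K a (lp.single 2 x (1 : ℂ)) = 0 := by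
  refine PEquiv.toOp_single_eq_zero _ _ (Option.eq_none_iff_forall_ne_some.2 fun y hy => ?_)
  exact h (Boundary.prependEquiv_eq_some.1 hy).1

/-- The operators `T_a` on `ℓ²(∂^K Λ)` form a Toeplitz-Cuntz-Krieger family. -/
theorem isTCK_boundaryOp (Λ : KGraph.{u} k) [Λ.IsFinite] (K : Finset (Fin k)) :
    Λ.IsTCK (Λ.boundaryOp K) := by
  classical
  have hid : ∀ v x y, (Boundary.prependEquiv (Λ := Λ) K (Λ.id v)).symm x = some y ↔
      x.1.range = v ∧ x = y := by
    intro v x y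
    rw [PEquiv.eq_some_iff, Boundary.prependEquiv_id]
    constructor <;> (rintro ⟨h, rfl⟩; exact ⟨h, rfl⟩)
  have hsymm : ∀ v, (Boundary.prependEquiv (Λ := Λ) K (Λ.id v)).symm =
      Boundary.prependEquiv K (Λ.id v) := by
    intro v
    ext x y
    exact (hid v x y).trans Boundary.prependEquiv_id.symm
  have hcomp : ∀ a b h, Λ.boundaryOp K a * Λ.boundaryOp K b = Λ.boundaryOp K (Λ.comp a b h) := by
    intro a b h
    rw [boundaryOp, boundaryOp, PEquiv.toOp_mul, boundaryOp, ← Boundary.prependEquiv_comp h]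
    rfl
  have hstar : ∀ a, star (Λ.boundaryOp K a) = (Boundary.prependEquiv K a).toOp :=
    fun a => PEquiv.star_toOp _
  have hproj : ∀ v, IsStarProjection (Λ.boundaryOp K (Λ.id v)) := by
    intro v
    constructor
    · have := hcomp (Λ.id v) (Λ.id v) ((Λ.s_id v).trans (Λ.r_id v).symm)
      have e := Λ.comp_id (Λ.id v)
      simp only [Λ.s_id] at e
      rw [e] at this
      exact this
    · change star _ = _
      rw [hstar, boundaryOp, hsymm]
  have hrange : ∀ a, Λ.boundaryOp K a * star (Λ.boundaryOp K a) =
      ((Boundary.prependEquiv K a).symm.trans (Boundary.prependEquiv K a)).toOp := by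
    intro a
    rw [hstar, boundaryOp, PEquiv.toOp_mul]
  have hrange' : ∀ a (x y : Λ.Boundary K),
      ((Boundary.prependEquiv K a).symm.trans (Boundary.prependEquiv K a)) x = some y ↔
        x ∈ Boundary.cyl K a ∧ x = y := by
    intro a x y
    change ((Boundary.prependEquiv K a).symm x).bind (Boundary.prependEquiv K a) = some y ↔ _
    rw [Option.bind_eq_some_iff]
    constructor
    · rintro ⟨z, hz, hy⟩
      refine ⟨(Boundary.prependEquiv_symm_eq_some.1 hz).1, ?_⟩
      rw [PEquiv.eq_some_iff, hy] at hz
      exact (Option.some.inj hz).symm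
    · rintro ⟨h, rfl⟩
      have hz : (Boundary.prependEquiv K a).symm x = some (x.shift (Λ.d a) h.1) :=
        Boundary.prependEquiv_symm_eq_some.2 ⟨h, rfl⟩
      exact ⟨_, hz, (PEquiv.eq_some_iff _).1 hz⟩
  refine ⟨?_, hproj, ?_, hcomp, ?_, ?_, ?_⟩
  · intro a
    rw [hrange, boundaryOp, PEquiv.toOp_mul]
    congr 1
    ext x y
    change (((Boundary.prependEquiv K a).symm.trans (Boundary.prependEquiv K a)) x).bind
      (Boundary.prependEquiv K a).symm = some y ↔ (Boundary.prependEquiv K a).symm x = some y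
    rw [Option.bind_eq_some_iff]
    constructor
    · rintro ⟨z, hz, hy⟩
      obtain ⟨-, rfl⟩ := (hrange' a x z).1 hz
      exact hy
    · intro hy
      exact ⟨x, (hrange' a x x).2 ⟨(Boundary.prependEquiv_symm_eq_some.1 hy).1, rfl⟩, hy⟩
  · intro v w hvw
    rw [boundaryOp, boundaryOp, PEquiv.toOp_mul]
    ext f x
    rw [PEquiv.toOp_apply]
    have : ((Boundary.prependEquiv (Λ := Λ) K (Λ.id v)).symm.trans
        (Boundary.prependEquiv K (Λ.id w)).symm) x = none := by
      refine Option.eq_none_iff_forall_ne_some.2 fun y hy => ?_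
      obtain ⟨z, hz, hy⟩ := Option.bind_eq_some_iff.1 hy
      obtain ⟨h₁, rfl⟩ := (hid v x z).1 hz
      exact hvw (h₁.symm.trans ((hid w x y).1 hy).1)
    rw [this]
    rfl
  · intro a
    rw [hstar, boundaryOp, PEquiv.toOp_mul, boundaryOp]
    congr 1
    ext x y
    refine Iff.trans ?_ (hid (Λ.s a) x y).symm
    change ((Boundary.prependEquiv K a) x).bind (Boundary.prependEquiv K a).symm = some y ↔ _
    rw [Option.bind_eq_some_iff]
    constructor
    · rintro ⟨z, hz, hy⟩
      refine ⟨(Boundary.prependEquiv_eq_some.1 hz).1.symm, ?_⟩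
      rw [← PEquiv.eq_some_iff, hy] at hz
      exact (Option.some.inj hz).symm
    · rintro ⟨h, rfl⟩
      have hz : Boundary.prependEquiv K a x = some (Boundary.prepend a x h.symm) :=
        Boundary.prependEquiv_eq_some.2 ⟨h.symm, rfl⟩
      exact ⟨_, hz, (PEquiv.eq_some_iff _).2 hz⟩
  · intro v n
    let g : Λ.Boundary K ≃. Λ.Boundary K :=
      PEquiv.ofSet {x | ∃ a ∈ Λ.pathsFrom v n, x ∈ Boundary.cyl K a}
    have hg : ∀ x y, g x = some y ↔ (∃ a ∈ Λ.pathsFrom v n, x ∈ Boundary.cyl K a) ∧ x = y := by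
      intro x y
      change (if _ then some x else none) = some y ↔ _
      simp
    have hsum : (∑ᶠ a ∈ Λ.pathsFrom v n, Λ.boundaryOp K a * star (Λ.boundaryOp K a)) = g.toOp := by
      simp only [hrange]
      refine (PEquiv.toOp_eq_finsum (Λ.finite_pathsFrom v n) g _ ?_ ?_).symm
      · intro x y
        rw [hg]
        simp only [hrange']
        constructor
        · rintro ⟨⟨a, h₁, h₂⟩, rfl⟩; exact ⟨a, h₁, h₂, rfl⟩
        · rintro ⟨a, h₁, h₂, rfl⟩; exact ⟨⟨a, h₁, h₂⟩, rfl⟩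
      · intro x a ha b hb h₁ h₂
        obtain ⟨y, hy⟩ := Option.isSome_iff_exists.1 h₁
        obtain ⟨z, hz⟩ := Option.isSome_iff_exists.1 h₂
        exact PathSpace.eq_of_mem_cyl ((hrange' _ _ _).1 hy).1 ((hrange' _ _ _).1 hz).1
          (ha.2.trans hb.2.symm)
    have hgs : g.symm = g := PEquiv.ofSet_symm _
    have hgp : IsStarProjection g.toOp := by
      constructor
      · change g.toOp * g.toOp = g.toOp
        rw [PEquiv.toOp_mul]
        congr 1
        ext x y
        change (g x).bind g = some y ↔ g x = some y
        rw [Option.bind_eq_some_iff]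
        constructor
        · rintro ⟨z, hz, hy⟩
          obtain ⟨-, rfl⟩ := (hg x z).1 hz
          exact hy
        · intro hy
          obtain ⟨-, rfl⟩ := (hg x y).1 hy
          exact ⟨x, hy, hy⟩
      · change star _ = _
        rw [PEquiv.star_toOp, hgs]
    have hmul : g.toOp * Λ.boundaryOp K (Λ.id v) = g.toOp := by
      rw [boundaryOp, PEquiv.toOp_mul]
      congr 1
      ext x y
      change (g x).bind (Boundary.prependEquiv K (Λ.id v)).symm = some y ↔ g x = some y
      rw [Option.bind_eq_some_iff]
      constructor
      · rintro ⟨z, hz, hy⟩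
        obtain ⟨-, rfl⟩ := (hg x z).1 hz
        obtain ⟨-, rfl⟩ := (hid v x y).1 hy
        exact hz
      · intro hy
        obtain ⟨⟨a, ha, hx⟩, rfl⟩ := (hg x y).1 hy
        exact ⟨x, hy, (hid v x x).2 ⟨(PathSpace.range_eq_of_mem_cyl hx).trans ha.1, rfl⟩⟩
    rw [hsum, ContinuousLinearMap.le_def]
    exact ContinuousLinearMap.IsPositive.of_isStarProjection
      (hgp.sub_of_mul_eq_left (hproj v) hmul)
  · intro a b
    have hb : ∀ p : Λ.Path × Λ.Path, Λ.boundaryOp K p.1 * star (Λ.boundaryOp K p.2) =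
        ((Boundary.prependEquiv K p.1).symm.trans (Boundary.prependEquiv K p.2)).toOp := by
      intro p
      rw [hstar, boundaryOp, PEquiv.toOp_mul]
    rw [hstar, boundaryOp, PEquiv.toOp_mul]
    simp only [hb]
    refine PEquiv.toOp_eq_finsum (Λ.finite_minExt a b) _ _ (fun x y => Boundary.minExt_iff) ?_
    intro x p hp q hq h₁ h₂
    obtain ⟨y, hy⟩ := Option.isSome_iff_exists.1 h₁
    obtain ⟨z, hz⟩ := Option.isSome_iff_exists.1 h₂
    obtain ⟨y', hy', -⟩ := Option.bind_eq_some_iff.1 hy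
    obtain ⟨z', hz', -⟩ := Option.bind_eq_some_iff.1 hz
    exact Boundary.minExt_unique hp hq (Boundary.prependEquiv_symm_eq_some.1 hy').1
      (Boundary.prependEquiv_symm_eq_some.1 hz').1

end KGraph

namespace KGraph

variable {k : ℕ}

/-! ### The Toeplitz algebra -/

/-- A Toeplitz-Cuntz-Krieger `Λ`-family, bundled with its Hilbert space. -/
structure TCKRep (Λ : KGraph.{u} k) where
  H : Type u
  [normedAddCommGroup : NormedAddCommGroup H]
  [innerProductSpace : InnerProductSpace ℂ H]
  [completeSpace : CompleteSpace H]
  T : Λ.Path → H →L[ℂ] H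
  isTCK : Λ.IsTCK T

attribute [instance] TCKRep.normedAddCommGroup TCKRep.innerProductSpace TCKRep.completeSpace

/-- The `C⋆`-algebra of bounded families `(a_F)_F` of operators, where `F` runs over all
Toeplitz-Cuntz-Krieger `Λ`-families and `a_F` acts on the Hilbert space of `F`. -/
def RepProduct (Λ : KGraph.{u} k) : Type (u + 1) :=
  lp (fun F : TCKRep Λ => F.H →L[ℂ] F.H) ∞

noncomputable instance (Λ : KGraph.{u} k) : NonUnitalCStarAlgebra (RepProduct Λ) :=
  inferInstanceAs (NonUnitalCStarAlgebra (lp (fun F : TCKRep Λ => F.H →L[ℂ] F.H) ∞))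

/-- The element `(F_a)_F` of the product, for a path `a`. -/
noncomputable def universalGen (Λ : KGraph.{u} k) (a : Λ.Path) : RepProduct Λ :=
  ⟨fun F => F.T a, memℓp_infty ⟨1, by rintro _ ⟨F, rfl⟩; exact F.isTCK.norm_le_one a⟩⟩

/-- The closed `⋆`-subalgebra generated by the universal family. -/
noncomputable def toeplitzSubalgebra (Λ : KGraph.{u} k) :
    NonUnitalStarSubalgebra ℂ (RepProduct Λ) :=
  (NonUnitalStarAlgebra.adjoin ℂ (Set.range Λ.universalGen)).topologicalClosure

instance (Λ : KGraph.{u} k) : IsClosed (Λ.toeplitzSubalgebra : Set (RepProduct Λ)) :=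
  NonUnitalStarSubalgebra.isClosed_topologicalClosure _

/-- The Toeplitz algebra `𝒯C⋆(Λ)`, the `C⋆`-algebra generated by a universal
Toeplitz-Cuntz-Krieger `Λ`-family: it is generated by the direct sum of all
Toeplitz-Cuntz-Krieger families, so that each family `F` is the image of the universal one under
the homomorphism `Toeplitz.rep F`. -/
def Toeplitz (Λ : KGraph.{u} k) : Type (u + 1) := Λ.toeplitzSubalgebra

noncomputable instance (Λ : KGraph.{u} k) : NonUnitalCStarAlgebra (Toeplitz Λ) :=
  NonUnitalStarSubalgebra.nonUnitalCStarAlgebra Λ.toeplitzSubalgebra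

namespace Toeplitz

variable {Λ : KGraph.{u} k}

/-- The universal family `t_a`. -/
noncomputable def t (a : Λ.Path) : Toeplitz Λ :=
  ⟨Λ.universalGen a, NonUnitalStarSubalgebra.le_topologicalClosure _
    (NonUnitalStarAlgebra.subset_adjoin ℂ _ ⟨a, rfl⟩)⟩

/-- The representation of `𝒯C⋆(Λ)` with `t_a ↦ F_a`, for a Toeplitz-Cuntz-Krieger family `F`. -/
noncomputable def rep (F : TCKRep Λ) : Toeplitz Λ →⋆ₙₐ[ℂ] (F.H →L[ℂ] F.H) where
  toFun a := a.1.1 F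
  map_smul' _ _ := rfl
  map_zero' := rfl
  map_add' _ _ := rfl
  map_mul' _ _ := rfl
  map_star' _ := rfl

theorem rep_t (F : TCKRep Λ) (a : Λ.Path) : rep F (t a) = F.T a := rfl

end Toeplitz

/-- `z ^ n = ∏ i, z_i ^ {n_i}` for `z ∈ 𝕋 ^ k` and `n ∈ ℕ ^ k`. -/
noncomputable def torusPow (z : Fin k → Circle) (n : Fin k → ℕ) : Circle := ∏ i, z i ^ n i

theorem torusPow_add (z : Fin k → Circle) (m n : Fin k → ℕ) :
    torusPow z (m + n) = torusPow z m * torusPow z n := by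
  simp [torusPow, pow_add, Finset.prod_mul_distrib]

theorem torusPow_zero (z : Fin k → Circle) : torusPow z 0 = 1 := by
  simp [torusPow]

theorem circle_smul_mul_star {H : Type v} [NormedAddCommGroup H] [InnerProductSpace ℂ H]
    [CompleteSpace H] (c : Circle) (A B : H →L[ℂ] H) :
    ((c : ℂ) • A) * star ((c : ℂ) • B) = A * star B := by
  rw [star_smul, smul_mul_smul_comm]
  have : (c : ℂ) * star (c : ℂ) = 1 := by
    rw [Complex.star_def, Complex.mul_conj, Circle.normSq_coe, Complex.ofReal_one]
  rw [this, one_smul]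

/-- If `T` is a Toeplitz-Cuntz-Krieger family then so is `z^{d(a)} T_a`. -/
theorem IsTCK.twist {Λ : KGraph.{u} k} {H : Type v} [NormedAddCommGroup H]
    [InnerProductSpace ℂ H] [CompleteSpace H] {T : Λ.Path → H →L[ℂ] H} (hT : Λ.IsTCK T)
    (z : Fin k → Circle) : Λ.IsTCK fun a => (torusPow z (Λ.d a) : ℂ) • T a := by
  have hid : ∀ v, (torusPow z (Λ.d (Λ.id v)) : ℂ) • T (Λ.id v) = T (Λ.id v) := by
    intro v
    rw [Λ.d_id, torusPow_zero, Circle.coe_one, one_smul]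
  have hc : ∀ c : Circle, star (c : ℂ) * (c : ℂ) = 1 := by
    intro c
    rw [mul_comm, Complex.star_def, Complex.mul_conj, Circle.normSq_coe, Complex.ofReal_one]
  refine ⟨?_, ?_, ?_, ?_, ?_, ?_, ?_⟩
  · intro a
    rw [circle_smul_mul_star, mul_smul_comm, hT.partialIsometry]
  · intro v
    simp only [hid]
    exact hT.proj v
  · intro v w h
    simp only [hid]
    exact hT.orthogonal v w h
  · intro a b h
    rw [smul_mul_smul_comm, hT.mul a b h, Λ.d_comp, torusPow_add, Circle.coe_mul]
  · intro a
    rw [hid, star_smul, smul_mul_smul_comm, hc, one_smul, hT.star_mul_self]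
  · intro v n
    simp only [hid, circle_smul_mul_star]
    exact hT.sum_le v n
  · intro a b
    rw [star_smul, smul_mul_smul_comm, hT.star_mul a b, smul_finsum]
    refine finsum_congr fun p => ?_
    rw [smul_finsum]
    refine finsum_congr fun hp => ?_
    rw [star_smul, smul_mul_smul_comm]
    congr 1
    obtain ⟨h₁, h₂, e, -⟩ := hp
    have hd := congrArg (fun c => (torusPow z (Λ.d c) : ℂ)) e
    simp only [Λ.d_comp, torusPow_add, Circle.coe_mul] at hd
    have ha := hc (torusPow z (Λ.d a))
    have hp := hc (torusPow z (Λ.d p.2))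
    linear_combination (-star (torusPow z (Λ.d a) : ℂ) * star (torusPow z (Λ.d p.2) : ℂ)) * hd
      + (torusPow z (Λ.d p.1) : ℂ) * star (torusPow z (Λ.d p.2) : ℂ) * ha
      - (torusPow z (Λ.d b) : ℂ) * star (torusPow z (Λ.d a) : ℂ) * hp

/-- The Toeplitz-Cuntz-Krieger family `z^{d(a)} F_a`. -/
@[reducible]
noncomputable def TCKRep.twist {Λ : KGraph.{u} k} (z : Fin k → Circle) (F : TCKRep Λ) : TCKRep Λ where
  H := F.H
  T a := (torusPow z (Λ.d a) : ℂ) • F.T a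
  isTCK := F.isTCK.twist z

/-- The homomorphism `(a_F)_F ↦ (a_{z F})_F`, where `z F` is the family `z^{d(a)} F_a`. -/
noncomputable def RepProduct.twist {Λ : KGraph.{u} k} (z : Fin k → Circle) :
    RepProduct Λ →⋆ₙₐ[ℂ] RepProduct Λ where
  toFun a := ⟨fun F => a.1 (F.twist z), memℓp_infty (by
    obtain ⟨C, hC⟩ := Memℓp.bddAbove a.2
    exact ⟨C, by rintro _ ⟨F, rfl⟩; exact hC ⟨F.twist z, rfl⟩⟩)⟩
  map_smul' _ _ := rfl
  map_zero' := rfl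
  map_add' _ _ := rfl
  map_mul' _ _ := rfl
  map_star' _ := rfl

theorem RepProduct.twist_universalGen {Λ : KGraph.{u} k} (z : Fin k → Circle) (a : Λ.Path) :
    RepProduct.twist z (Λ.universalGen a) = (torusPow z (Λ.d a) : ℂ) • Λ.universalGen a := rfl

theorem RepProduct.twist_mem {Λ : KGraph.{u} k} (z : Fin k → Circle) (a : Toeplitz Λ) :
    RepProduct.twist z a.1 ∈ Λ.toeplitzSubalgebra := by
  have hc : Continuous (RepProduct.twist (Λ := Λ) z) :=
    NonUnitalStarAlgHom.instContinuousLinearMapClassComplex.map_continuous (RepProduct.twist z)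
  have h := NonUnitalStarSubalgebra.map_topologicalClosure_le
    (NonUnitalStarAlgebra.adjoin ℂ (Set.range Λ.universalGen)) hc
  refine NonUnitalStarSubalgebra.topologicalClosure_minimal _ ?_
    (NonUnitalStarSubalgebra.isClosed_topologicalClosure _)
    (h (NonUnitalStarSubalgebra.mem_map.2 ⟨a.1, a.2, rfl⟩))
  refine le_trans ?_ (NonUnitalStarSubalgebra.le_topologicalClosure _)
  rw [NonUnitalStarAlgHom.map_adjoin, NonUnitalStarAlgebra.adjoin_le_iff]
  rintro _ ⟨_, ⟨b, rfl⟩, rfl⟩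
  rw [RepProduct.twist_universalGen]
  exact SMulMemClass.smul_mem _ (NonUnitalStarAlgebra.subset_adjoin ℂ _ ⟨b, rfl⟩)

namespace Toeplitz

variable {Λ : KGraph.{u} k}

/-- The gauge action `γ` of `𝕋 ^ k` on `𝒯C⋆(Λ)`, with `γ_z(t_a) = z^{d(a)} t_a`. -/
noncomputable def gauge (z : Fin k → Circle) : Toeplitz Λ →⋆ₙₐ[ℂ] Toeplitz Λ :=
  NonUnitalStarAlgHom.codRestrict
    ((RepProduct.twist z).comp (NonUnitalStarSubalgebraClass.subtype Λ.toeplitzSubalgebra))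
    Λ.toeplitzSubalgebra (RepProduct.twist_mem z)

theorem gauge_t (z : Fin k → Circle) (a : Λ.Path) :
    gauge z (t a) = (torusPow z (Λ.d a) : ℂ) • t a := rfl

/-- The map `Φ^γ(a) = ∫ γ_z(a) dz`, the average over the gauge action with respect to the
normalised Haar measure of the torus `𝕋 ^ k ≅ (ℝ / ℤ) ^ k`. -/
noncomputable def expectation (a : Toeplitz Λ) : Toeplitz Λ :=
  ∫ θ, gauge (fun i => (θ i).toCircle) a
    ∂(MeasureTheory.Measure.pi fun _ : Fin k => (AddCircle.haarAddCircle (T := (1 : ℝ))))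

/-- The dynamics `α^r_t = γ_{e^{itr}}`. -/
noncomputable def dynamics (r : Fin k → ℝ) (t : ℝ) : Toeplitz Λ →⋆ₙₐ[ℂ] Toeplitz Λ :=
  gauge fun i => Circle.exp (t * r i)

/-- `f : ℂ → 𝒯C⋆(Λ)` is an entire extension of `t ↦ α^r_t(a)`; the element `a` is analytic if there
is such an extension. -/
def IsEntireExtension (r : Fin k → ℝ) (a : Toeplitz Λ) (f : ℂ → Toeplitz Λ) : Prop :=
  Differentiable ℂ f ∧ ∀ t : ℝ, f t = dynamics r t a

open scoped ComplexOrder in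
/-- A state: a positive linear functional of norm one. -/
def IsState (φ : Toeplitz Λ →L[ℂ] ℂ) : Prop :=
  (∀ a, 0 ≤ φ (star a * a)) ∧ ‖φ‖ = 1

/-- `φ` is a `KMS_β` state of `(𝒯C⋆(Λ), α^r)`: a state with `φ(a b) = φ(b α_{iβ}(a))` for all
analytic elements `a`, `b`. -/
def IsKMSState (r : Fin k → ℝ) (β : ℝ) (φ : Toeplitz Λ →L[ℂ] ℂ) : Prop :=
  IsState φ ∧ ∀ (a b : Toeplitz Λ) (f g : ℂ → Toeplitz Λ),
    IsEntireExtension r a f → IsEntireExtension r b g →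
      φ (a * b) = φ (b * f (Complex.I * β))

/-- The semi-infinite path representation `π^K` of `𝒯C⋆(Λ)` on `ℓ²(∂^K Λ)`. -/
noncomputable def boundaryRep [Λ.IsFinite] (K : Finset (Fin k)) :
    Toeplitz Λ →⋆ₙₐ[ℂ]
      (lp (fun _ : Λ.Boundary K => ℂ) 2 →L[ℂ] lp (fun _ : Λ.Boundary K => ℂ) 2) :=
  rep ⟨lp (fun _ : Λ.Boundary K => ℂ) 2, Λ.boundaryOp K, Λ.isTCK_boundaryOp K⟩

theorem boundaryRep_t [Λ.IsFinite] (K : Finset (Fin k)) (a : Λ.Path) :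
    boundaryRep K (t a) = Λ.boundaryOp K a := rfl

open Classical in
/-- The point mass `ξ_x`. -/
noncomputable def pointMass {K : Finset (Fin k)} (x : Λ.Boundary K) :
    lp (fun _ : Λ.Boundary K => ℂ) 2 := lp.single 2 x (1 : ℂ)

/-- The vector functional `(π^K(a) ξ_x | ξ_x)`, with the inner product linear in the left
variable (Mathlib's is linear in the right one). -/
noncomputable def vectorState [Λ.IsFinite] (K : Finset (Fin k)) (a : Toeplitz Λ)
    (x : Λ.Boundary K) : ℂ :=
  inner ℂ (pointMass x) (boundaryRep K a (pointMass x))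

end Toeplitz

/-! ### Vertex matrices -/

/-- The vertex matrix `A_i`, with entries `A_i(v, w) = |v Λ^{e_i} w|`. -/
noncomputable def vertexMatrix (Λ : KGraph.{u} k) (i : Fin k) : Matrix Λ.V Λ.V ℕ :=
  Matrix.of fun v w => {a | Λ.r a = v ∧ Λ.s a = w ∧ Λ.d a = Pi.single i 1}.ncard

/-- `Λ` is coordinatewise irreducible if each vertex matrix is irreducible. -/
def CoordinatewiseIrreducible (Λ : KGraph.{u} k) [Fintype Λ.V] [DecidableEq Λ.V] : Prop :=
  ∀ (i : Fin k) (v w : Λ.V), ∃ n : ℕ, (Λ.vertexMatrix i ^ n) v w ≠ 0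

/-- The spectral radius `ρ(A_i)`. -/
noncomputable def rho (Λ : KGraph.{u} k) [Fintype Λ.V] [DecidableEq Λ.V] (i : Fin k) : ℝ :=
  (spectralRadius ℂ ((Λ.vertexMatrix i).map (Nat.cast : ℕ → ℂ))).toReal

/-- `κ` is the common unimodular Perron-Frobenius eigenvector of the vertex matrices: it is
positive, has `1`-norm one, and satisfies `A_i κ = ρ(A_i) κ` for all `i`. -/
def IsPerronFrobenius (Λ : KGraph.{u} k) [Fintype Λ.V] [DecidableEq Λ.V] (κ : Λ.V → ℝ) : Prop :=
  (∀ v, 0 < κ v) ∧ ∑ v, κ v = 1 ∧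
    ∀ i, ((Λ.vertexMatrix i).map (Nat.cast : ℕ → ℝ)).mulVec κ = Λ.rho i • κ

/-- `e^{- r · n}`. -/
noncomputable def expWeight (r : Fin k → ℝ) (n : Fin k → ℕ) : ℝ := Real.exp (-∑ i, r i * n i)

/-- `C_J = ∏_{j ∈ J} (1 - e^{-r_j} ρ(A_j))`, where `J` is the complement of `K`. -/
noncomputable def constJ (Λ : KGraph.{u} k) [Fintype Λ.V] [DecidableEq Λ.V] (K : Finset (Fin k))
    (r : Fin k → ℝ) : ℝ :=
  ∏ j ∈ Kᶜ, (1 - Real.exp (-r j) * Λ.rho j)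

end KGraph

/-! ### Perron-Frobenius theory for strictly positive matrices -/

section PerronFrobenius

variable {n : Type*} [Fintype n]

/-! Everything is governed by the weight `W a = e^{-r·d(a)} κ_{s(a)}`. Put `q_i = e^{-r_i} ρ(A_i)`.
Because `κ` is a common eigenvector, the extensions of `a` by paths of degree `n` have total weight
`W a * ∏ q_i^{n_i}` (`IsPerronFrobenius.isWeight`). The hypotheses on `r` say exactly that `q_i = 1`
for `i ∈ K` and `q_j < 1` for `j ∈ J`.

The vector `κ` comes from Perron-Frobenius theory. The vertex matrices commute by the factorisation
property, and a sum of powers of one of them is strictly positive. Its positive eigenvector spans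
the eigenspace, so every `A_i` preserves that line, and a nonnegative matrix with a positive
eigenvector has the eigenvalue as spectral radius.

In the directions of `K` the weight is conserved, so on a fixed level `m` it defines a Markov chain
of longer and longer paths. The law of its limit, rescaled, is a measure on `Λ^{m,∞_K}` giving
`Z(a)` mass `W a * ∏_J q_j^{m_j - d(a)_j}` when `d(a)_J ≤ m`, and mass zero otherwise
(`IsWeight.exists_levelMeasure`). In the directions of `J` the weight decays, and summing over `m`
yields a product of geometric series equal to `W a / C_J`. Hence `C_J` times these measures are the
`ν^m`, and their sum `μ` is a probability measure with `μ(Z(a)) = W a`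
(`IsWeight.exists_boundaryMeasure`).

The state is integration of `(π^K(Φ^γ(·)) ξ_x | ξ_x)` against `μ`. At `t_a t_b⋆` the integrand is
the indicator of `Z(a)` if `a = b` and zero otherwise (`vectorState_expectation_t_mul_star_t`),
which gives the stated values. Those values alone force the KMS condition
(`HasGibbsValues.isKMSState`): on spanning elements it reduces to a bijection between two sets of
minimal common extensions, and it reaches all analytic elements by invariance of the state, the
identity theorem and density. -/

theorem Matrix.mulVec_pos_of_pos {P : Matrix n n ℝ} (hP : ∀ v w, 0 < P v w) {x : n → ℝ}
    (hx : ∀ v, 0 ≤ x v) (hx0 : x ≠ 0) (v : n) : 0 < P.mulVec x v := by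
  obtain ⟨w, hw⟩ := Function.ne_iff.1 hx0
  exact Finset.sum_pos' (fun i _ => mul_nonneg (hP v i).le (hx i))
    ⟨w, Finset.mem_univ _, mul_pos (hP v w) (lt_of_le_of_ne (hx w) (Ne.symm hw))⟩

/-- A strictly positive matrix has a strictly positive eigenvector. -/
theorem Matrix.exists_pos_eigenvector [Nonempty n] {P : Matrix n n ℝ} (hP : ∀ v w, 0 < P v w) :
    ∃ (κ : n → ℝ) (l : ℝ), (∀ v, 0 < κ v) ∧ ∑ v, κ v = 1 ∧ P.mulVec κ = l • κ := by
  set M : ℝ := ∑ v, ∑ w, P v w with hM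
  -- Summing `l x ≤ P x` over a probability vector bounds `l` by the sum of all entries; this makes
  -- the set `C` below compact.
  have hbound : ∀ x : n → ℝ, x ∈ stdSimplex ℝ n → ∀ l, (∀ v, l * x v ≤ P.mulVec x v) → l ≤ M := by
    intro x hx l hl
    calc l = ∑ v, l * x v := by rw [← Finset.mul_sum, hx.2, mul_one]
      _ ≤ ∑ v, P.mulVec x v := Finset.sum_le_sum fun v _ => hl v
      _ ≤ M := by
        refine Finset.sum_le_sum fun v _ => Finset.sum_le_sum fun w _ => ?_
        have : x w ≤ 1 := by
          rw [← hx.2]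
          exact Finset.single_le_sum (fun i _ => hx.1 i) (Finset.mem_univ w)
        exact mul_le_of_le_one_right (hP v w).le this
  have hcont : ∀ v, Continuous fun x : n → ℝ => P.mulVec x v := fun v => by
    simp only [Matrix.mulVec, dotProduct]; fun_prop
  -- The Collatz-Wielandt set: the eigenvalue is the largest `l` admitting a probability vector `x`
  -- with `l x ≤ P x`.
  let C : Set ((n → ℝ) × ℝ) :=
    (stdSimplex ℝ n ×ˢ Set.Icc 0 M) ∩ {p | ∀ v, p.2 * p.1 v ≤ P.mulVec p.1 v}
  have hC : IsCompact C := by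
    refine ((isCompact_stdSimplex ℝ n).prod isCompact_Icc).inter_right ?_
    simp only [Set.ofPred_forall]
    refine isClosed_iInter fun v => isClosed_le ?_ ((hcont v).comp continuous_fst)
    fun_prop
  have hCne : C.Nonempty := by
    obtain ⟨x, hx⟩ := (inferInstance : Nonempty (stdSimplex ℝ n))
    have h0 : ∀ v, 0 * x v ≤ P.mulVec x v := fun v => by
      rw [zero_mul]
      exact Finset.sum_nonneg fun w _ => mul_nonneg (hP v w).le (hx.1 w)
    exact ⟨(x, 0), ⟨hx, le_rfl, hbound x hx 0 h0⟩, h0⟩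
  obtain ⟨⟨x, l⟩, ⟨⟨hx, hl0, -⟩, hxl⟩, hmax⟩ := hC.exists_isMaxOn hCne continuous_snd.continuousOn
  simp only at hx hl0 hxl
  have hx0 : x ≠ 0 := by
    rintro rfl
    simpa using hx.2
  have hpos := Matrix.mulVec_pos_of_pos hP hx.1 hx0
  have heq : P.mulVec x = l • x := by
    -- If `P x - l x` is nonzero then `P` makes it strictly positive, so `y = P x` satisfies `l y <
    -- P y` in every coordinate. The least ratio `l'` of `P y` to `y` then exceeds `l`, against
    -- maximality.
    by_contra hne
    set y := P.mulVec x with hy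
    have hd := Matrix.mulVec_pos_of_pos hP (x := y - l • x)
      (fun v => sub_nonneg.2 (hxl v)) (sub_ne_zero.2 hne)
    rw [Matrix.mulVec_sub, Matrix.mulVec_smul, ← hy] at hd
    obtain ⟨v₀, hv₀⟩ := Finite.exists_min fun v => P.mulVec y v / y v
    set l' := P.mulVec y v₀ / y v₀ with hl'
    have hll : l < l' := by
      rw [hl', lt_div_iff₀ (hpos v₀)]
      have := hd v₀
      simp only [Pi.sub_apply, Pi.smul_apply, smul_eq_mul] at this
      linarith
    have hS : 0 < ∑ v, y v := Finset.sum_pos (fun v _ => hpos v) Finset.univ_nonempty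
    have hz : (∑ v, y v)⁻¹ • y ∈ stdSimplex ℝ n :=
      ⟨fun v => mul_nonneg (inv_nonneg.2 hS.le) (hpos v).le, by
        simp only [Pi.smul_apply, smul_eq_mul, ← Finset.mul_sum]
        exact inv_mul_cancel₀ hS.ne'⟩
    have hzl : ∀ v, l' * ((∑ v, y v)⁻¹ • y) v ≤ P.mulVec ((∑ v, y v)⁻¹ • y) v := by
      intro v
      rw [Matrix.mulVec_smul]
      simp only [Pi.smul_apply, smul_eq_mul]
      rw [mul_left_comm]
      refine mul_le_mul_of_nonneg_left ?_ (inv_nonneg.2 hS.le)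
      exact (le_div_iff₀ (hpos v)).1 (hv₀ v)
    have := hmax (a := ((∑ v, y v)⁻¹ • y, l'))
      ⟨⟨hz, hl0.trans hll.le, hbound _ hz _ hzl⟩, hzl⟩
    exact absurd this (not_le.2 hll)
  refine ⟨x, l, fun v => ?_, hx.2, heq⟩
  have h1 := hpos v
  rw [heq, Pi.smul_apply, smul_eq_mul] at h1
  exact pos_of_mul_pos_right h1 hl0

/-- The eigenspace of a strictly positive matrix that holds a strictly positive vector is
one-dimensional. -/
theorem Matrix.eq_smul_of_pos_eigenvector [Nonempty n] {P : Matrix n n ℝ}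
    (hP : ∀ v w, 0 < P v w) {κ z : n → ℝ} {l : ℝ} (hκ : ∀ v, 0 < κ v)
    (h : P.mulVec κ = l • κ) (hz : P.mulVec z = l • z) : ∃ c : ℝ, z = c • κ := by
  obtain ⟨v₀, hv₀⟩ := Finite.exists_min fun v => z v / κ v
  refine ⟨z v₀ / κ v₀, ?_⟩
  by_contra hne
  -- The vector `z - c κ`, with `c` the least ratio, is nonnegative and vanishes at `v₀`. Were it
  -- nonzero, `P` would make it positive at `v₀`, although `P` only multiplies it by `l`.
  have hw := Matrix.mulVec_pos_of_pos hP (x := z - (z v₀ / κ v₀) • κ) (fun v => by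
    have := (le_div_iff₀ (hκ v)).1 (hv₀ v)
    simpa using this) (sub_ne_zero.2 hne) v₀
  rw [Matrix.mulVec_sub, Matrix.mulVec_smul, h, hz] at hw
  simp only [Pi.sub_apply, Pi.smul_apply, smul_eq_mul] at hw
  have h1 : z v₀ / κ v₀ * κ v₀ = z v₀ := div_mul_cancel₀ _ (hκ v₀).ne'
  have : l * z v₀ - z v₀ / κ v₀ * (l * κ v₀) = 0 := by
    rw [mul_left_comm, h1, sub_self]
  linarith

/-- A nonnegative matrix with a strictly positive eigenvector has the eigenvalue as spectral
radius. -/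
theorem Matrix.spectralRadius_of_pos_eigenvector [Nonempty n] [DecidableEq n] {A : Matrix n n ℕ}
    {κ : n → ℝ} {l : ℝ} (hκ : ∀ v, 0 < κ v)
    (h : (A.map (Nat.cast : ℕ → ℝ)).mulVec κ = l • κ) :
    (spectralRadius ℂ (A.map (Nat.cast : ℕ → ℂ))).toReal = l := by
  have hentry : ∀ v, ∑ w, (A v w : ℝ) * κ w = l * κ v := fun v => congrFun h v
  obtain ⟨v₁⟩ := ‹Nonempty n›
  have hl : 0 ≤ l := by
    have := hentry v₁
    have h2 : 0 ≤ l * κ v₁ := by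
      rw [← this]; exact Finset.sum_nonneg fun w _ => mul_nonneg (Nat.cast_nonneg _) (hκ w).le
    exact nonneg_of_mul_nonneg_left h2 (hκ v₁)
  set B := A.map (Nat.cast : ℕ → ℂ) with hB
  have hspec : ∀ z, z ∈ spectrum ℂ B ↔ ∃ x : n → ℂ, x ≠ 0 ∧ B.mulVec x = z • x := by
    intro z
    rw [← Matrix.spectrum_toLin', ← Module.End.hasEigenvalue_iff_mem_spectrum]
    constructor
    · intro hz
      obtain ⟨x, hx⟩ := hz.exists_hasEigenvector
      exact ⟨x, hx.2, by simpa using hx.apply_eq_smul⟩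
    · rintro ⟨x, hx0, hx⟩
      exact Module.End.hasEigenvalue_of_hasEigenvector (x := x)
        ⟨Module.End.mem_eigenspace_iff.2 (by simpa using hx), hx0⟩
  have hle : ∀ z ∈ spectrum ℂ B, ‖z‖ ≤ l := by
    intro z hz
    obtain ⟨x, hx0, hx⟩ := (hspec z).1 hz
    have : Nonempty n := ⟨v₁⟩
    -- With `c` the largest ratio, `|x| ≤ c κ` with equality at `v₀`; the eigenvalue equation read
    -- at `v₀` then gives `‖z‖ ≤ l`.
    obtain ⟨v₀, hv₀⟩ := Finite.exists_max fun v => ‖x v‖ / κ v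
    set c := ‖x v₀‖ / κ v₀ with hc
    have hxc : ∀ v, ‖x v‖ ≤ c * κ v := fun v => (div_le_iff₀ (hκ v)).1 (hv₀ v)
    have hcpos : 0 < c := by
      obtain ⟨v, hv⟩ := Function.ne_iff.1 hx0
      exact lt_of_lt_of_le (div_pos (norm_pos_iff.2 hv) (hκ v)) (hv₀ v)
    have h1 : ‖z‖ * ‖x v₀‖ ≤ l * (c * κ v₀) := by
      calc ‖z‖ * ‖x v₀‖ = ‖B.mulVec x v₀‖ := by rw [hx, Pi.smul_apply, smul_eq_mul, norm_mul]
        _ ≤ ∑ w, ‖B v₀ w * x w‖ := norm_sum_le _ _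
        _ ≤ ∑ w, (A v₀ w : ℝ) * (c * κ w) := by
          refine Finset.sum_le_sum fun w _ => ?_
          rw [norm_mul]
          have : ‖B v₀ w‖ = A v₀ w := by simp [hB]
          rw [this]
          exact mul_le_mul_of_nonneg_left (hxc w) (Nat.cast_nonneg _)
        _ = c * ∑ w, (A v₀ w : ℝ) * κ w := by
          rw [Finset.mul_sum]
          exact Finset.sum_congr rfl fun w _ => by ring
        _ = l * (c * κ v₀) := by rw [hentry]; ring
    have h2 : c * κ v₀ = ‖x v₀‖ := div_mul_cancel₀ _ (hκ v₀).ne'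
    rw [h2] at h1
    exact le_of_mul_le_mul_right h1 (by rw [← h2]; exact mul_pos hcpos (hκ v₀))
  have hmem : (l : ℂ) ∈ spectrum ℂ B := by
    refine (hspec _).2 ⟨fun v => (κ v : ℂ), ?_, ?_⟩
    · exact Function.ne_iff.2 ⟨v₁, by simpa using (hκ v₁).ne'⟩
    · funext v
      have := congrArg (Complex.ofReal) (hentry v)
      push_cast at this
      simpa [Matrix.mulVec, dotProduct, hB] using this
  have hr : spectralRadius ℂ B = ENNReal.ofReal l := by
    refine le_antisymm (iSup₂_le fun z hz => ?_) ?_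
    · rw [← enorm_eq_nnnorm, ← ofReal_norm]
      exact ENNReal.ofReal_le_ofReal (hle z hz)
    · refine le_trans (le_of_eq ?_) (le_iSup₂ (f := fun z (_ : z ∈ spectrum ℂ B) => (‖z‖₊ : ℝ≥0∞))
        (l : ℂ) hmem)
      rw [← enorm_eq_nnnorm, ← ofReal_norm, Complex.norm_real, Real.norm_of_nonneg hl]
  rw [hr, ENNReal.toReal_ofReal hl]

/-- For an irreducible matrix there is a strictly positive matrix that commutes with everything the
irreducible matrix commutes with. -/
theorem Matrix.exists_pos_commute [DecidableEq n] {A : Matrix n n ℕ}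
    (hA : ∀ v w, ∃ N : ℕ, (A ^ N) v w ≠ 0) :
    ∃ P : Matrix n n ℕ, (∀ v w, 0 < P v w) ∧ ∀ B, Commute A B → Commute P B := by
  choose N hN using hA
  -- The entry at `(v, w)` is positive thanks to the summand chosen for that pair, and a sum of
  -- powers commutes with whatever `A` commutes with.
  refine ⟨∑ v, ∑ w, A ^ N v w, fun v w => ?_, fun B hB => ?_⟩
  · simp only [Matrix.sum_apply]
    exact Finset.sum_pos' (fun _ _ => Nat.zero_le _) ⟨v, Finset.mem_univ _,
      Finset.sum_pos' (fun _ _ => Nat.zero_le _) ⟨w, Finset.mem_univ _,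
        Nat.pos_of_ne_zero (hN v w)⟩⟩
  · exact Commute.sum_left _ _ _ fun v _ => Commute.sum_left _ _ _ fun w _ => hB.pow_left _

/-- A commuting family of nonnegative matrices, one of which is irreducible, has a common strictly
positive eigenvector. -/
theorem Matrix.exists_common_pos_eigenvector [Nonempty n] [DecidableEq n] {ι : Type*}
    {A : ι → Matrix n n ℕ} (hcomm : ∀ i j, Commute (A i) (A j)) {i₀ : ι}
    (hirr : ∀ v w, ∃ N : ℕ, (A i₀ ^ N) v w ≠ 0) :
    ∃ κ : n → ℝ, (∀ v, 0 < κ v) ∧ ∑ v, κ v = 1 ∧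
      ∀ i, ∃ l : ℝ, ((A i).map (Nat.cast : ℕ → ℝ)).mulVec κ = l • κ := by
  obtain ⟨P, hP, hPc⟩ := Matrix.exists_pos_commute hirr
  have hP' : ∀ v w, 0 < P.map (Nat.cast : ℕ → ℝ) v w := fun v w => by
    simpa using hP v w
  obtain ⟨κ, l, hκ, h1, hl⟩ := Matrix.exists_pos_eigenvector hP'
  refine ⟨κ, hκ, h1, fun i => ?_⟩
  -- Since `A i` commutes with `P`, the vector `A i κ` lies in the same eigenspace of `P` as `κ`,
  -- and that eigenspace is a line.
  refine Matrix.eq_smul_of_pos_eigenvector hP' hκ hl ?_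
  have hc : P.map (Nat.cast : ℕ → ℝ) * (A i).map Nat.cast =
      (A i).map Nat.cast * P.map (Nat.cast : ℕ → ℝ) := by
    have := congrArg (Nat.castRingHom ℝ).mapMatrix (hPc _ (hcomm i₀ i)).eq
    rw [map_mul, map_mul] at this
    exact this
  rw [Matrix.mulVec_mulVec, hc, ← Matrix.mulVec_mulVec, hl, Matrix.mulVec_smul]

end PerronFrobenius

namespace KGraph

variable {k : ℕ}

/-! ### Sums over paths -/

section PathSums

variable (Λ : KGraph.{u} k)

/-- `v Λ^n` as a finset. -/
noncomputable def pathsFinset [Λ.IsFinite] (v : Λ.V) (n : Fin k → ℕ) : Finset Λ.Path :=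
  (Λ.finite_pathsFrom v n).toFinset

variable {Λ}

theorem mem_pathsFinset [Λ.IsFinite] {v : Λ.V} {n : Fin k → ℕ} {a : Λ.Path} :
    a ∈ Λ.pathsFinset v n ↔ Λ.r a = v ∧ Λ.d a = n := by
  rw [pathsFinset, Set.Finite.mem_toFinset]; rfl

theorem s_drop {a : Λ.Path} {n : Fin k → ℕ} (hn : n ≤ Λ.d a) : Λ.s (Λ.drop a n) = Λ.s a := by
  obtain ⟨h, e⟩ := Λ.take_drop hn
  conv_rhs => rw [← e]
  rw [Λ.s_comp]

theorem r_drop {a : Λ.Path} {n : Fin k → ℕ} (hn : n ≤ Λ.d a) :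
    Λ.r (Λ.drop a n) = Λ.s (Λ.take a n) :=
  (Λ.take_drop hn).1.symm

/-- The factorisation property is a bijection from `v Λ^{m+n}` to composable pairs of degrees `m`
and `n`; this is its summation form. -/
theorem sum_pathsFinset_add [Λ.IsFinite] {M : Type*} [AddCommMonoid M] (v : Λ.V)
    (m n : Fin k → ℕ) (F : Λ.Path → Λ.Path → M) :
    ∑ c ∈ Λ.pathsFinset v (m + n), F (Λ.take c m) (Λ.drop c m) =
      ∑ a ∈ Λ.pathsFinset v m, ∑ b ∈ Λ.pathsFinset (Λ.s a) n, F a b := by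
  rw [Finset.sum_sigma']
  have hs : ∀ x : (_ : Λ.Path) × Λ.Path, x ∈ (Λ.pathsFinset v m).sigma
      (fun a => Λ.pathsFinset (Λ.s a) n) ↔
      (Λ.r x.1 = v ∧ Λ.d x.1 = m) ∧ Λ.r x.2 = Λ.s x.1 ∧ Λ.d x.2 = n := fun x => by
    rw [Finset.mem_sigma, mem_pathsFinset, mem_pathsFinset]
  refine Finset.sum_bij' (fun c _ => ⟨Λ.take c m, Λ.drop c m⟩)
    (fun x hx => Λ.comp x.1 x.2 ((hs x).1 hx).2.1.symm) ?_ ?_ ?_ ?_ ?_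
  · intro c hc
    obtain ⟨h1, h2⟩ := mem_pathsFinset.1 hc
    have hm : m ≤ Λ.d c := by rw [h2]; exact le_self_add
    exact (hs _).2 ⟨⟨(Λ.r_take hm).trans h1, Λ.d_take hm⟩, r_drop hm, by
      rw [Λ.d_drop hm, h2, add_tsub_cancel_left]⟩
  · intro x hx
    obtain ⟨⟨h1, h2⟩, h3, h4⟩ := (hs x).1 hx
    exact mem_pathsFinset.2 ⟨by rw [Λ.r_comp, h1], by rw [Λ.d_comp, h2, h4]⟩
  · intro c hc
    have hm : m ≤ Λ.d c := by rw [(mem_pathsFinset.1 hc).2]; exact le_self_add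
    exact (Λ.take_drop hm).2
  · rintro ⟨a, b⟩ hx
    obtain ⟨⟨h1, h2⟩, h3, h4⟩ := (hs _).1 hx
    simp only at h1 h2 h3 h4
    obtain ⟨e1, e2⟩ := Λ.take_drop_comp a b h3.symm
    rw [h2] at e1 e2
    simp only [e1, e2]
  · intro c _
    rfl

theorem sum_source_pathsFinset_add [Λ.IsFinite] {M : Type*} [AddCommMonoid M] (v : Λ.V)
    (m n : Fin k → ℕ) (f : Λ.V → M) :
    ∑ c ∈ Λ.pathsFinset v (m + n), f (Λ.s c) =
      ∑ a ∈ Λ.pathsFinset v m, ∑ b ∈ Λ.pathsFinset (Λ.s a) n, f (Λ.s b) := by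
  rw [← sum_pathsFinset_add v m n fun _ b => f (Λ.s b)]
  refine Finset.sum_congr rfl fun c hc => ?_
  rw [s_drop]
  rw [(mem_pathsFinset.1 hc).2]
  exact le_self_add

theorem pathsFinset_zero [Λ.IsFinite] (v : Λ.V) : Λ.pathsFinset v 0 = {Λ.id v} := by
  ext a
  rw [mem_pathsFinset, Finset.mem_singleton]
  constructor
  · rintro ⟨h1, h2⟩
    rw [Λ.eq_id_of_d_eq_zero h2, h1]
  · rintro rfl
    exact ⟨Λ.r_id v, Λ.d_id v⟩

open Finset in
theorem vertexMatrix_mulVec [Λ.IsFinite] [Fintype Λ.V] {R : Type*}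
    [CommSemiring R] (i : Fin k) (f : Λ.V → R) (v : Λ.V) :
    ((Λ.vertexMatrix i).map (Nat.cast : ℕ → R)).mulVec f v =
      ∑ a ∈ Λ.pathsFinset v (Pi.single i 1), f (Λ.s a) := by
  classical
  rw [← Finset.sum_fiberwise _ Λ.s]
  refine Finset.sum_congr rfl fun w _ => ?_
  rw [Finset.sum_congr rfl (g := fun _ => f w)
    (fun a ha => by rw [(Finset.mem_filter.1 ha).2]), Finset.sum_const, nsmul_eq_mul]
  have hcard : Λ.vertexMatrix i v w = #{a ∈ Λ.pathsFinset v (Pi.single i 1) | Λ.s a = w} := by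
    change Set.ncard _ = _
    rw [← Set.ncard_coe_finset]
    congr 1
    ext a
    simp only [Finset.coe_filter, mem_pathsFinset, Set.mem_ofPred_eq]
    tauto
  rw [← hcard]
  rfl

/-- Both products count paths of degree `e_i + e_j` by range and source, and this degree is
symmetric in `i` and `j`. -/
theorem vertexMatrix_commute [Λ.IsFinite] [Fintype Λ.V] (i j : Fin k) :
    Commute (Λ.vertexMatrix i) (Λ.vertexMatrix j) := by
  classical
  have key : ∀ i j (f : Λ.V → ℕ) v, (Λ.vertexMatrix i * Λ.vertexMatrix j).mulVec f v =
      ∑ c ∈ Λ.pathsFinset v (Pi.single i 1 + Pi.single j 1), f (Λ.s c) := by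
    intro i j f v
    have h : ∀ i, (Λ.vertexMatrix i).map (Nat.cast : ℕ → ℕ) = Λ.vertexMatrix i := fun i => by
      ext; simp
    rw [← Matrix.mulVec_mulVec, sum_source_pathsFinset_add, ← h i, vertexMatrix_mulVec]
    refine Finset.sum_congr rfl fun a _ => ?_
    rw [← h j, vertexMatrix_mulVec]
  refine Matrix.ext_of_mulVec_single fun w => funext fun v => ?_
  rw [key, key, add_comm]

end PathSums

/-! ### The common Perron-Frobenius eigenvector -/

section Eigenvector

variable {Λ : KGraph.{u} k} [Λ.IsFinite] [Fintype Λ.V] [DecidableEq Λ.V]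

theorem exists_isPerronFrobenius [Nonempty Λ.V] (hirr : Λ.CoordinatewiseIrreducible)
    (i₀ : Fin k) : ∃ κ : Λ.V → ℝ, Λ.IsPerronFrobenius κ := by
  obtain ⟨κ, hκ, h1, h⟩ := Matrix.exists_common_pos_eigenvector
    (fun i j => Λ.vertexMatrix_commute i j) (hirr i₀)
  refine ⟨κ, hκ, h1, fun i => ?_⟩
  obtain ⟨l, hl⟩ := h i
  rw [rho, Matrix.spectralRadius_of_pos_eigenvector hκ hl, hl]

theorem IsPerronFrobenius.sum_single {κ : Λ.V → ℝ} (hκ : Λ.IsPerronFrobenius κ) (i : Fin k)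
    (v : Λ.V) : ∑ a ∈ Λ.pathsFinset v (Pi.single i 1), κ (Λ.s a) = Λ.rho i * κ v := by
  rw [← vertexMatrix_mulVec, hκ.2.2 i]; rfl

/-- Without sources, `ρ(A_i) κ_v` is a nonempty sum of positive terms. Positivity is needed for
`exp` to undo `log (ρ(A_i))` and for the ratios `q_i` to be positive. -/
theorem IsPerronFrobenius.rho_pos [Nonempty Λ.V] {κ : Λ.V → ℝ} (hκ : Λ.IsPerronFrobenius κ)
    (hs : Λ.NoSources) (i : Fin k) : 0 < Λ.rho i := by
  obtain ⟨v⟩ := ‹Nonempty Λ.V›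
  obtain ⟨a, ha⟩ := hs v (Pi.single i 1)
  have h := hκ.sum_single i v
  have : 0 < ∑ a ∈ Λ.pathsFinset v (Pi.single i 1), κ (Λ.s a) :=
    Finset.sum_pos (fun a _ => hκ.1 _) ⟨a, mem_pathsFinset.2 ha⟩
  rw [h] at this
  exact pos_of_mul_pos_left this (hκ.1 v).le

/-- Splitting off one edge at a time gives a factor `ρ(A_i)` by the eigenvector equation; one
induction runs within a coordinate, a second over the coordinates. -/
theorem IsPerronFrobenius.sum_source {κ : Λ.V → ℝ} (hκ : Λ.IsPerronFrobenius κ)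
    (n : Fin k → ℕ) (v : Λ.V) :
    ∑ a ∈ Λ.pathsFinset v n, κ (Λ.s a) = (∏ i, Λ.rho i ^ n i) * κ v := by
  have hstep : ∀ (i : Fin k) (c : ℕ) (v : Λ.V),
      ∑ a ∈ Λ.pathsFinset v (Pi.single i c), κ (Λ.s a) = Λ.rho i ^ c * κ v := by
    intro i c
    induction c with
    | zero => intro v; simp [pathsFinset_zero, Λ.s_id]
    | succ c ih =>
      intro v
      rw [Pi.single_add, sum_source_pathsFinset_add]
      simp only [hκ.sum_single, ← Finset.mul_sum, ih]
      ring
  have hsum : ∀ (S : Finset (Fin k)) (v : Λ.V),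
      ∑ a ∈ Λ.pathsFinset v (∑ i ∈ S, Pi.single i (n i)), κ (Λ.s a) =
        (∏ i ∈ S, Λ.rho i ^ n i) * κ v := by
    intro S
    induction S using Finset.induction_on with
    | empty => intro v; simp [pathsFinset_zero, Λ.s_id]
    | insert i S hi ih =>
      intro v
      rw [Finset.sum_insert hi, sum_source_pathsFinset_add]
      simp only [ih, ← Finset.mul_sum, hstep]
      rw [Finset.prod_insert hi]
      ring
  rw [← hsum Finset.univ v, Finset.univ_sum_single]

theorem expWeight_add (r : Fin k → ℝ) (m n : Fin k → ℕ) :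
    expWeight r (m + n) = expWeight r m * expWeight r n := by
  rw [expWeight, expWeight, expWeight, ← Real.exp_add, ← neg_add, ← Finset.sum_add_distrib]
  congr 2
  exact Finset.sum_congr rfl fun i _ => by simp only [Pi.add_apply]; push_cast; ring

theorem expWeight_pos (r : Fin k → ℝ) (n : Fin k → ℕ) : 0 < expWeight r n := Real.exp_pos _

theorem expWeight_zero (r : Fin k → ℝ) : expWeight r 0 = 1 := by simp [expWeight]

theorem expWeight_eq_prod (r : Fin k → ℝ) (n : Fin k → ℕ) :
    expWeight r n = ∏ i, Real.exp (-r i) ^ n i := by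
  rw [expWeight, ← Finset.sum_neg_distrib, Real.exp_sum]
  refine Finset.prod_congr rfl fun i _ => ?_
  rw [← Real.exp_nat_mul]
  congr 1
  ring

/-- `∑_{a ∈ v Λ^n} e^{-r · n} κ_{s(a)} = ∏_i (e^{-r_i} ρ(A_i))^{n_i} κ_v`. -/
theorem IsPerronFrobenius.sum_expWeight {κ : Λ.V → ℝ} (hκ : Λ.IsPerronFrobenius κ)
    (r : Fin k → ℝ) (n : Fin k → ℕ) (v : Λ.V) :
    ∑ a ∈ Λ.pathsFinset v n, expWeight r (Λ.d a) * κ (Λ.s a) =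
      (∏ i, (Real.exp (-r i) * Λ.rho i) ^ n i) * κ v := by
  have h : ∀ a ∈ Λ.pathsFinset v n, expWeight r (Λ.d a) * κ (Λ.s a) =
      expWeight r n * κ (Λ.s a) := fun a ha => by rw [(mem_pathsFinset.1 ha).2]
  rw [Finset.sum_congr rfl h, ← Finset.mul_sum, hκ.sum_source, expWeight_eq_prod, ← mul_assoc,
    ← Finset.prod_mul_distrib]
  simp only [mul_pow]

end Eigenvector

end KGraph

namespace KGraph

variable {k : ℕ}

open MeasureTheory ProbabilityTheory

/-! ### Weights on paths and the associated Markov chain -/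

section Weights

variable (Λ : KGraph.{u} k)

/-- `Λ^n` as a finset. -/
noncomputable def degreeFinset [Λ.IsFinite] (n : Fin k → ℕ) : Finset Λ.Path :=
  (IsFinite.finite_degree (Λ := Λ) n).toFinset

/-- The paths of degree `d(a) + n` that extend `a`, as a finset. -/
noncomputable def extensions [Λ.IsFinite] (a : Λ.Path) (n : Fin k → ℕ) : Finset Λ.Path :=
  @Finset.filter _ (fun c => Λ.take c (Λ.d a) = a) (Classical.decPred _)
    (Λ.degreeFinset (Λ.d a + n))

variable {Λ}

theorem mem_degreeFinset [Λ.IsFinite] {n : Fin k → ℕ} {a : Λ.Path} :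
    a ∈ Λ.degreeFinset n ↔ Λ.d a = n := by
  rw [degreeFinset, Set.Finite.mem_toFinset]; rfl

theorem mem_extensions [Λ.IsFinite] {n : Fin k → ℕ} {a c : Λ.Path} :
    c ∈ Λ.extensions a n ↔ Λ.d c = Λ.d a + n ∧ Λ.take c (Λ.d a) = a := by
  simp only [extensions, Finset.mem_filter, mem_degreeFinset]

/-- A strictly positive weight `W` on paths such that the total weight of the extensions of `a` of
degree `d(a) + n` is `∏_i q_i^{n_i}` times the weight of `a`. -/
structure IsWeight (Λ : KGraph.{u} k) [Λ.IsFinite] [Fintype Λ.V] (W : Λ.Path → ℝ)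
    (q : Fin k → ℝ) : Prop where
  pos : ∀ a, 0 < W a
  ratio_pos : ∀ i, 0 < q i
  sum_extensions : ∀ a n, ∑ c ∈ Λ.extensions a n, W c = W a * ∏ i, q i ^ n i
  sum_vertices : ∑ v, W (Λ.id v) = 1

/-- Every path extends the identity path at its range, so this is the extension property at the
vertices, whose weights add up to one. -/
theorem IsWeight.sum_degree [Λ.IsFinite] [Fintype Λ.V] {W : Λ.Path → ℝ} {q : Fin k → ℝ}
    (hW : Λ.IsWeight W q) (n : Fin k → ℕ) :
    ∑ c ∈ Λ.degreeFinset n, W c = ∏ i, q i ^ n i := by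
  classical
  rw [← Finset.sum_fiberwise _ Λ.r, ← one_mul (∏ i, q i ^ n i), ← hW.sum_vertices, Finset.sum_mul]
  refine Finset.sum_congr rfl fun v _ => ?_
  rw [← hW.sum_extensions]
  refine Finset.sum_congr (Finset.ext fun c => ?_) fun _ _ => rfl
  rw [Finset.mem_filter, mem_degreeFinset, mem_extensions, Λ.d_id, zero_add, Λ.take_zero]
  refine and_congr_right fun _ => ⟨fun h => by rw [h], fun h => ?_⟩
  rw [← Λ.r_id v, ← h, Λ.r_id]

/-- An extension of `a` is `a b` with `r(b) = s(a)`, and its weight is `e^{-r·d(a)}` times that of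
`b`; the sum over `b` is the eigenvector equation. -/
theorem IsPerronFrobenius.isWeight [Λ.IsFinite] [Fintype Λ.V] [DecidableEq Λ.V]
    [Nonempty Λ.V] {κ : Λ.V → ℝ}
    (hκ : Λ.IsPerronFrobenius κ) (hs : Λ.NoSources) (r : Fin k → ℝ) :
    Λ.IsWeight (fun a => expWeight r (Λ.d a) * κ (Λ.s a))
      (fun i => Real.exp (-r i) * Λ.rho i) where
  pos a := mul_pos (expWeight_pos _ _) (hκ.1 _)
  ratio_pos i := mul_pos (Real.exp_pos _) (hκ.rho_pos hs i)
  sum_vertices := by simpa [Λ.d_id, expWeight_zero, Λ.s_id] using hκ.2.1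
  sum_extensions a n := by
    classical
    have h1 : Λ.extensions a n =
        {c ∈ Λ.pathsFinset (Λ.r a) (Λ.d a + n) | Λ.take c (Λ.d a) = a} := by
      ext c
      rw [mem_extensions, Finset.mem_filter, mem_pathsFinset]
      constructor
      · rintro ⟨h1, h2⟩
        refine ⟨⟨?_, h1⟩, h2⟩
        have := Λ.r_take (a := c) (n := Λ.d a) (by rw [h1]; exact le_self_add)
        rw [← this, h2]
      · rintro ⟨⟨-, h1⟩, h2⟩
        exact ⟨h1, h2⟩
    -- The condition of extending `a` is kept as an `if` on the initial segment, so that the sum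
    -- splits over factorisations and only the initial segment `a` survives.
    have h2 : ∀ c ∈ Λ.pathsFinset (Λ.r a) (Λ.d a + n),
        (if Λ.take c (Λ.d a) = a then expWeight r (Λ.d c) * κ (Λ.s c) else 0) =
        if Λ.take c (Λ.d a) = a then
          expWeight r (Λ.d a) * (expWeight r (Λ.d (Λ.drop c (Λ.d a))) *
            κ (Λ.s (Λ.drop c (Λ.d a)))) else 0 := by
      intro c hc
      have hd := (mem_pathsFinset.1 hc).2
      have hle : Λ.d a ≤ Λ.d c := by rw [hd]; exact le_self_add
      rw [s_drop hle, Λ.d_drop hle, hd, add_tsub_cancel_left, expWeight_add, mul_assoc]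
    rw [h1, Finset.sum_filter, Finset.sum_congr rfl h2,
      sum_pathsFinset_add (Λ.r a) (Λ.d a) n (fun a' b => if a' = a then
        expWeight r (Λ.d a) * (expWeight r (Λ.d b) * κ (Λ.s b)) else 0),
      Finset.sum_eq_single_of_mem a (mem_pathsFinset.2 ⟨rfl, rfl⟩)]
    · simp only [if_true, ← Finset.mul_sum]
      rw [hκ.sum_expWeight]
      ring
    · intro b _ hb
      simp only [if_neg hb, Finset.sum_const_zero]

end Weights

/-! ### The Markov chain of path extensions -/

section MarkovChain

variable {Λ : KGraph.{u} k}

instance [Λ.IsFinite] : Countable Λ.Path := by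
  have : (Set.univ : Set Λ.Path) = ⋃ n : Fin k → ℕ, {a | Λ.d a = n} := by
    ext a; simp
  rw [← Set.countable_univ_iff, this]
  exact Set.countable_iUnion fun n => (IsFinite.finite_degree n).countable

/-- The discrete `σ`-algebra on paths. -/
instance : MeasurableSpace Λ.Path := ⊤

instance : DiscreteMeasurableSpace Λ.Path := ⟨fun _ => trivial⟩

variable [Λ.IsFinite]

/-- The measure on `Λ^n` with density `W / c`. -/
noncomputable def weightMeasure (S : Finset Λ.Path) (W : Λ.Path → ℝ) (c : ℝ) :
    Measure Λ.Path :=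
  ∑ b ∈ S, ENNReal.ofReal (W b / c) • Measure.dirac b

theorem lintegral_weightMeasure {S : Finset Λ.Path} {W : Λ.Path → ℝ} {c : ℝ}
    (f : Λ.Path → ℝ≥0∞) :
    ∫⁻ a, f a ∂(weightMeasure S W c) = ∑ b ∈ S, ENNReal.ofReal (W b / c) * f b := by
  rw [weightMeasure, lintegral_finsetSum_measure]
  exact Finset.sum_congr rfl fun b _ => by
    rw [lintegral_smul_measure, lintegral_dirac, smul_eq_mul]

/-- Each path of degree `m + n` extends exactly one path of degree `m`, its initial segment. -/
theorem sum_extensions_of_degree {M : Type*} [AddCommMonoid M] (m n : Fin k → ℕ)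
    (F : Λ.Path → M) :
    ∑ a ∈ Λ.degreeFinset m, ∑ b ∈ Λ.extensions a n, F b = ∑ b ∈ Λ.degreeFinset (m + n), F b := by
  classical
  rw [← Finset.sum_fiberwise_of_maps_to (s := Λ.degreeFinset (m + n)) (t := Λ.degreeFinset m)
    (g := fun b => Λ.take b m)]
  · refine Finset.sum_congr rfl fun a ha => Finset.sum_congr (Finset.ext fun c => ?_) fun _ _ => rfl
    rw [mem_degreeFinset] at ha
    rw [mem_extensions, Finset.mem_filter, mem_degreeFinset, ha]
  · intro b hb
    rw [mem_degreeFinset] at hb ⊢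
    exact Λ.d_take (by rw [hb]; exact le_self_add)

theorem weightMeasure_apply {S : Finset Λ.Path} {W : Λ.Path → ℝ} {c : ℝ} (hW : ∀ a, 0 < W a)
    (hc : 0 < c) (E : Set Λ.Path) :
    weightMeasure S W c E = ENNReal.ofReal ((∑ b ∈ S, E.indicator W b) / c) := by
  rw [weightMeasure, Measure.finsetSum_apply, Finset.sum_div, ENNReal.ofReal_sum_of_nonneg
    (fun b _ => div_nonneg (Set.indicator_nonneg (fun a _ => (hW a).le) b) hc.le)]
  refine Finset.sum_congr rfl fun b _ => ?_
  rw [Measure.smul_apply, Measure.dirac_apply, smul_eq_mul]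
  by_cases hb : b ∈ E <;> simp [hb]

variable (Λ) in
/-- The transition kernel from `a` to its extensions of degree `d(a) + e`, with probabilities
proportional to `W`. -/
noncomputable def stepKernel (W : Λ.Path → ℝ) (e : Fin k → ℕ) : Kernel Λ.Path Λ.Path where
  toFun a := weightMeasure (Λ.extensions a e) W (W a)
  measurable' := measurable_of_countable _

theorem stepKernel_apply (W : Λ.Path → ℝ) (e : Fin k → ℕ) (a : Λ.Path) :
    Λ.stepKernel W e a = weightMeasure (Λ.extensions a e) W (W a) := rfl

variable (Λ) in
/-- The step kernel as a function of the history of the chain. -/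
noncomputable def historyKernel (W : Λ.Path → ℝ) (e : Fin k → ℕ) (n : ℕ) :
    Kernel (Finset.Iic n → Λ.Path) Λ.Path :=
  (Λ.stepKernel W e).comap (fun x => x ⟨n, Finset.mem_Iic.2 le_rfl⟩) (measurable_pi_apply _)

variable [Fintype Λ.V] {W : Λ.Path → ℝ} {q : Fin k → ℝ}

/-- The hypothesis on `e` says that weight is conserved in this direction: the extensions of `a`
weigh as much as `a` in total. -/
theorem IsWeight.isMarkovKernel (hW : Λ.IsWeight W q) {e : Fin k → ℕ}
    (he : ∏ i, q i ^ e i = 1) : IsMarkovKernel (Λ.stepKernel W e) := by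
  classical
  refine ⟨fun a => ⟨?_⟩⟩
  rw [stepKernel_apply, weightMeasure_apply hW.pos (hW.pos a), Set.indicator_univ,
    hW.sum_extensions, he, mul_one, div_self (hW.pos a).ne',
    ENNReal.ofReal_one]

/-- There is a Markov chain `X_n`, with `X_n` of degree `p + n e` distributed according to `W`, such
that `X_{n+1}` extends `X_n`. -/
theorem IsWeight.exists_chain (hW : Λ.IsWeight W q) {p e : Fin k → ℕ}
    (he : ∏ i, q i ^ e i = 1) :
    ∃ P : Measure (ℕ → Λ.Path), IsProbabilityMeasure P ∧
      (∀ n, P.map (fun X => X n) =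
        weightMeasure (Λ.degreeFinset (p + n • e)) W (∏ i, q i ^ p i)) ∧
      ∀ᵐ X ∂P, ∀ n, Λ.d (X n) = p + n • e ∧ Λ.take (X (n + 1)) (p + n • e) = X n := by
  classical
  have hQ : 0 < ∏ i, q i ^ p i := Finset.prod_pos fun i _ => pow_pos (hW.ratio_pos i) _
  have hK := hW.isMarkovKernel he
  have hKn : ∀ n, IsMarkovKernel (Λ.historyKernel W e n) := fun n => by
    unfold historyKernel; infer_instance
  -- The normalising constant is the total weight of `Λ^p`.
  let μ₀ := weightMeasure (Λ.degreeFinset p) W (∏ i, q i ^ p i)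
  have hμ₀ : IsProbabilityMeasure μ₀ := ⟨by
    rw [weightMeasure_apply hW.pos hQ, Set.indicator_univ, hW.sum_degree, div_self hQ.ne', ENNReal.ofReal_one]⟩
  -- The measure on trajectories is given by the Ionescu-Tulcea theorem.
  let P : Measure (ℕ → Λ.Path) := Kernel.trajMeasure (X := fun _ => Λ.Path) μ₀ (Λ.historyKernel W e)
  have hP : IsProbabilityMeasure P := inferInstance
  -- The joint law of two consecutive terms is the law of the first followed by the step kernel;
  -- both the marginals and the extension property are read off from it.
  have hstep : ∀ n (E : Set (Λ.Path × Λ.Path)), P {X | (X n, X (n + 1)) ∈ E} =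
      ∫⁻ a, Λ.stepKernel W e a {b | (a, b) ∈ E} ∂(P.map fun X => X n) := by
    intro n E
    have hE : MeasurableSet E := MeasurableSet.of_discrete
    have h := Kernel.map_frestrictLe_trajMeasure_compProd_eq_map_trajMeasure
      (X := fun _ => Λ.Path) (μ₀ := μ₀) (κ := Λ.historyKernel W e) (a := n)
    have hE' : MeasurableSet {x : (Finset.Iic n → Λ.Path) × Λ.Path |
        (x.1 ⟨n, Finset.mem_Iic.2 le_rfl⟩, x.2) ∈ E} := by
      refine hE.preimage (f := fun x : (Finset.Iic n → Λ.Path) × Λ.Path =>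
        (x.1 ⟨n, Finset.mem_Iic.2 le_rfl⟩, x.2)) ?_
      fun_prop
    have h2 := congrArg (fun m => m {x | (x.1 ⟨n, Finset.mem_Iic.2 le_rfl⟩, x.2) ∈ E}) h
    beta_reduce at h2
    rw [Measure.map_apply (by fun_prop) hE', Measure.compProd_apply hE',
      lintegral_map (Kernel.measurable_kernel_prodMk_left hE') (by fun_prop)] at h2
    rw [lintegral_map (measurable_of_countable _) (by fun_prop)]
    exact h2.symm
  have hlaw : ∀ n, P.map (fun X => X n) =
      weightMeasure (Λ.degreeFinset (p + n • e)) W (∏ i, q i ^ p i) := by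
    intro n
    induction n with
    | zero =>
      have h0 : P.map (Preorder.frestrictLe (π := fun _ : ℕ => Λ.Path) 0) =
          μ₀.map (MeasurableEquiv.piUnique (fun _ : Finset.Iic 0 => Λ.Path)).symm := by
        change (Measure.bind _ _).map _ = _
        rw [Measure.map_comp _ _ (by fun_prop), Kernel.traj_map_frestrictLe,
          Kernel.partialTraj_self, Measure.id_comp]
      have h1 := congrArg
        (Measure.map fun x : Finset.Iic 0 → Λ.Path => x ⟨0, Finset.mem_Iic.2 le_rfl⟩) h0
      rw [Measure.map_map (by fun_prop) (by fun_prop),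
        Measure.map_map (by fun_prop) (by fun_prop)] at h1
      rw [zero_smul, add_zero]
      refine Eq.trans h1 ?_
      exact Measure.map_id
    | succ n ih =>
      ext E -
      rw [Measure.map_apply (by fun_prop) MeasurableSet.of_discrete]
      refine (hstep n {x | x.2 ∈ E}).trans ?_
      rw [ih, lintegral_weightMeasure, weightMeasure_apply hW.pos hQ, add_smul, one_smul,
        ← add_assoc, ← sum_extensions_of_degree (p + n • e), Finset.sum_div,
        ENNReal.ofReal_sum_of_nonneg]
      · refine Finset.sum_congr rfl fun a _ => ?_
        rw [stepKernel_apply, weightMeasure_apply hW.pos (hW.pos a),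
          ← ENNReal.ofReal_mul (div_pos (hW.pos a) hQ).le]
        congr 1
        have := (hW.pos a).ne'
        -- The mass of `a` cancels the normalisation of the kernel at `a`, leaving the weight of the
        -- extensions over the initial constant.
        change W a / _ * ((∑ b ∈ Λ.extensions a e, E.indicator W b) / W a) = _
        field_simp
      · exact fun a _ => div_nonneg (Finset.sum_nonneg fun b _ =>
          Set.indicator_nonneg (fun a _ => (hW.pos a).le) b) hQ.le
  refine ⟨P, hP, hlaw, ?_⟩
  rw [ae_all_iff]
  intro n
  have h1 : ∀ᵐ X ∂P, Λ.d (X n) = p + n • e := by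
    have : P {X | ¬ Λ.d (X n) = p + n • e} = 0 := by
      have h := congrArg (fun m => m {a | ¬ Λ.d a = p + n • e}) (hlaw n)
      beta_reduce at h
      rw [Measure.map_apply (by fun_prop) MeasurableSet.of_discrete,
        weightMeasure_apply hW.pos hQ, Finset.sum_eq_zero] at h
      · simpa using h
      · exact fun a ha => Set.indicator_of_notMem (not_not.2 (mem_degreeFinset.1 ha)) _
    exact this
  have h2 : ∀ᵐ X ∂P, Λ.take (X (n + 1)) (Λ.d (X n)) = X n := by
    have : P {X | ¬ Λ.take (X (n + 1)) (Λ.d (X n)) = X n} = 0 := by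
      refine (hstep n {x | ¬ Λ.take x.2 (Λ.d x.1) = x.1}).trans ?_
      rw [lintegral_eq_zero_iff (measurable_of_countable _)]
      refine Filter.Eventually.of_forall fun a => ?_
      beta_reduce
      rw [stepKernel_apply, weightMeasure_apply hW.pos (hW.pos a), Finset.sum_eq_zero]
      · simp
      · exact fun b hb => Set.indicator_of_notMem (not_not.2 (mem_extensions.1 hb).2) _
    exact this
  filter_upwards [h1, h2] with X hX1 hX2
  exact ⟨hX1, by rw [← hX1]; exact hX2⟩

end MarkovChain

end KGraph

namespace KGraph

variable {k : ℕ}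

open MeasureTheory ProbabilityTheory

/-! ### The Borel structure of the semi-infinite path space -/

section Borel

variable {Λ : KGraph.{u} k}

/-- The subbasic sets are indexed by a path and a finite set of paths, and there are countably many
paths. -/
instance [Λ.IsFinite] : SecondCountableTopology Λ.PathSpace := by
  refine ⟨⟨_, ?_, rfl⟩⟩
  have : Set.Countable (Set.univ ×ˢ {G : Set Λ.Path | G.Finite}) :=
    (Set.countable_univ (α := Λ.Path)).prod Set.Countable.ofPred_finite
  refine (this.image fun p => PathSpace.cylDiff p.1 p.2).mono ?_
  rintro _ ⟨a, G, hG, -, rfl⟩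
  exact ⟨(a, G), ⟨trivial, hG⟩, rfl⟩

theorem Boundary.isInducing_val (K : Finset (Fin k)) :
    Topology.IsInducing fun x : Λ.Boundary K => x.1 := ⟨rfl⟩

instance [Λ.IsFinite] (K : Finset (Fin k)) : SecondCountableTopology (Λ.Boundary K) :=
  (Boundary.isInducing_val K).secondCountableTopology

theorem PathSpace.isOpen_cyl (a : Λ.Path) : IsOpen (PathSpace.cyl a) :=
  TopologicalSpace.isOpen_generateFrom_of_mem
    ⟨a, ∅, Set.finite_empty, by simp, by simp [PathSpace.cylDiff]⟩

theorem Boundary.measurableSet_cyl (K : Finset (Fin k)) (a : Λ.Path) :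
    MeasurableSet (Boundary.cyl K a) :=
  ((PathSpace.isOpen_cyl a).preimage (Boundary.isInducing_val K).continuous).measurableSet

/-- A map into `∂^K Λ` is measurable if the preimages of the cylinder sets are. -/
theorem Boundary.measurable_of_cyl [Λ.IsFinite] {K : Finset (Fin k)} {Ω : Type*} [MeasurableSpace Ω]
    {f : Ω → Λ.Boundary K} (hf : ∀ a, MeasurableSet (f ⁻¹' Boundary.cyl K a)) :
    Measurable f := by
  have ht : (inferInstance : TopologicalSpace (Λ.Boundary K)) = TopologicalSpace.generateFrom
      (Set.preimage (fun x : Λ.Boundary K => x.1) '' {U | ∃ (a : Λ.Path) (G : Set Λ.Path), G.Finite ∧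
        (∀ b ∈ G, Λ.r b = Λ.s a) ∧ U = PathSpace.cylDiff a G}) :=
    induced_generateFrom_eq
  -- Second countability is what lets a subbasis of the topology generate the Borel sets.
  have hb := borel_eq_generateFrom_of_subbasis ht
  change @Measurable _ _ _ (borel _) f
  rw [hb]
  refine measurable_generateFrom ?_
  rintro _ ⟨_, ⟨a, G, hG, -, rfl⟩, rfl⟩
  have : f ⁻¹' ((fun x : Λ.Boundary K => x.1) ⁻¹' PathSpace.cylDiff a G) =
      f ⁻¹' Boundary.cyl K a \
        ⋃ b ∈ G, ⋃ h : Λ.s a = Λ.r b, f ⁻¹' Boundary.cyl K (Λ.comp a b h) := by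
    ext x
    simp [PathSpace.cylDiff, Boundary.cyl]
  rw [this]
  exact (hf a).diff (MeasurableSet.biUnion hG.countable fun b _ =>
    MeasurableSet.iUnion fun _ => hf _)

theorem PathSpace.castDeg_le_iff {n : Fin k → ℕ} {x : Λ.PathSpace} :
    castDeg n ≤ x.deg ↔ ∃ a, Λ.d a = n ∧ x ∈ PathSpace.cyl a := by
  constructor
  · intro h
    have hd : Λ.d (x.seg 0 n zero_le h) = n := by rw [PathSpace.d_seg, tsub_zero]
    exact ⟨x.seg 0 n zero_le h, hd, by rw [hd]; exact h, x.seg_congr rfl hd _ _ _ _⟩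
  · rintro ⟨a, rfl, h⟩
    exact h.1

theorem Boundary.measurableSet_castDeg_le [Λ.IsFinite] (K : Finset (Fin k)) (n : Fin k → ℕ) :
    MeasurableSet {x : Λ.Boundary K | castDeg n ≤ x.1.deg} := by
  have : {x : Λ.Boundary K | castDeg n ≤ x.1.deg} =
      ⋃ a ∈ {a : Λ.Path | Λ.d a = n}, Boundary.cyl K a := by
    ext x
    simp [PathSpace.castDeg_le_iff, Boundary.cyl]
  rw [this]
  exact MeasurableSet.biUnion (Set.to_countable _) fun a _ => Boundary.measurableSet_cyl K a

/-- The conditions `c ≤ d(x)_j` are countable unions of cylinder sets, and the equality `d(x)_j =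
m_j` is the difference of two of them. -/
theorem Boundary.measurableSet_level [Λ.IsFinite] (K : Finset (Fin k)) (m : {j // j ∉ K} → ℕ) :
    MeasurableSet (Boundary.level Λ K m) := by
  have h : ∀ (j : Fin k) (c : ℕ), MeasurableSet {x : Λ.Boundary K | (c : ℕ∞) ≤ x.1.deg j} := by
    intro j c
    convert Boundary.measurableSet_castDeg_le (Λ := Λ) K (Pi.single j c) using 1
    ext x
    constructor
    · intro hx i
      rcases eq_or_ne i j with rfl | hij
      · simpa [castDeg] using hx
      · simp [castDeg, hij]
    · intro hx
      simpa [castDeg] using hx j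
  have : Boundary.level Λ K m = ⋂ j : {j // j ∉ K}, ({x : Λ.Boundary K | (m j : ℕ∞) ≤ x.1.deg j} \
      {x : Λ.Boundary K | ((m j + 1 : ℕ) : ℕ∞) ≤ x.1.deg j}) := by
    ext x
    simp only [Boundary.level, Set.mem_ofPred_eq, Set.mem_iInter, Set.mem_sdiff]
    refine forall_congr' fun j => ?_
    generalize x.1.deg j = e
    induction e using ENat.recTopCoe with
    | top => simp
    | coe e => norm_cast; omega
  rw [this]
  exact MeasurableSet.iInter fun j => (h _ _).diff (h _ _)

end Borel

/-! ### The limit of a coherent sequence of paths -/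

section Limit

variable {Λ : KGraph.{u} k}

/-- The sequences of paths of degrees `p + n e`, each of which extends the previous one. -/
def coherent (Λ : KGraph.{u} k) (p e : Fin k → ℕ) : Set (ℕ → Λ.Path) :=
  {X | ∀ n, Λ.d (X n) = p + n • e ∧ Λ.take (X (n + 1)) (p + n • e) = X n}

/-- Initial segments stabilise: once a term is long enough to contain degree `q`, later terms have
the same segment there. This is why the limit path is well defined. -/
theorem take_of_coherent {p e : Fin k → ℕ} {X : ℕ → Λ.Path} (hX : X ∈ Λ.coherent p e) {n n' : ℕ}
    (h : n ≤ n') {q : Fin k → ℕ} (hq : q ≤ p + n • e) : Λ.take (X n') q = Λ.take (X n) q := by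
  induction n', h using Nat.le_induction with
  | base => rfl
  | succ n' h ih =>
    have hle : q ≤ p + n' • e := hq.trans (by gcongr)
    rw [← ih, ← (hX n').2, Λ.take_take hle]
    rw [(hX (n' + 1)).1]
    gcongr
    exact Nat.le_succ _

/-- The element of `ℕ^k` that extends `m ∈ ℕ^J` by zero. -/
def extendZero {K : Finset (Fin k)} (m : {j // j ∉ K} → ℕ) : Fin k → ℕ :=
  fun i => if h : i ∈ K then 0 else m ⟨i, h⟩

/-- The element of `(ℕ ∪ {∞})^k` that extends `m ∈ ℕ^J` by infinity. -/
def extendTop {K : Finset (Fin k)} (m : {j // j ∉ K} → ℕ) : Fin k → ℕ∞ :=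
  fun i => if h : i ∈ K then ⊤ else m ⟨i, h⟩

/-- The indicator of `K`. -/
def oneOn (K : Finset (Fin k)) : Fin k → ℕ := fun i => if i ∈ K then 1 else 0

/-- The largest coordinate. -/
def maxCoord (q : Fin k → ℕ) : ℕ := Finset.univ.sup q

theorem maxCoord_mono {q t : Fin k → ℕ} (h : q ≤ t) : maxCoord q ≤ maxCoord t :=
  Finset.sup_mono_fun fun i _ => h i

/-- Stage `maxCoord q` of a coherent sequence is already long enough in the directions of `K` to
contain degree `q`; off `K` both sides ask for `q ≤ m`. -/
theorem castDeg_le_extendTop {K : Finset (Fin k)} {m : {j // j ∉ K} → ℕ} {q : Fin k → ℕ} :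
    castDeg q ≤ extendTop m ↔ q ≤ extendZero m + maxCoord q • oneOn K := by
  rw [Pi.le_def, Pi.le_def]
  refine forall_congr' fun i => ?_
  by_cases h : i ∈ K
  · have : q i ≤ maxCoord q := Finset.le_sup (f := q) (Finset.mem_univ i)
    simp [castDeg, extendTop, extendZero, oneOn, h, this]
  · simp [castDeg, extendTop, extendZero, oneOn, h]

/-- The semi-infinite path with initial segments `X n`. -/
noncomputable def limitPath {K : Finset (Fin k)} (m : {j // j ∉ K} → ℕ) (X : ℕ → Λ.Path)
    (hX : X ∈ Λ.coherent (extendZero m) (oneOn K)) : Λ.Boundary K :=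
  ⟨PathSpace.ofSeg (extendTop m) (fun p q _ _ => Λ.seg (X (maxCoord q)) p q)
    (fun p q hpq hq => Λ.d_seg hpq (by rw [(hX _).1]; exact castDeg_le_extendTop.1 hq))
    (fun p q t hpq hqt ht => by
      have hq := castDeg_le_extendTop.1 ((castDeg_mono hqt).trans ht)
      -- Segments ending at `q` and at `t` are read from different terms of the sequence; the
      -- earlier one can be read from the later term instead.
      have e := Λ.seg_congr_take (p := p) (take_of_coherent hX (maxCoord_mono hqt) hq)
      obtain ⟨h₁, e₁⟩ := Λ.seg_comp (a := X (maxCoord t)) hpq hqt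
        (by rw [(hX _).1]; exact castDeg_le_extendTop.1 ht)
      exact ⟨by rw [← e]; exact h₁, by simp only [← e]; exact e₁⟩),
    fun i hi => by change extendTop m i = ⊤; simp [extendTop, hi],
    fun i hi => by change extendTop m i ≠ ⊤; simp [extendTop, hi]⟩

theorem limitPath_mem_level {K : Finset (Fin k)} (m : {j // j ∉ K} → ℕ) (X : ℕ → Λ.Path)
    (hX : X ∈ Λ.coherent (extendZero m) (oneOn K)) :
    limitPath m X hX ∈ Boundary.level Λ K m := fun j => by
  change extendTop m j = _
  simp [extendTop, j.2]

/-- Membership of a cylinder set depends on a single term of the sequence. Both the measurability of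
the limit and the computation of its law rest on this. -/
theorem limitPath_mem_cyl {K : Finset (Fin k)} (m : {j // j ∉ K} → ℕ) (X : ℕ → Λ.Path)
    (hX : X ∈ Λ.coherent (extendZero m) (oneOn K)) (a : Λ.Path) :
    limitPath m X hX ∈ Boundary.cyl K a ↔
      Λ.d a ≤ extendZero m + maxCoord (Λ.d a) • oneOn K ∧
        Λ.take (X (maxCoord (Λ.d a))) (Λ.d a) = a := by
  rw [← castDeg_le_extendTop, ← exists_prop]
  refine exists_congr fun h => ?_
  change Λ.seg _ 0 _ = a ↔ _
  rw [KGraph.seg, Λ.drop_zero]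

open Classical in
/-- The map from sequences of paths to semi-infinite paths, with the value `x₀` at sequences that
are not coherent. -/
noncomputable def limitMap {K : Finset (Fin k)} (m : {j // j ∉ K} → ℕ) (x₀ : Λ.Boundary K)
    (X : ℕ → Λ.Path) : Λ.Boundary K :=
  if hX : X ∈ Λ.coherent (extendZero m) (oneOn K) then limitPath m X hX else x₀

theorem measurable_limitMap [Λ.IsFinite] {K : Finset (Fin k)} (m : {j // j ∉ K} → ℕ)
    (x₀ : Λ.Boundary K) : Measurable (limitMap m x₀) := by
  have hG : MeasurableSet (Λ.coherent (extendZero m) (oneOn K)) := by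
    simp only [coherent, Set.ofPred_forall]
    refine MeasurableSet.iInter fun n => ?_
    have : Measurable fun X : ℕ → Λ.Path => (X n, X (n + 1)) := by fun_prop
    exact this (t := {x | Λ.d x.1 = extendZero m + n • oneOn K ∧
      Λ.take x.2 (extendZero m + n • oneOn K) = x.1}) MeasurableSet.of_discrete
  refine Boundary.measurable_of_cyl fun a => ?_
  have : limitMap m x₀ ⁻¹' Boundary.cyl K a =
      (Λ.coherent (extendZero m) (oneOn K) ∩ {X | Λ.d a ≤ extendZero m + maxCoord (Λ.d a) • oneOn K ∧
        Λ.take (X (maxCoord (Λ.d a))) (Λ.d a) = a}) ∪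
      ((Λ.coherent (extendZero m) (oneOn K))ᶜ ∩ {_X | x₀ ∈ Boundary.cyl K a}) := by
    ext X
    by_cases hX : X ∈ Λ.coherent (extendZero m) (oneOn K)
    · simp [limitMap, hX, limitPath_mem_cyl]
    · simp [limitMap, hX]
  rw [this]
  refine (hG.inter (MeasurableSet.const _ |>.inter ?_)).union (hG.compl.inter (MeasurableSet.const _))
  exact (measurable_pi_apply (X := fun _ : ℕ => Λ.Path) (maxCoord (Λ.d a)))
    (t := {b | Λ.take b (Λ.d a) = a}) MeasurableSet.of_discrete

end Limit

/-! ### The measures on the levels of the semi-infinite path space -/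

section LevelMeasure

variable {Λ : KGraph.{u} k} [Λ.IsFinite] [Fintype Λ.V] {W : Λ.Path → ℝ} {q : Fin k → ℝ}

/-- There is a measure on `Λ^{m,∞_K}` whose value at the cylinder set of `a` is the weight of
`a` times `∏_{j ∈ J} q_j^{m_j - d(a)_j}`. -/
theorem IsWeight.exists_levelMeasure (hW : Λ.IsWeight W q) {K : Finset (Fin k)}
    (hq : ∀ i ∈ K, q i = 1) (m : {j // j ∉ K} → ℕ) :
    ∃ ν : Measure (Λ.Boundary K), ν (Boundary.level Λ K m)ᶜ = 0 ∧
      ∀ a, (∀ j : {j // j ∉ K}, Λ.d a j ≤ m j) →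
        ν (Boundary.cyl K a) =
          ENNReal.ofReal (W a * ∏ j : {j // j ∉ K}, q j ^ (m j - Λ.d a j)) := by
  classical
  -- The chain grows only in the directions of `K`, where each ratio is one.
  have he : ∏ i, q i ^ oneOn K i = 1 := Finset.prod_eq_one fun i _ => by
    by_cases h : i ∈ K <;> simp [oneOn, h, hq]
  obtain ⟨P, hP, hlaw, hae⟩ := hW.exists_chain (p := extendZero m) he
  have hQ : 0 < ∏ i, q i ^ (extendZero m) i :=
    Finset.prod_pos fun i _ => pow_pos (hW.ratio_pos i) _
  change ∀ᵐ X ∂P, X ∈ Λ.coherent (extendZero m) (oneOn K) at hae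
  -- A coherent sequence supplies the default value of the limit map; the choice is immaterial,
  -- because incoherent sequences form a null set.
  obtain ⟨X₀, hX₀⟩ := hae.exists
  let x₀ := limitPath m X₀ hX₀
  have hmeas := measurable_limitMap m x₀
  -- The factor undoes the normalisation of the chain, so that its law at each stage becomes the
  -- weight itself.
  refine ⟨ENNReal.ofReal (∏ i, q i ^ (extendZero m) i) • P.map (limitMap m x₀), ?_, ?_⟩
  · rw [Measure.smul_apply, Measure.map_apply hmeas (Boundary.measurableSet_level K m).compl]
    have : P (limitMap m x₀ ⁻¹' (Boundary.level Λ K m)ᶜ) = 0 := by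
      refine measure_mono_null ?_ hae
      intro X hX (hX' : X ∈ Λ.coherent (extendZero m) (oneOn K))
      refine hX ?_
      rw [limitMap, dif_pos hX']
      exact limitPath_mem_level m X hX'
    rw [this, smul_zero]
  · intro a ha
    -- A stage of the chain from which the initial segment of degree `d(a)` can be read.
    set N := maxCoord (Λ.d a) with hN
    have hle : Λ.d a ≤ extendZero m + N • oneOn K := by
      rw [hN, ← castDeg_le_extendTop]
      intro i
      by_cases h : i ∈ K
      · simp [extendTop, h]
      · simpa [castDeg, extendTop, h] using ha ⟨i, h⟩
    have h1 : P (limitMap m x₀ ⁻¹' Boundary.cyl K a) =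
        P {X | X N ∈ {b | Λ.take b (Λ.d a) = a}} := by
      refine measure_congr ?_
      filter_upwards [hae] with X hX
      refine propext ?_
      change limitMap m x₀ X ∈ Boundary.cyl K a ↔ Λ.take (X N) (Λ.d a) = a
      rw [limitMap, dif_pos hX, limitPath_mem_cyl, and_iff_right hle]
    have h2 := congrArg (fun μ => μ {b | Λ.take b (Λ.d a) = a}) (hlaw N)
    beta_reduce at h2
    rw [Measure.map_apply (by fun_prop) MeasurableSet.of_discrete,
      weightMeasure_apply hW.pos hQ] at h2
    have h3 : ∑ b ∈ Λ.degreeFinset (extendZero m + N • oneOn K),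
        {b | Λ.take b (Λ.d a) = a}.indicator W b =
        ∑ b ∈ Λ.extensions a (extendZero m + N • oneOn K - Λ.d a), W b := by
      simp only [Set.indicator_apply, Set.mem_ofPred_eq]
      rw [← Finset.sum_filter]
      refine Finset.sum_congr (Finset.ext fun b => ?_) fun _ _ => rfl
      rw [Finset.mem_filter, mem_degreeFinset, mem_extensions, add_tsub_cancel_of_le hle]
    -- The coordinates in `K` contribute factors one, so the result does not depend on the stage
    -- `N`.
    have h4 : ∏ i, q i ^ (extendZero m + N • oneOn K - Λ.d a) i =
        ∏ j : {j // j ∉ K}, q j ^ (m j - Λ.d a j) := by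
      rw [← Fintype.prod_subtype_mul_prod_subtype (fun i => i ∈ K), Finset.prod_eq_one, one_mul]
      · refine Finset.prod_congr rfl fun j _ => ?_
        simp [extendZero, oneOn, j.2]
      · intro i _
        rw [hq i i.2, one_pow]
    rw [Measure.smul_apply, Measure.map_apply hmeas (Boundary.measurableSet_cyl K a), h1]
    refine (congrArg (fun t => _ • t) h2).trans ?_
    rw [smul_eq_mul, ← ENNReal.ofReal_mul hQ.le, h3, hW.sum_extensions, h4,
      mul_div_cancel₀ _ hQ.ne']

end LevelMeasure

end KGraph

/-! ### Sums over `ℕ^J` -/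

/-- Tonelli's theorem, by induction on the finite index type; values in `ℝ≥0∞` spare any summability
condition. -/
theorem ENNReal.tsum_prod_pi {ι : Type*} [Fintype ι] (g : ι → ℕ → ℝ≥0∞) :
    ∑' m : ι → ℕ, ∏ j, g j (m j) = ∏ j, ∑' n, g j n := by
  classical
  revert g
  refine Fintype.induction_empty_option (P := fun ι [Fintype ι] => ∀ g : ι → ℕ → ℝ≥0∞,
    ∑' m : ι → ℕ, ∏ j, g j (m j) = ∏ j, ∑' n, g j n) ?_ ?_ ?_ ι
  · intro α β _ e ih g
    let := Fintype.ofEquiv β e.symm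
    have h := ih fun a => g (e a)
    rw [← (Equiv.arrowCongr e (Equiv.refl ℕ)).tsum_eq, ← e.prod_comp, ← h]
    refine tsum_congr fun m => ?_
    rw [← e.prod_comp]
    simp
  · intro g
    simp
  · intro α _ ih g
    rw [← (Equiv.piOptionEquivProd (β := fun _ => ℕ)).symm.tsum_eq, ENNReal.tsum_prod',
      Fintype.prod_option, ← ih fun a => g (some a), ← ENNReal.tsum_mul_right]
    refine tsum_congr fun n => ?_
    rw [← ENNReal.tsum_mul_left]
    refine tsum_congr fun m => ?_
    rw [Fintype.prod_option]
    rfl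

/-- Shifting the index by `d` leaves the plain geometric series. The `if` discards `n < d`, where
truncated subtraction would contribute ones. -/
theorem ENNReal.tsum_shifted_geometric {q : ℝ} (h0 : 0 ≤ q) (h1 : q < 1) (d : ℕ) :
    ∑' n, (if d ≤ n then ENNReal.ofReal (q ^ (n - d)) else 0) = ENNReal.ofReal (1 - q)⁻¹ := by
  rw [← (add_left_injective d).tsum_eq]
  · simp only [le_add_iff_nonneg_left, zero_le, if_true, add_tsub_cancel_right]
    rw [← ENNReal.ofReal_tsum_of_nonneg (fun n => pow_nonneg h0 n)
      (summable_geometric_of_lt_one h0 h1), tsum_geometric_of_lt_one h0 h1]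
  · intro n hn
    by_cases h : d ≤ n
    · exact ⟨n - d, Nat.sub_add_cancel h⟩
    · simp [h] at hn

namespace KGraph

variable {k : ℕ}

open MeasureTheory ProbabilityTheory

/-! ### Summing the level measures to a probability measure -/

section BoundaryMeasure

variable {Λ : KGraph.{u} k} [Λ.IsFinite] [Fintype Λ.V] {W : Λ.Path → ℝ} {q : Fin k → ℝ}

/-- There are measures on the levels `Λ^{m,∞_K}` that agree with the normalised weight on the
cylinder sets, and their sum is a probability measure whose value at the cylinder set of `a` is
the weight of `a`. -/
theorem IsWeight.exists_boundaryMeasure (hW : Λ.IsWeight W q) {K : Finset (Fin k)}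
    (hq : ∀ i ∈ K, q i = 1) (hq' : ∀ i ∉ K, q i < 1) :
    ∃ ν : ({j // j ∉ K} → ℕ) → Measure (Λ.Boundary K),
      (∀ m, ν m (Boundary.level Λ K m)ᶜ = 0 ∧
        ∀ a, (∀ j : {j // j ∉ K}, Λ.d a j = m j) →
          ν m (Boundary.cyl K a) = ENNReal.ofReal (W a * ∏ j ∈ Kᶜ, (1 - q j))) ∧
      (∀ a, Measure.sum ν (Boundary.cyl K a) = ENNReal.ofReal (W a)) ∧
      IsProbabilityMeasure (Measure.sum ν) := by
  classical
  choose ν₀ hν₀ hν₁ using fun m => hW.exists_levelMeasure hq m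
  set C := ∏ j ∈ Kᶜ, (1 - q j) with hC
  have hCprod : C = ∏ j : {j // j ∉ K}, (1 - q j) := by
    rw [hC]
    exact Finset.prod_subtype _ (fun x => Finset.mem_compl) _
  have hC0 : 0 < C := Finset.prod_pos fun j hj => sub_pos.2 (hq' j (Finset.mem_compl.1 hj))
  -- The mass of `Z(a)` at level `m` is `W a` times a product over `J` of functions of one
  -- coordinate each, so the sum over `m` becomes a product of sums.
  let g : Λ.Path → {j // j ∉ K} → ℕ → ℝ≥0∞ := fun a j n =>
    if Λ.d a j ≤ n then ENNReal.ofReal (q j ^ (n - Λ.d a j)) else 0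
  have hcyl : ∀ a m, ν₀ m (Boundary.cyl K a) = ENNReal.ofReal (W a) * ∏ j, g a j (m j) := by
    intro a m
    by_cases h : ∀ j : {j // j ∉ K}, Λ.d a j ≤ m j
    · rw [hν₁ m a h, ENNReal.ofReal_mul (hW.pos a).le, ENNReal.ofReal_prod_of_nonneg
        (f := fun j : {j // j ∉ K} => q j ^ (m j - Λ.d a j))
        fun j _ => pow_nonneg (hW.ratio_pos j).le _]
      congr 1
      exact Finset.prod_congr rfl fun j _ => (if_pos (h j)).symm
    · have h' := h
      push Not at h'
      obtain ⟨j, hj⟩ := h'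
      rw [Finset.prod_eq_zero (Finset.mem_univ j) (if_neg hj.not_ge), mul_zero]
      refine measure_mono_null ?_ (hν₀ m)
      intro x hx hx'
      have h1 := hx.1 j
      rw [hx' j] at h1
      exact absurd (ENat.natCast_le_natCast.1 h1) hj.not_ge
  have hsum : ∀ a, Measure.sum (fun m => ENNReal.ofReal C • ν₀ m) (Boundary.cyl K a) =
      ENNReal.ofReal (W a) := by
    intro a
    rw [Measure.sum_apply _ (Boundary.measurableSet_cyl K a)]
    simp only [Measure.smul_apply, hcyl, smul_eq_mul]
    -- The geometric series multiply to `∏ (1 - q_j)⁻¹ = C⁻¹`, which the factor `C` cancels.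
    rw [ENNReal.tsum_mul_left, ENNReal.tsum_mul_left, ENNReal.tsum_prod_pi]
    simp only [g]
    rw [Finset.prod_congr rfl fun (j : {j // j ∉ K}) _ =>
      ENNReal.tsum_shifted_geometric (hW.ratio_pos j).le (hq' j j.2) (Λ.d a j),
      ← ENNReal.ofReal_prod_of_nonneg fun (j : {j // j ∉ K}) _ =>
        inv_nonneg.2 (sub_nonneg.2 (hq' j j.2).le), Finset.prod_inv_distrib, ← hCprod,
      mul_left_comm, ← ENNReal.ofReal_mul hC0.le, mul_inv_cancel₀ hC0.ne', ENNReal.ofReal_one,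
      mul_one]
  refine ⟨fun m => ENNReal.ofReal C • ν₀ m, fun m => ⟨?_, fun a ha => ?_⟩, hsum, ⟨?_⟩⟩
  · rw [Measure.smul_apply, hν₀, smul_zero]
  · rw [Measure.smul_apply, hν₁ m a fun j => (ha j).le, smul_eq_mul, ← ENNReal.ofReal_mul hC0.le]
    congr 1
    rw [Finset.prod_eq_one fun j _ => by rw [ha j, tsub_self, pow_zero], mul_one, mul_comm]
  -- The cylinder sets of the vertices partition the space, so the total mass is the sum of the
  -- vertex weights.
  · have huniv : (Set.univ : Set (Λ.Boundary K)) = ⋃ v, Boundary.cyl K (Λ.id v) := by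
      ext x
      simp only [Set.mem_univ, Set.mem_iUnion, true_iff]
      exact ⟨x.1.range, PathSpace.mem_cyl_id.2 rfl⟩
    rw [huniv, measure_iUnion _ fun v => Boundary.measurableSet_cyl K _, tsum_fintype]
    · simp only [hsum]
      rw [← ENNReal.ofReal_sum_of_nonneg fun v _ => (hW.pos _).le, hW.sum_vertices,
        ENNReal.ofReal_one]
    · intro v w hvw
      refine Set.disjoint_left.2 fun x hx hx' => hvw ?_
      exact (PathSpace.mem_cyl_id.1 hx).symm.trans (PathSpace.mem_cyl_id.1 hx')

end BoundaryMeasure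

end KGraph

namespace KGraph

variable {k : ℕ}

open MeasureTheory

namespace Toeplitz

variable {Λ : KGraph.{u} k}

/-! ### Relations of the universal family -/

/-- An element is the family of its images under all Toeplitz-Cuntz-Krieger families, so relations
may be checked in each of them. -/
theorem ext_rep {a b : Toeplitz Λ} (h : ∀ F : TCKRep Λ, rep F a = rep F b) : a = b :=
  Subtype.ext (lp.ext (funext h))

theorem t_mul_t {a b : Λ.Path} (h : Λ.s a = Λ.r b) : t a * t b = t (Λ.comp a b h) :=
  ext_rep fun F => by simp only [map_mul, rep_t]; exact F.isTCK.mul a b h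

theorem isStarProjection_t_id (v : Λ.V) : IsStarProjection (t (Λ.id v)) where
  isIdempotentElem := ext_rep fun F => by
    simp only [map_mul, rep_t]; exact (F.isTCK.proj v).isIdempotentElem
  isSelfAdjoint := ext_rep fun F => by
    simp only [map_star, rep_t]; exact (F.isTCK.proj v).isSelfAdjoint

theorem t_id_mul_t_id {v w : Λ.V} (h : v ≠ w) : t (Λ.id v) * t (Λ.id w) = 0 :=
  ext_rep fun F => by simp only [map_mul, rep_t, map_zero]; exact F.isTCK.orthogonal v w h

theorem t_mul_star_t_id (a : Λ.Path) : t a * star (t (Λ.id (Λ.s a))) = t a := by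
  rw [(isStarProjection_t_id _).isSelfAdjoint.star_eq, t_mul_t (Λ.r_id _).symm, Λ.comp_id]

theorem star_t_mul_t [Λ.IsFinite] (a b : Λ.Path) :
    star (t a) * t b = ∑ p ∈ (Λ.finite_minExt a b).toFinset, t p.1 * star (t p.2) :=
  ext_rep fun F => by
    simp only [map_mul, map_star, rep_t, map_sum]
    rw [← finsum_mem_eq_finite_toFinset_sum]
    exact F.isTCK.star_mul a b

theorem t_mul_star_t_eq_zero {a b : Λ.Path} (h : Λ.s a ≠ Λ.s b) : t a * star (t b) = 0 := by
  rw [← t_mul_star_t_id a, ← t_mul_star_t_id b, star_mul, star_star, mul_assoc,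
    ← mul_assoc (star (t (Λ.id (Λ.s a)))), (isStarProjection_t_id _).isSelfAdjoint.star_eq,
    t_id_mul_t_id h, zero_mul, mul_zero]

end Toeplitz

open Classical in
/-- Composition of paths as a total function, with the value `a` if `a` and `b` are not
composable. -/
noncomputable def compTotal (Λ : KGraph.{u} k) (a b : Λ.Path) : Λ.Path :=
  if h : Λ.s a = Λ.r b then Λ.comp a b h else a

theorem compTotal_eq {Λ : KGraph.{u} k} {a b : Λ.Path} (h : Λ.s a = Λ.r b) :
    Λ.compTotal a b = Λ.comp a b h := dif_pos h

namespace Toeplitz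

variable {Λ : KGraph.{u} k}

/-- Only the middle factor `t_b⋆ t_c` needs expanding, over minimal common extensions. The total
composition avoids carrying composability proofs inside the sum. -/
theorem span_mul_span [Λ.IsFinite] {a b c e : Λ.Path} (hab : Λ.s a = Λ.s b)
    (hce : Λ.s c = Λ.s e) :
    (t a * star (t b)) * (t c * star (t e)) = ∑ p ∈ (Λ.finite_minExt b c).toFinset,
      t (Λ.compTotal a p.1) * star (t (Λ.compTotal e p.2)) := by
  have h : (t a * star (t b)) * (t c * star (t e)) = t a * (star (t b) * t c) * star (t e) := by
    simp only [mul_assoc]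
  rw [h, star_t_mul_t, Finset.mul_sum, Finset.sum_mul]
  refine Finset.sum_congr rfl fun p hp => ?_
  obtain ⟨h1, h2, -, -⟩ := (Set.Finite.mem_toFinset _).1 hp
  rw [compTotal_eq (hab.trans h1), compTotal_eq (hce.symm.trans h2), ← t_mul_t (hab.trans h1),
    ← t_mul_t (hce.symm.trans h2), star_mul]
  simp only [mul_assoc]

/-! ### The spanning family -/

variable (Λ) in
/-- The linear span of the elements `t_a t_b⋆`. -/
noncomputable def coreSpan : Submodule ℂ (Toeplitz Λ) :=
  Submodule.span ℂ (Set.range fun p : Λ.Path × Λ.Path => t p.1 * star (t p.2))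

theorem t_mul_star_t_mem (a b : Λ.Path) : t a * star (t b) ∈ coreSpan Λ :=
  Submodule.subset_span ⟨(a, b), rfl⟩

theorem mul_mem_coreSpan [Λ.IsFinite] {x y : Toeplitz Λ} (hx : x ∈ coreSpan Λ)
    (hy : y ∈ coreSpan Λ) : x * y ∈ coreSpan Λ := by
  induction hx using Submodule.span_induction with
  | zero => rw [zero_mul]; exact zero_mem _
  | add x₁ x₂ _ _ h₁ h₂ => rw [add_mul]; exact add_mem h₁ h₂
  | smul c x _ h => rw [smul_mul_assoc]; exact Submodule.smul_mem _ c h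
  | mem x hx =>
    obtain ⟨⟨a, b⟩, rfl⟩ := hx
    induction hy using Submodule.span_induction with
    | zero => rw [mul_zero]; exact zero_mem _
    | add x₁ x₂ _ _ h₁ h₂ => rw [mul_add]; exact add_mem h₁ h₂
    | smul c x _ h => rw [mul_smul_comm]; exact Submodule.smul_mem _ c h
    | mem y hy =>
      obtain ⟨⟨c, e⟩, rfl⟩ := hy
      by_cases hab : Λ.s a = Λ.s b
      · by_cases hce : Λ.s c = Λ.s e
        · simp only [span_mul_span hab hce]
          exact Submodule.sum_mem _ fun p _ => t_mul_star_t_mem _ _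
        · simp only [t_mul_star_t_eq_zero hce, mul_zero]
          exact zero_mem _
      · simp only [t_mul_star_t_eq_zero hab, zero_mul]
        exact zero_mem _

theorem star_mem_coreSpan {x : Toeplitz Λ} (hx : x ∈ coreSpan Λ) : star x ∈ coreSpan Λ := by
  induction hx using Submodule.span_induction with
  | zero => rw [star_zero]; exact zero_mem _
  | add x₁ x₂ _ _ h₁ h₂ => rw [star_add]; exact add_mem h₁ h₂
  | smul c x _ h => rw [star_smul]; exact Submodule.smul_mem _ _ h
  | mem x hx =>
    obtain ⟨⟨a, b⟩, rfl⟩ := hx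
    simp only [star_mul, star_star]
    exact t_mul_star_t_mem _ _

/-- The span contains the generators, since `t_a = t_a t_{s(a)}⋆`, and is closed under products and
adjoints, so it contains the algebra whose closure defines `Toeplitz Λ`. -/
theorem dense_coreSpan [Λ.IsFinite] : Dense (coreSpan Λ : Set (Toeplitz Λ)) := by
  have hadj : ∀ y ∈ NonUnitalStarAlgebra.adjoin ℂ (Set.range Λ.universalGen),
      ∃ x ∈ coreSpan Λ, x.1 = y := by
    intro y hy
    induction hy using NonUnitalStarAlgebra.adjoin_induction with
    | mem y hy =>
      obtain ⟨a, rfl⟩ := hy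
      refine ⟨t a, ?_, rfl⟩
      rw [← t_mul_star_t_id]
      exact t_mul_star_t_mem _ _
    | add y z _ _ hy hz =>
      obtain ⟨x, hx, rfl⟩ := hy
      obtain ⟨x', hx', rfl⟩ := hz
      exact ⟨x + x', add_mem hx hx', rfl⟩
    | zero => exact ⟨0, zero_mem _, rfl⟩
    | mul y z _ _ hy hz =>
      obtain ⟨x, hx, rfl⟩ := hy
      obtain ⟨x', hx', rfl⟩ := hz
      exact ⟨x * x', mul_mem_coreSpan hx hx', rfl⟩
    | smul c y _ hy =>
      obtain ⟨x, hx, rfl⟩ := hy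
      exact ⟨c • x, Submodule.smul_mem _ c hx, rfl⟩
    | star y _ hy =>
      obtain ⟨x, hx, rfl⟩ := hy
      exact ⟨star x, star_mem_coreSpan hx, rfl⟩
  intro x
  -- The closure is taken in the ambient product, so density is pulled back along the inclusion.
  have h : Topology.IsInducing fun y : Toeplitz Λ => y.1 := ⟨rfl⟩
  rw [h.closure_eq_preimage_closure_image]
  refine closure_mono ?_ x.2
  intro y hy
  obtain ⟨z, hz, rfl⟩ := hadj y hy
  exact ⟨z, hz, rfl⟩

/-- A closed property of elements that is stable under linear combinations holds everywhere if it
holds at the elements `t_a t_b⋆`. -/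
theorem induction_on [Λ.IsFinite] {p : Toeplitz Λ → Prop} (x : Toeplitz Λ)
    (hmem : ∀ a b, p (t a * star (t b))) (hzero : p 0) (hadd : ∀ x y, p x → p y → p (x + y))
    (hsmul : ∀ (c : ℂ) x, p x → p (c • x)) (hclosed : IsClosed {x | p x}) : p x := by
  refine dense_coreSpan.induction (P := p) (fun y hy => ?_) hclosed x
  induction hy using Submodule.span_induction with
  | mem y hy => obtain ⟨⟨a, b⟩, rfl⟩ := hy; exact hmem a b
  | zero => exact hzero
  | add y z _ _ hy hz => exact hadd y z hy hz
  | smul c y _ hy => exact hsmul c y hy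

/-! ### The gauge action -/

theorem norm_gauge_le (z : Fin k → Circle) (a : Toeplitz Λ) : ‖gauge z a‖ ≤ ‖a‖ :=
  NonUnitalStarAlgHom.norm_apply_le (gauge z) a

theorem gauge_t_mul_star_t (z : Fin k → Circle) (a b : Λ.Path) :
    gauge z (t a * star (t b)) =
      ((torusPow z (Λ.d a) : ℂ) * star (torusPow z (Λ.d b) : ℂ)) • (t a * star (t b)) := by
  rw [map_mul, map_star, gauge_t, gauge_t, star_smul, smul_mul_smul_comm]

theorem continuous_torusPow (n : Fin k → ℕ) : Continuous fun z : Fin k → Circle => torusPow z n := by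
  unfold torusPow
  fun_prop

/-- On spanning elements the orbit is a trigonometric polynomial times a fixed element;
contractivity of `γ_z` makes approximation of `a` uniform in `z`. -/
theorem continuous_gauge [Λ.IsFinite] (a : Toeplitz Λ) :
    Continuous fun z : Fin k → Circle => gauge z a := by
  induction a using induction_on with
  | hmem a b =>
    simp only [gauge_t_mul_star_t]
    have h := continuous_torusPow (k := k)
    have h' : ∀ n : Fin k → ℕ, Continuous fun z => (torusPow z n : ℂ) := fun n =>
      continuous_subtype_val.comp (h n)
    exact ((h' _).mul (continuous_star.comp (h' _))).smul continuous_const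
  | hzero => simp only [map_zero]; exact continuous_const
  | hadd x y hx hy => simp only [map_add]; exact hx.add hy
  | hsmul c x hx => simp only [map_smul]; exact hx.const_smul c
  | hclosed =>
    refine isClosed_of_closure_subset fun a ha => ?_
    refine continuous_of_uniform_approx_of_continuous fun u hu => ?_
    obtain ⟨ε, hε, h⟩ := Metric.mem_uniformity_dist.1 hu
    obtain ⟨b, hb, hab⟩ := Metric.mem_closure_iff.1 ha ε hε
    refine ⟨_, hb, fun z => h ?_⟩
    rw [dist_eq_norm, ← map_sub]
    exact (norm_gauge_le z _).trans_lt (by rwa [← dist_eq_norm])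

/-! ### The expectation -/

/-- The point of the torus `𝕋^k` with coordinates in `ℝ/ℤ`. -/
noncomputable def torusPoint (θ : Fin k → AddCircle (1 : ℝ)) : Fin k → Circle :=
  fun i => (θ i).toCircle

theorem continuous_torusPoint : Continuous (torusPoint (k := k)) :=
  continuous_pi fun i => AddCircle.continuous_toCircle.comp (continuous_apply i)

variable (k) in
/-- The normalised Haar measure of the torus. -/
noncomputable def torusMeasure : Measure (Fin k → AddCircle (1 : ℝ)) :=
  Measure.pi fun _ : Fin k => AddCircle.haarAddCircle

instance : IsProbabilityMeasure (torusMeasure k) := by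
  unfold torusMeasure; infer_instance

theorem expectation_eq (a : Toeplitz Λ) :
    expectation a = ∫ θ, gauge (torusPoint θ) a ∂(torusMeasure k) := rfl

theorem integrable_gauge [Λ.IsFinite] (a : Toeplitz Λ) :
    Integrable (fun θ => gauge (torusPoint θ) a) (torusMeasure k) := by
  refine Integrable.of_bound ?_ ‖a‖ (Filter.Eventually.of_forall fun θ => norm_gauge_le _ a)
  exact ((continuous_gauge a).comp continuous_torusPoint).aestronglyMeasurable

/-- The integrand is a product of characters in separate coordinates, so this is orthogonality of
characters on the circle in each variable. -/
theorem integral_torusPow (m n : Fin k → ℕ) :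
    ∫ θ, ((torusPow (torusPoint θ) m : ℂ) * star (torusPow (torusPoint θ) n : ℂ))
      ∂(torusMeasure k) = if m = n then 1 else 0 := by
  have h : ∀ θ : Fin k → AddCircle (1 : ℝ),
      ((torusPow (torusPoint θ) m : ℂ) * star (torusPow (torusPoint θ) n : ℂ)) =
        ∏ i, fourier ((m i : ℤ) - n i) (θ i) := by
    intro θ
    have h1 : torusPow (torusPoint θ) m * (torusPow (torusPoint θ) n)⁻¹ =
        ∏ i, AddCircle.toCircle (((m i : ℤ) - n i) • θ i) := by
      rw [torusPow, torusPow, ← Finset.prod_inv_distrib, ← Finset.prod_mul_distrib]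
      refine Finset.prod_congr rfl fun i _ => ?_
      rw [AddCircle.toCircle_zsmul, zpow_sub, zpow_natCast, zpow_natCast]
      rfl
    have h2 := congrArg Circle.coeHom h1
    rw [map_mul, map_prod] at h2
    simp only [fourier_apply]
    refine Eq.trans ?_ h2
    congr 1
    exact (Circle.coe_inv_eq_conj _).symm
  simp only [h, torusMeasure]
  rw [integral_fintype_prod_eq_prod]
  have h1 : ∀ n : ℤ, ∫ x, fourier n x ∂(AddCircle.haarAddCircle (T := (1 : ℝ))) =
      if n = 0 then 1 else 0 := by
    intro n
    -- The integral of a character is its Fourier coefficient at zero.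
    have h2 := congrFun (fourierCoeff_fourier (T := (1 : ℝ)) n) 0
    simp only [fourierCoeff, neg_zero, fourier_zero, one_smul, Pi.single_apply, eq_comm (a := (0 : ℤ))] at h2
    exact h2
  simp only [h1, sub_eq_zero, Nat.cast_inj]
  split_ifs with hmn
  · subst hmn; simp
  · obtain ⟨i, hi⟩ := Function.ne_iff.1 hmn
    exact Finset.prod_eq_zero (Finset.mem_univ i) (if_neg hi)

theorem expectation_t_mul_star_t [Λ.IsFinite] (a b : Λ.Path) :
    expectation (t a * star (t b)) = if Λ.d a = Λ.d b then t a * star (t b) else 0 := by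
  rw [expectation_eq]
  simp only [gauge_t_mul_star_t]
  rw [integral_smul_const, integral_torusPow]
  split_ifs <;> simp

theorem expectation_add [Λ.IsFinite] (a b : Toeplitz Λ) :
    expectation (a + b) = expectation a + expectation b := by
  simp only [expectation_eq, map_add]
  exact integral_add (integrable_gauge a) (integrable_gauge b)

theorem expectation_smul (c : ℂ) (a : Toeplitz Λ) :
    expectation (c • a) = c • expectation a := by
  simp only [expectation_eq, map_smul]
  exact integral_smul c _

theorem norm_expectation_le (a : Toeplitz Λ) : ‖expectation a‖ ≤ ‖a‖ := by
  rw [expectation_eq]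
  refine (norm_integral_le_of_norm_le_const
    (Filter.Eventually.of_forall fun θ => norm_gauge_le (torusPoint θ) a)).trans ?_
  simp

end Toeplitz
end KGraph

theorem ContinuousLinearMap.inner_star_mul_apply {H : Type*} [NormedAddCommGroup H]
    [InnerProductSpace ℂ H] [CompleteSpace H] (S T : H →L[ℂ] H) (x y : H) :
    inner ℂ x ((star S * T) y) = inner ℂ (S x) (T y) := by
  change inner ℂ x (ContinuousLinearMap.adjoint S (T y)) = _
  rw [ContinuousLinearMap.adjoint_inner_right]

namespace KGraph

variable {k : ℕ}

open MeasureTheory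

namespace Toeplitz

variable {Λ : KGraph.{u} k} {K : Finset (Fin k)}

/-! ### Vector states -/

theorem norm_pointMass (x : Λ.Boundary K) : ‖pointMass x‖ = 1 := by
  classical
  rw [pointMass, lp.norm_single (by norm_num), norm_one]

variable [Λ.IsFinite]

theorem vectorState_add (a b : Toeplitz Λ) (x : Λ.Boundary K) :
    vectorState K (a + b) x = vectorState K a x + vectorState K b x := by
  simp only [vectorState, map_add, add_apply, inner_add_right]

theorem vectorState_smul (c : ℂ) (a : Toeplitz Λ) (x : Λ.Boundary K) :
    vectorState K (c • a) x = c * vectorState K a x := by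
  simp only [vectorState, map_smul, smul_apply, inner_smul_right]

theorem norm_vectorState_le (a : Toeplitz Λ) (x : Λ.Boundary K) : ‖vectorState K a x‖ ≤ ‖a‖ := by
  refine (norm_inner_le_norm _ _).trans ?_
  rw [norm_pointMass, one_mul]
  refine ((boundaryRep K a).le_opNorm _).trans ?_
  rw [norm_pointMass, mul_one]
  exact NonUnitalStarAlgHom.norm_apply_le (boundaryRep K) a

/-- The vector functional at a point as a continuous linear map. -/
noncomputable def vectorStateCLM (x : Λ.Boundary K) : Toeplitz Λ →L[ℂ] ℂ :=
  LinearMap.mkContinuous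
    { toFun := fun a => vectorState K a x
      map_add' := fun a b => vectorState_add a b x
      map_smul' := fun c a => vectorState_smul c a x } 1
    fun a => by rw [one_mul]; exact norm_vectorState_le a x

theorem vectorStateCLM_apply (x : Λ.Boundary K) (a : Toeplitz Λ) :
    vectorStateCLM x a = vectorState K a x := rfl

open scoped ComplexOrder in
theorem vectorState_star_mul_self_nonneg (a : Toeplitz Λ) (x : Λ.Boundary K) :
    0 ≤ vectorState K (star a * a) x := by
  have h : vectorState K (star a * a) x =
      inner ℂ (boundaryRep K a (pointMass x)) (boundaryRep K a (pointMass x)) := by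
    have hmul : boundaryRep K (star a * a) = star (boundaryRep K a) * boundaryRep K a := by
      rw [map_mul, map_star]
    rw [vectorState, hmul]
    exact ContinuousLinearMap.inner_star_mul_apply _ _ _ _
  rw [h, inner_self_eq_norm_sq_to_K]
  refine (Complex.zero_le_real.2 (sq_nonneg ‖boundaryRep K a (pointMass x)‖)).trans_eq ?_
  push_cast
  rfl

/-- The value is the inner product of `t_a⋆ ξ_x` with `t_b⋆ ξ_x`, where `t_c⋆ ξ_x` is the point mass
at the shift of `x` if `x ∈ Z(c)` and zero otherwise. A path has only one initial segment of a given
degree, so both survive only when `a = b`. -/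
theorem vectorState_t_mul_star_t (a b : Λ.Path) (x : Λ.Boundary K) (hd : Λ.d a = Λ.d b) :
    vectorState K (t a * star (t b)) x =
      {y | a = b ∧ y ∈ Boundary.cyl K a}.indicator (fun _ => 1) x := by
  classical
  have hB : ∀ c : Λ.Path, star (Λ.boundaryOp K c) = (Boundary.prependEquiv K c).toOp :=
    fun c => PEquiv.star_toOp _
  have h : vectorState K (t a * star (t b)) x =
      inner ℂ ((Boundary.prependEquiv K a).toOp (pointMass x))
        ((Boundary.prependEquiv K b).toOp (pointMass x)) := by
    have hmul : boundaryRep K (t a * star (t b)) =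
        star (Boundary.prependEquiv K a).toOp * (Boundary.prependEquiv K b).toOp := by
      rw [map_mul, map_star, boundaryRep_t, boundaryRep_t, hB, PEquiv.star_toOp]
      rfl
    rw [vectorState, hmul]
    exact ContinuousLinearMap.inner_star_mul_apply _ _ _ _
  have hzero : ∀ c, x ∉ Boundary.cyl K c →
      (Boundary.prependEquiv K c).toOp (pointMass x) = 0 := by
    intro c hc
    refine PEquiv.toOp_single_eq_zero _ _ (Option.eq_none_iff_forall_ne_some.2 fun y hy => ?_)
    exact hc (Boundary.prependEquiv_symm_eq_some.1 hy).1
  rw [h]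
  by_cases ha : x ∈ Boundary.cyl K a
  · by_cases hb : x ∈ Boundary.cyl K b
    · obtain rfl : a = b := PathSpace.eq_of_mem_cyl ha hb hd
      have hy : (Boundary.prependEquiv K a).symm x = some (x.shift (Λ.d a) ha.1) :=
        Boundary.prependEquiv_symm_eq_some.2 ⟨ha, rfl⟩
      have h1 : (Boundary.prependEquiv K a).toOp (pointMass x) =
          pointMass (x.shift (Λ.d a) ha.1) :=
        PEquiv.toOp_single _ _ _ ((PEquiv.eq_some_iff _).1 hy)
      rw [h1, inner_self_eq_norm_sq_to_K, norm_pointMass, Set.indicator_of_mem]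
      · simp
      · exact ⟨rfl, ha⟩
    · rw [hzero b hb, inner_zero_right, Set.indicator_of_notMem]
      exact fun h => hb (h.1 ▸ h.2)
  · rw [hzero a ha, inner_zero_left, Set.indicator_of_notMem]
    exact fun h => ha h.2

/-! ### The functional of a measure on the semi-infinite path space -/

/-- Averaging over the torus removes the case of different degrees, where `(π^K(t_a t_b⋆) ξ_x |
ξ_x)` could be nonzero for `x` periodic. What remains involves `x` only through a cylinder set. -/
theorem vectorState_expectation_t_mul_star_t (a b : Λ.Path) (x : Λ.Boundary K) :
    vectorState K (expectation (t a * star (t b))) x =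
      {y | a = b ∧ y ∈ Boundary.cyl K a}.indicator (fun _ => 1) x := by
  rw [expectation_t_mul_star_t]
  split_ifs with h
  · exact vectorState_t_mul_star_t a b x h
  · rw [Set.indicator_of_notMem]
    · exact (vectorStateCLM x).map_zero
    · rintro ⟨rfl, -⟩
      exact h rfl

theorem norm_vectorState_expectation_le (a : Toeplitz Λ) (x : Λ.Boundary K) :
    ‖vectorState K (expectation a) x‖ ≤ ‖a‖ :=
  (norm_vectorState_le _ x).trans (norm_expectation_le a)

theorem vectorState_expectation_add (a b : Toeplitz Λ) (x : Λ.Boundary K) :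
    vectorState K (expectation (a + b)) x =
      vectorState K (expectation a) x + vectorState K (expectation b) x := by
  rw [expectation_add, vectorState_add]

theorem vectorState_expectation_smul (c : ℂ) (a : Toeplitz Λ) (x : Λ.Boundary K) :
    vectorState K (expectation (c • a)) x = c * vectorState K (expectation a) x := by
  rw [expectation_smul, vectorState_smul]

/-- On spanning elements these are indicators of cylinder sets or zero, and norm limits of elements
give pointwise limits of functions. -/
theorem measurable_vectorState_expectation (a : Toeplitz Λ) :
    Measurable (vectorState K (expectation a)) := by
  induction a using induction_on with
  | hmem a b =>
    simp only [funext (vectorState_expectation_t_mul_star_t a b (K := K))]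
    exact measurable_const.indicator ((MeasurableSet.const _).inter
      (Boundary.measurableSet_cyl K a))
  | hzero =>
    have : vectorState K (expectation (0 : Toeplitz Λ)) = 0 := by
      funext x
      have := vectorState_expectation_smul 0 0 x
      rwa [zero_smul, zero_mul] at this
    rw [this]
    exact measurable_const
  | hadd x y hx hy =>
    simp only [funext (vectorState_expectation_add x y (K := K))]
    exact hx.add hy
  | hsmul c x hx =>
    simp only [funext (vectorState_expectation_smul c x (K := K))]
    exact hx.const_mul c
  | hclosed =>
    refine isClosed_of_closure_subset fun a ha => ?_
    obtain ⟨b, hb, hab⟩ := mem_closure_iff_seq_limit.1 ha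
    refine measurable_of_tendsto_metrizable hb (tendsto_pi_nhds.2 fun x => ?_)
    rw [tendsto_iff_norm_sub_tendsto_zero] at hab ⊢
    refine squeeze_zero (fun _ => norm_nonneg _) (fun n => ?_) hab
    have h : vectorState K (expectation (b n)) x - vectorState K (expectation a) x =
        vectorState K (expectation (b n - a)) x := by
      rw [sub_eq_iff_eq_add, ← vectorState_expectation_add, sub_add_cancel]
    rw [h]
    exact norm_vectorState_expectation_le _ x

variable {μ : Measure (Λ.Boundary K)} [IsProbabilityMeasure μ]

theorem integrable_vectorState_expectation (μ : Measure (Λ.Boundary K)) [IsFiniteMeasure μ]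
    (a : Toeplitz Λ) : Integrable (vectorState K (expectation a)) μ :=
  Integrable.of_bound (measurable_vectorState_expectation a).aestronglyMeasurable ‖a‖
    (Filter.Eventually.of_forall fun x => norm_vectorState_expectation_le a x)

/-- The functional `a ↦ ∫ (π^K(Φ^γ(a)) ξ_x | ξ_x) dμ(x)` of a probability measure. -/
noncomputable def measureState (μ : Measure (Λ.Boundary K)) [IsProbabilityMeasure μ] :
    Toeplitz Λ →L[ℂ] ℂ :=
  LinearMap.mkContinuous
    { toFun := fun a => ∫ x, vectorState K (expectation a) x ∂μ
      map_add' := fun a b => by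
        simp only [vectorState_expectation_add]
        exact integral_add (integrable_vectorState_expectation μ a)
          (integrable_vectorState_expectation μ b)
      map_smul' := fun c a => by
        simp only [vectorState_expectation_smul]
        exact integral_const_mul c _ } 1
    fun a => by
      rw [one_mul]
      refine (norm_integral_le_of_norm_le_const (Filter.Eventually.of_forall fun x =>
        norm_vectorState_expectation_le a x)).trans ?_
      simp

theorem measureState_apply (μ : Measure (Λ.Boundary K)) [IsProbabilityMeasure μ]
    (a : Toeplitz Λ) : measureState μ a = ∫ x, vectorState K (expectation a) x ∂μ := rfl

theorem measureState_t_mul_star_t_self (a : Λ.Path) :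
    measureState μ (t a * star (t a)) = (μ.real (Boundary.cyl K a) : ℂ) := by
  rw [measureState_apply]
  simp only [vectorState_expectation_t_mul_star_t, true_and]
  exact (integral_indicator (Boundary.measurableSet_cyl K a)).trans (by simp)

theorem measureState_t_mul_star_t_of_ne {a b : Λ.Path} (h : a ≠ b) :
    measureState μ (t a * star (t b)) = 0 := by
  rw [measureState_apply]
  simp [vectorState_expectation_t_mul_star_t, h]

open scoped ComplexOrder in
-- Passing the vector functional under the integral defining `Φ^γ` gives an average of its values at
-- `(γ_z a)⋆ (γ_z a)`.
theorem vectorState_expectation_star_mul_self_nonneg (a : Toeplitz Λ) (x : Λ.Boundary K) :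
    0 ≤ vectorState K (expectation (star a * a)) x := by
  rw [← vectorStateCLM_apply, expectation_eq,
    ← ContinuousLinearMap.integral_comp_comm _ (integrable_gauge _)]
  refine integral_nonneg fun θ => ?_
  simp only [vectorStateCLM_apply, map_mul, map_star]
  exact vectorState_star_mul_self_nonneg _ x

open scoped ComplexOrder in
theorem isState_measureState [Fintype Λ.V] : IsState (measureState μ) := by
  classical
  refine ⟨fun a => ?_, le_antisymm ?_ ?_⟩
  · rw [measureState_apply]
    exact integral_nonneg fun x => vectorState_expectation_star_mul_self_nonneg a x
  · exact LinearMap.mkContinuous_norm_le _ zero_le_one _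
  -- The sum of the vertex projections plays the role of a unit: it is a projection, hence of norm
  -- at most one, and its value is the total mass of `μ`.
  · set e : Toeplitz Λ := ∑ v, t (Λ.id v) with he
    have hproj : IsStarProjection e := by
      refine ⟨?_, ?_⟩
      · change e * e = e
        rw [he, Finset.sum_mul_sum]
        refine Finset.sum_congr rfl fun v _ => ?_
        rw [Finset.sum_eq_single_of_mem v (Finset.mem_univ v)
          fun w _ hw => t_id_mul_t_id hw.symm]
        exact (isStarProjection_t_id v).isIdempotentElem
      · exact isSelfAdjoint_sum _ fun v _ => (isStarProjection_t_id v).isSelfAdjoint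
    have hφ : measureState μ e = 1 := by
      have h1 : ∀ v, measureState μ (t (Λ.id v)) = (μ.real (Boundary.cyl K (Λ.id v)) : ℂ) := by
        intro v
        rw [← measureState_t_mul_star_t_self]
        congr 1
        rw [(isStarProjection_t_id v).isSelfAdjoint.star_eq,
          (isStarProjection_t_id v).isIdempotentElem.eq]
      rw [he, map_sum]
      simp only [h1]
      rw [← Complex.ofReal_sum, ← measureReal_biUnion_finset]
      · have : (⋃ v ∈ (Finset.univ : Finset Λ.V), Boundary.cyl K (Λ.id v)) = Set.univ := by
          ext x
          simp only [Finset.mem_univ, Set.iUnion_true, Set.mem_iUnion, Set.mem_univ, iff_true]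
          exact ⟨x.1.range, PathSpace.mem_cyl_id.2 rfl⟩
        rw [this]
        simp
      · intro v _ w _ hvw
        refine Set.disjoint_left.2 fun x hx hx' => hvw ?_
        exact (PathSpace.mem_cyl_id.1 hx).symm.trans (PathSpace.mem_cyl_id.1 hx')
      · exact fun v _ => Boundary.measurableSet_cyl K _
    have h2 := (measureState μ).le_opNorm e
    rw [hφ, norm_one] at h2
    exact h2.trans (mul_le_of_le_one_right (norm_nonneg _) hproj.norm_le)

end Toeplitz
end KGraph

namespace KGraph

variable {k : ℕ}

open MeasureTheory

/-! ### A symmetry of minimal common extensions -/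

section MinExt

variable {Λ : KGraph.{u} k}

/-- Minimality of `b η = c ζ` means that `d(η)` and `d(ζ)` have disjoint supports. This condition
does not involve `b` and `c`, so the common path `a η = e ζ` is minimal too. -/
theorem swap_mem_minExt {a b c e : Λ.Path} (hce : Λ.s c = Λ.s e) (hab : Λ.s a = Λ.s b)
    {p : Λ.Path × Λ.Path} (hp : p ∈ Λ.minExt b c)
    (h : Λ.compTotal a p.1 = Λ.compTotal e p.2) :
    p.swap ∈ Λ.minExt e a ∧ Λ.compTotal c p.swap.1 = Λ.compTotal b p.swap.2 := by
  obtain ⟨η, ζ⟩ := p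
  obtain ⟨h1, h2, h3, h4⟩ := hp
  simp only [Prod.swap_prod_mk] at h h1 h2 h3 h4 ⊢
  rw [compTotal_eq (hab.trans h1), compTotal_eq (hce.symm.trans h2)] at h
  refine ⟨⟨hce.symm.trans h2, hab.trans h1, h.symm, ?_⟩, ?_⟩
  · have hd := congrArg Λ.d h
    have hd' := congrArg Λ.d h3
    simp only [Λ.d_comp] at hd hd' h4 ⊢
    funext i
    have e1 := congrFun hd i
    have e2 := congrFun hd' i
    have e3 := congrFun h4 i
    simp only [Pi.add_apply, Pi.sup_apply] at *
    omega
  · rw [compTotal_eq h1, compTotal_eq h2, h3]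

end MinExt

/-! ### The dynamics on the spanning elements -/

namespace Toeplitz

variable {Λ : KGraph.{u} k}

theorem torusPow_exp (r : Fin k → ℝ) (x : ℝ) (n : Fin k → ℕ) :
    torusPow (fun i => Circle.exp (x * r i)) n = Circle.exp (x * ∑ i, r i * n i) := by
  have hsum : ∀ (S : Finset (Fin k)) (f : Fin k → ℝ),
      Circle.exp (∑ i ∈ S, f i) = ∏ i ∈ S, Circle.exp (f i) := fun S f =>
    map_sum Circle.expHom f S
  rw [Finset.mul_sum, torusPow, hsum]
  refine Finset.prod_congr rfl fun i _ => ?_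
  rw [← Circle.exp_nsmul, nsmul_eq_mul]
  congr 1
  ring

/-- The spanning elements are eigenvectors of the dynamics, with eigenvalue an entire function of
time; this explicit form drives the KMS computation. -/
theorem dynamics_t_mul_star_t (r : Fin k → ℝ) (x : ℝ) (a b : Λ.Path) :
    dynamics r x (t a * star (t b)) =
      Complex.exp (Complex.I * x * ((∑ i, r i * Λ.d a i : ℝ) - (∑ i, r i * Λ.d b i : ℝ))) •
        (t a * star (t b)) := by
  rw [dynamics, gauge_t_mul_star_t, torusPow_exp, torusPow_exp]
  congr 1
  rw [Circle.coe_exp, Complex.star_def, ← Circle.coe_inv_eq_conj, ← Circle.exp_neg,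
    Circle.coe_exp, ← Complex.exp_add]
  congr 1
  push_cast
  ring

theorem dynamics_dynamics_neg [Λ.IsFinite] (r : Fin k → ℝ) (x : ℝ) (a : Toeplitz Λ) :
    dynamics r x (dynamics r (-x) a) = a := by
  induction a using induction_on with
  | hmem a b =>
    rw [dynamics_t_mul_star_t, map_smul, dynamics_t_mul_star_t, smul_smul, ← Complex.exp_add]
    convert one_smul ℂ _
    rw [← Complex.exp_zero]
    congr 1
    push_cast
    ring
  | hzero => simp only [map_zero]
  | hadd x y hx hy => simp only [map_add, hx, hy]
  | hsmul c x hx => simp only [map_smul, hx]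
  | hclosed =>
    have h : ∀ y, Continuous (dynamics (Λ := Λ) r y) := fun y =>
      NonUnitalStarAlgHom.instContinuousLinearMapClassComplex.map_continuous (dynamics r y)
    exact isClosed_eq ((h x).comp (h (-x))) continuous_id

/-! ### From the values on spanning elements to the KMS condition -/

section KMS

variable [Λ.IsFinite] {r : Fin k → ℝ} {κ : Λ.V → ℝ} {φ : Toeplitz Λ →L[ℂ] ℂ}

/-- The values `φ(t_a t_b⋆) = δ_{a,b} e^{-r · d(a)} κ_{s(a)}` of a functional. -/
def HasGibbsValues (φ : Toeplitz Λ →L[ℂ] ℂ) (r : Fin k → ℝ) (κ : Λ.V → ℝ) : Prop :=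
  (∀ a, φ (t a * star (t a)) = (expWeight r (Λ.d a) * κ (Λ.s a) : ℝ)) ∧
    ∀ a b, a ≠ b → φ (t a * star (t b)) = 0

open Classical in
-- In the expansion of the product over minimal extensions `(η, ζ)`, only the diagonal terms with `a
-- η = e ζ` have nonzero value.
theorem HasGibbsValues.map_mul (h : HasGibbsValues φ r κ) {a b c e : Λ.Path}
    (hab : Λ.s a = Λ.s b) (hce : Λ.s c = Λ.s e) :
    φ ((t a * star (t b)) * (t c * star (t e))) =
      ∑ p ∈ (Λ.finite_minExt b c).toFinset with Λ.compTotal a p.1 = Λ.compTotal e p.2,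
        ((expWeight r (Λ.d a) * expWeight r (Λ.d p.1) * κ (Λ.s p.1) : ℝ) : ℂ) := by
  rw [span_mul_span hab hce, map_sum, Finset.sum_filter]
  refine Finset.sum_congr rfl fun p hp => ?_
  obtain ⟨h1, -⟩ := (Set.Finite.mem_toFinset _).1 hp
  split_ifs with heq
  · rw [← heq, h.1, compTotal_eq (hab.trans h1), Λ.d_comp, Λ.s_comp, expWeight_add]
  · exact h.2 _ _ heq

/-- The KMS condition for two spanning elements, cleared of denominators. Swapping `(η, ζ)` matches
the terms of both sides, and their weights agree because `b η = c ζ`. -/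
theorem HasGibbsValues.map_mul_comm_of_span (h : HasGibbsValues φ r κ) (a b c e : Λ.Path) :
    (expWeight r (Λ.d b) : ℂ) * φ ((t a * star (t b)) * (t c * star (t e))) =
      (expWeight r (Λ.d a) : ℂ) * φ ((t c * star (t e)) * (t a * star (t b))) := by
  classical
  by_cases hab : Λ.s a = Λ.s b
  swap
  · rw [t_mul_star_t_eq_zero hab, zero_mul, mul_zero, map_zero, mul_zero, mul_zero]
  by_cases hce : Λ.s c = Λ.s e
  swap
  · rw [t_mul_star_t_eq_zero hce, zero_mul, mul_zero, map_zero, mul_zero, mul_zero]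
  rw [h.map_mul hab hce, h.map_mul hce hab, Finset.mul_sum, Finset.mul_sum]
  have hmem : ∀ {a b c e : Λ.Path} (p : Λ.Path × Λ.Path),
      p ∈ (Λ.finite_minExt b c).toFinset.filter
        (fun p => Λ.compTotal a p.1 = Λ.compTotal e p.2) ↔
      p ∈ Λ.minExt b c ∧ Λ.compTotal a p.1 = Λ.compTotal e p.2 := fun p => by
    rw [Finset.mem_filter, Set.Finite.mem_toFinset]
  refine Finset.sum_nbij' Prod.swap Prod.swap (fun p hp => ?_) (fun p hp => ?_)
    (fun _ _ => Prod.swap_swap _) (fun _ _ => Prod.swap_swap _) fun p hp => ?_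
  · rw [hmem] at hp ⊢
    exact swap_mem_minExt hce hab hp.1 hp.2
  · rw [hmem] at hp ⊢
    exact swap_mem_minExt hab hce hp.1 hp.2
  · rw [hmem] at hp
    obtain ⟨⟨h1, h2, h3, -⟩, -⟩ := hp
    have hd := congrArg (expWeight r) (congrArg Λ.d h3)
    rw [Λ.d_comp, Λ.d_comp, expWeight_add, expWeight_add] at hd
    have hs := congrArg Λ.s h3
    rw [Λ.s_comp, Λ.s_comp] at hs
    simp only [Prod.fst_swap]
    rw [← hs]
    norm_cast
    linear_combination expWeight r (Λ.d a) * κ (Λ.s p.1) * hd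

theorem HasGibbsValues.map_mul_comm (h : HasGibbsValues φ r κ) (a b : Λ.Path) (x : Toeplitz Λ) :
    (expWeight r (Λ.d b) : ℂ) * φ ((t a * star (t b)) * x) =
      (expWeight r (Λ.d a) : ℂ) * φ (x * (t a * star (t b))) := by
  induction x using induction_on with
  | hmem c e => exact h.map_mul_comm_of_span a b c e
  | hzero => simp only [mul_zero, zero_mul, map_zero]
  | hadd x y hx hy => rw [mul_add, add_mul, map_add, map_add, mul_add, mul_add, hx, hy]
  | hsmul c x hx =>
    rw [mul_smul_comm, smul_mul_assoc, map_smul, map_smul, smul_eq_mul, smul_eq_mul,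
      mul_left_comm, hx, mul_left_comm]
  | hclosed => exact isClosed_eq (by fun_prop) (by fun_prop)

/-- The functional is nonzero only at diagonal spanning elements `t_a t_a⋆`, which the dynamics
fixes. -/
theorem HasGibbsValues.map_dynamics (h : HasGibbsValues φ r κ) (y : ℝ) (x : Toeplitz Λ) :
    φ (dynamics r y x) = φ x := by
  induction x using induction_on with
  | hmem a b =>
    rw [dynamics_t_mul_star_t, map_smul, smul_eq_mul]
    rcases eq_or_ne a b with rfl | hab
    · rw [sub_self, mul_zero, Complex.exp_zero, one_mul]
    · rw [h.2 a b hab, mul_zero]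
  | hzero => simp only [map_zero]
  | hadd x y hx hy => rw [map_add, map_add, map_add, hx, hy]
  | hsmul c x hx => rw [map_smul, map_smul, map_smul, hx]
  | hclosed =>
    have : Continuous (dynamics (Λ := Λ) r y) :=
      NonUnitalStarAlgHom.instContinuousLinearMapClassComplex.map_continuous (dynamics r y)
    exact isClosed_eq (φ.continuous.comp this) φ.continuous

/-- The identity theorem, with real points accumulating at zero. -/
theorem eq_of_eqOn_real {F G : ℂ → ℂ} (hF : Differentiable ℂ F) (hG : Differentiable ℂ G)
    (h : ∀ x : ℝ, F x = G x) : F = G := by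
  have hF' : AnalyticOnNhd ℂ F Set.univ := fun z _ => hF.analyticAt z
  have hG' : AnalyticOnNhd ℂ G Set.univ := fun z _ => hG.analyticAt z
  refine hF'.eq_of_frequently_eq hG' (z₀ := 0) ?_
  have ht : Filter.Tendsto (fun x : ℝ => (x : ℂ)) (nhdsWithin 0 {0}ᶜ) (nhdsWithin 0 {0}ᶜ) := by
    refine tendsto_nhdsWithin_of_tendsto_nhds_of_eventually_within _ ?_ ?_
    · exact (Complex.continuous_ofReal.tendsto' 0 0 Complex.ofReal_zero).mono_left
        nhdsWithin_le_nhds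
    · filter_upwards [self_mem_nhdsWithin] with x hx
      simpa using hx
  exact ht.frequently (Filter.Eventually.of_forall h).frequently

/-- Invariance moves the dynamics from `x` to the eigenvector `y = t_a t_b⋆`, so for real `s` the
value at `y α_s(x)` is an exponential in `s` times that at `y x`. Both sides are entire in `s`; at
`s = i` the exponential is the factor of `map_mul_comm`. -/
theorem HasGibbsValues.map_mul_entire (h : HasGibbsValues φ r κ) {x : Toeplitz Λ}
    {f : ℂ → Toeplitz Λ} (hf : IsEntireExtension r x f) (a b : Λ.Path) :
    φ (x * (t a * star (t b))) = φ ((t a * star (t b)) * f Complex.I) := by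
  set c : ℂ := ((∑ i, r i * Λ.d a i : ℝ) : ℂ) - (∑ i, r i * Λ.d b i : ℝ) with hc
  set y := t a * star (t b) with hy
  have hreal : ∀ s : ℝ, φ (y * f s) = Complex.exp (-(Complex.I * s * c)) * φ (y * x) := by
    intro s
    have hdy : dynamics r (-s) y = Complex.exp (-(Complex.I * s * c)) • y := by
      rw [hy, dynamics_t_mul_star_t, ← hc]
      congr 2
      push_cast
      ring
    rw [hf.2 s]
    -- This uses that `α_s` is multiplicative and inverts `α_{-s}`.
    have e1 : y * dynamics r s x = dynamics r s (dynamics r (-s) y * x) := by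
      rw [_root_.map_mul, dynamics_dynamics_neg]
    rw [e1, h.map_dynamics, hdy, smul_mul_assoc, map_smul, smul_eq_mul]
  have hall := eq_of_eqOn_real (F := fun z => φ (y * f z))
    (G := fun z => Complex.exp (-(Complex.I * z * c)) * φ (y * x))
    ((φ.comp (ContinuousLinearMap.mul ℂ (Toeplitz Λ) y)).differentiable.comp hf.1) (by fun_prop) hreal
  have hI := congrFun hall Complex.I
  beta_reduce at hI
  rw [hI]
  have hcomm := h.map_mul_comm a b x
  rw [← hy] at hcomm
  have ha : (expWeight r (Λ.d a) : ℂ) ≠ 0 := by exact_mod_cast (expWeight_pos r (Λ.d a)).ne'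
  refine mul_left_cancel₀ ha ?_
  rw [← hcomm, ← mul_assoc]
  congr 1
  rw [expWeight, expWeight, Complex.ofReal_exp, Complex.ofReal_exp, ← Complex.exp_add]
  congr 1
  rw [Complex.I_mul_I, hc]
  push_cast
  ring

/-- For a fixed entire extension of the first element the identity is linear and continuous in the
second, so spanning elements suffice. -/
theorem HasGibbsValues.isKMSState (h : HasGibbsValues φ r κ) (hφ : IsState φ) :
    IsKMSState r 1 φ := by
  refine ⟨hφ, fun x y f _ hf _ => ?_⟩
  rw [Complex.ofReal_one, mul_one]
  clear * - h hf
  induction y using induction_on with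
  | hmem a b => exact h.map_mul_entire hf a b
  | hzero => rw [mul_zero, zero_mul]
  | hadd y z hy hz => rw [mul_add, add_mul, map_add, map_add, hy, hz]
  | hsmul c y hy => rw [mul_smul_comm, smul_mul_assoc, map_smul, map_smul, hy]
  | hclosed => exact isClosed_eq (by fun_prop) (by fun_prop)

end KMS

end Toeplitz

end KGraph

/-! ### Assembly of the theorem -/

theorem corollary5p5 {k : ℕ} (Λ : KGraph.{u} k) [Λ.IsFinite] [Fintype Λ.V] [DecidableEq Λ.V]
    [Nonempty Λ.V] (hsources : Λ.NoSources) (hirr : Λ.CoordinatewiseIrreducible)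
    (K : Finset (Fin k)) (hK : K.Nonempty) (hJ : Kᶜ.Nonempty)
    (r : Fin k → ℝ) (hr : ∀ i, 0 < r i)
    (hrJ : ∀ j ∉ K, Real.log (Λ.rho j) < r j)
    (hrK : ∀ i ∈ K, r i = Real.log (Λ.rho i)) :
    ∃ κ : Λ.V → ℝ, Λ.IsPerronFrobenius κ ∧
    ∃ ν : ({j // j ∉ K} → ℕ) → MeasureTheory.Measure (Λ.Boundary K),
      (∀ m, ν m (KGraph.Boundary.level Λ K m)ᶜ = 0 ∧
        ∀ a : Λ.Path, (∀ j : {j // j ∉ K}, Λ.d a j = m j) →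
          ν m (KGraph.Boundary.cyl K a) =
            ENNReal.ofReal (KGraph.expWeight r (Λ.d a) * Λ.constJ K r * κ (Λ.s a))) ∧
    ∃ φ : KGraph.Toeplitz Λ →L[ℂ] ℂ,
      KGraph.Toeplitz.IsKMSState r 1 φ ∧
      (∀ a, HasSum (fun m => ∫ x, KGraph.Toeplitz.vectorState K (KGraph.Toeplitz.expectation a) x ∂ν m) (φ a)) ∧
      (∀ σ, φ (KGraph.Toeplitz.t σ * star (KGraph.Toeplitz.t σ)) = (KGraph.expWeight r (Λ.d σ) * κ (Λ.s σ) : ℝ)) ∧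
      (∀ σ τ, σ ≠ τ → φ (KGraph.Toeplitz.t σ * star (KGraph.Toeplitz.t τ)) = 0) ∧
      ∃ μ : MeasureTheory.Measure (Λ.Boundary K), MeasureTheory.IsProbabilityMeasure μ ∧
        (∀ a, MeasureTheory.Integrable (KGraph.Toeplitz.vectorState K (KGraph.Toeplitz.expectation a)) μ ∧
          φ a = ∫ x, KGraph.Toeplitz.vectorState K (KGraph.Toeplitz.expectation a) x ∂μ) ∧
        ∀ σ, φ (KGraph.Toeplitz.t σ * star (KGraph.Toeplitz.t σ)) = (μ.real (KGraph.Boundary.cyl K σ) : ℂ) := by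
  obtain ⟨i₀, hi₀⟩ := hK
  obtain ⟨κ, hκ⟩ := KGraph.exists_isPerronFrobenius hirr i₀
  have hρ := hκ.rho_pos hsources
  -- The critical coordinates have ratio exactly one, and the others, treated next, ratio below one:
  -- conservation along `K` and convergence along `J`.
  have hqK : ∀ i ∈ K, Real.exp (-r i) * Λ.rho i = 1 := fun i hi => by
    rw [hrK i hi, Real.exp_neg, Real.exp_log (hρ i), inv_mul_cancel₀ (hρ i).ne']
  have hqJ : ∀ j ∉ K, Real.exp (-r j) * Λ.rho j < 1 := fun j hj => by
    have h := (Real.log_lt_iff_lt_exp (hρ j)).1 (hrJ j hj)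
    rw [Real.exp_neg, inv_mul_lt_one₀ (Real.exp_pos _)]
    exact h
  obtain ⟨ν, hν, hμ, hprob⟩ := (hκ.isWeight hsources r).exists_boundaryMeasure hqK hqJ
  have hself : ∀ σ, (MeasureTheory.Measure.sum ν).real (KGraph.Boundary.cyl K σ) =
      KGraph.expWeight r (Λ.d σ) * κ (Λ.s σ) := fun σ => by
    rw [MeasureTheory.measureReal_def, hμ,
      ENNReal.toReal_ofReal (mul_pos (KGraph.expWeight_pos _ _) (hκ.1 _)).le]
  have hgibbs : KGraph.Toeplitz.HasGibbsValues
      (KGraph.Toeplitz.measureState (MeasureTheory.Measure.sum ν)) r κ :=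
    ⟨fun σ => by rw [KGraph.Toeplitz.measureState_t_mul_star_t_self, hself],
      fun σ τ h => KGraph.Toeplitz.measureState_t_mul_star_t_of_ne h⟩
  refine ⟨κ, hκ, ν, fun m => ⟨(hν m).1, fun a ha => ?_⟩,
    KGraph.Toeplitz.measureState (MeasureTheory.Measure.sum ν),
    hgibbs.isKMSState KGraph.Toeplitz.isState_measureState, fun a => ?_, hgibbs.1, hgibbs.2,
    MeasureTheory.Measure.sum ν, hprob, fun a => ⟨?_, ?_⟩,
    fun σ => KGraph.Toeplitz.measureState_t_mul_star_t_self σ⟩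
  · rw [(hν m).2 a ha, KGraph.constJ, mul_right_comm]
  -- The series over levels is the integral against the sum of the measures `ν m`, split by
  -- countable additivity in the measure.
  · exact MeasureTheory.hasSum_integral_measure
      (KGraph.Toeplitz.integrable_vectorState_expectation _ a)
  · exact KGraph.Toeplitz.integrable_vectorState_expectation _ a
  · exact KGraph.Toeplitz.measureState_apply _ a
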